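/- **Setting.** Let $H$ be a real separable Hilbert space and $\mathcal A^{-1}\colon H\to H$ a compact, self-adjoint, positive definite operator with positive square root $\mathcal A^{-1/2}$. Let $V=D(\mathcal A^{1/2})=\operatorname{range}\mathcal A^{-1/2}$, $a(\zeta,\varphi)=\langle\mathcal A^{1/2}\zeta,\mathcal A^{1/2}\varphi\rangle_H$ and $\|v\|_V=a(v,v)^{1/2}$. Let $\mathcal B\colon H\to\mathbb R^\beta$ be bounded linear and $\Gamma\in\mathbb R^{\beta\times\beta}$ symmetric positive definite. Let $V_0\subset V_1\subset\dots\subset V$ be finite-dimensional subspaces with bases $\{\phi^\ell_j\}_{j\le n_\ell}$, and put $P_\ell x=\sum_j x_j\phi^\ell_j$. Define the matrices $$(A_\ell)_{jk}=a(\phi_j^\ell,\phi_k^\ell),\quad (B_\ell)_{jk}=(\mathcal B\phi^\ell_j)_k,\quad \widetilde A_\ell=A_\ell+B_\ell\Gamma^{-1}B_\ell^\top ,$$ and let $I_{\ell-1}^\ell$ be the matrix of $P_\ell^{-1}P_{\ell-1}$. Write $A_\ell=D_\ell+L_\ell+L_\ell^\top$ with $D_\ell$ diagonal and $L_\ell$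 strictly lower triangular. For $y\in\mathbb R^\beta$ let $\widetilde\mu_L=A_L^{-1}B_L(\Gamma+B_L^\top A_L^{-1}B_L)^{-1}y$ and $f_L=B_L\Gamma^{-1}y$. For $\chi\in H$ let $(F_L)_j=\langle\phi_j^L,\chi\rangle_H$. **Assumptions.** 1. There are constants $c_1,c_2>0$ and a decreasing $\Phi\colon\mathbb N_0\to[0,\infty)$ with $c_1\|P_\ell x\|_H\le\Phi(\ell)\|x\|_2\le c_2\|P_\ell x\|_H$ for all $\ell\ge 0$ and $x\in\mathbb R^{n_\ell}$. 2. There are a subspace $W\subset V$ with a norm $\|\cdot\|_W$, a constant $C_{\mathcal A}>0$ and a decreasing $\Psi\colon\mathbb N_0\to[0,\infty)$ such that: (a) for every $f\in H$ the solution $u\in V$ of $a(u,\varphi)=\langle f,\varphi\rangle_H$ for all $\varphi\in V$ lies in $W$, with $\|u\|_W\le C_{\mathcal A}\|f\|_H$; (b) $\inf_{w_\ell\in V_\ell}\|w-w_\ell\|_V\le\sqrt{\Psi(\ell)}\,\|w\|_W$ for all $w\in W$ and $\ell\ge0$. 3. There is $C_\Psi>1$ with $\Psi(\ell-1)\le C_\Psi\Psi(\ell)$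 for all $\ell\ge1$, and $\sqrt{\Psi(\ell)}\,\|\varphi\|_V\le\|\varphi\|_H$ for all $\varphi\in V_\ell$ and $\ell\ge0$. 4. There is a constant $c$ independent of $\ell$ such that the symmetric Gauss–Seidel matrices $M^{\rm(SGS)}_\ell=(D_\ell+L_\ell)D_\ell^{-1}(D_\ell+L_\ell^\top)$ of the prior satisfy $\|M^{\rm(SGS)}_\ell\|_2\le c\,\|A_\ell\|_2$ for all $\ell\ge1$. **Algorithm.** Fix $k\ge1$. For $L\ge 0$, consider the multigrid Monte Carlo (MGMC) V-cycle for $\mathcal N(\widetilde\mu_L,\widetilde A_L^{-1})$. * On level $\ell=0$ it draws an exact sample of $\mathcal N(\widetilde A_0^{-1}f_0,\widetilde A_0^{-1})$. * On a level $\ell\ge1$ with right-hand side $f_\ell$ it performs $k$ random pre-smoothing steps, then a coarse correction, then $k$ random post-smoothing steps. * A smoothing step is $\theta\mapsto\theta+\widetilde M_\ell^{-1}(f_\ell+\xi-\widetilde A_\ell\theta)$ with $\xi\sim\mathcal N(0,\widetilde M_\ell+\widetilde M_\ell^\top-\widetilde A_\ell)$, where $\widetilde M_\ell$ is the low-rank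 symmetric Gauss–Seidel matrix $$\widetilde M_\ell=(D_\ell+B_\ell\Gamma^{-1}B_\ell^\top+L_\ell)(D_\ell+B_\ell\Gamma^{-1}B_\ell^\top)^{-1}(D_\ell+B_\ell\Gamma^{-1}B_\ell^\top+L_\ell^\top).$$ * The coarse correction is $\theta\mapsto\theta+I_{\ell-1}^\ell\psi$, where $\psi$ is the output of one MGMC update on level $\ell-1$ started at $0$ with right-hand side $(I_{\ell-1}^\ell)^\top(f_\ell-\widetilde A_\ell\theta)$. All draws are independent. Let $\theta^{(0)}_L,\theta^{(1)}_L,\dots$ be a chain generated by these updates on level $L$ with right-hand side $f_L$, from a square-integrable $\theta_L^{(0)}$ independent of the draws. Let $\widetilde X_L$ be the iteration matrix, defined by $\widetilde X_0=0$ and $$\widetilde X_\ell=S_\ell^k\bigl(I-I_{\ell-1}^\ell R_\ell+I_{\ell-1}^\ell\widetilde X_{\ell-1}R_\ell\bigr)S_\ell^k,\quad S_\ell=\widetilde M_\ell^{-1}(\widetilde M_\ell-\widetilde A_\ell),\quad R_\ell=\widetilde A_{\ell-1}^{-1}(I_{\ell-1}^\ell)^\top\widetilde A_\ell ,$$ and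 let $\sigma_L=\|\widetilde A_L^{1/2}\widetilde X_L\widetilde A_L^{-1/2}\|_2$. For $F_L\ne0$ put $$\tau^{(m)}_{L}=1+2\sum_{s\ge1}\frac{\operatorname{Cov}(F_L^\top\theta_L^{(m+s)},F_L^\top\theta_L^{(m)})}{\operatorname{Cov}(F_L^\top\theta_L^{(m)},F_L^\top\theta_L^{(m)})},\qquad \tau_{L}=1+2\sum_{s\ge1}\frac{F_L^\top\widetilde X_L^s\widetilde A_L^{-1}F_L}{F_L^\top\widetilde A_L^{-1}F_L}.$$ **Theorem.** Under Assumptions 1–4 there is $q\in[0,1)$ with $\sigma_L\le q$ for all $L$. Moreover, for every $C_0$ the following hold. * (IACT) There is $C>0$ such that for all $\chi\in H$ and $L$ with $F_L\neq0$ the series for $\tau_L$ converges and $\tau_L\le\frac{1+\sigma_L}{1-\sigma_L}$. If $\theta_L^{(0)}\sim\mathcal N(\widetilde\mu_L,\widetilde A_L^{-1})$, then $\tau_L^{(m)}=\tau_L$ for all $m\ge0$. If $\max\{\|\widetilde A_L^{1/2}\mathbb E[\theta_L^{(0)}]\|_2,\|\widetilde A_L^{1/2}\operatorname{Cov}(\theta_L^{(0)})\widetilde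 A_L^{1/2}\|_2\}<C_0$, then for all $m\ge1$ $$|\tau_L^{(m)}-\tau_L|\le C\,\frac{\sigma_L^{2m+1}}{(1-\sigma_L)(1-\sigma_L^{2m})}.$$ Here the variances in the denominators of $\tau_L^{(m)}$ are positive and the series converge. * (RMSE) For every $\chi\in H$ there is a function $r\mapsto C(r)>0$ such that for all $L$, all $y\in\mathbb R^\beta$, all chains satisfying the same bound on the moments of $\theta_L^{(0)}$, and all $M\ge1$, $$\sqrt{\mathbb E\Bigl[\Bigl|\mathbb E[F_L^\top\theta]-\frac1M\sum_{m=1}^MF_L^\top\theta_L^{(m)}\Bigr|^2\Bigr]}\le\frac{C(\|y\|_2)}{\sqrt M},\qquad\theta\sim\mathcal N(\widetilde\mu_L,\widetilde A_L^{-1}).$$ -/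

import Mathlib

open MeasureTheory ProbabilityTheory Matrix
open scoped InnerProductSpace MatrixOrder Matrix.Norms.L2Operator

noncomputable section

namespace MGMC

/-- Coefficient vectors, with the Euclidean norm. Matrices carry the induced (spectral) norm. -/
abbrev Vec (n : ℕ) : Type := EuclideanSpace ℝ (Fin n)

/-- The matrix-vector product. -/
def mv {m n : ℕ} (A : Matrix (Fin m) (Fin n) ℝ) (x : Vec n) : Vec m :=
  WithLp.toLp 2 (A *ᵥ x.ofLp)

/-! ### Matrix splittings -/

section Splitting

variable {n : ℕ}

/-- The diagonal part of a matrix. -/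
def diagPart (A : Matrix (Fin n) (Fin n) ℝ) : Matrix (Fin n) (Fin n) ℝ :=
  Matrix.diagonal fun i => A i i

/-- The strictly lower triangular part of a matrix. -/
def lowerPart (A : Matrix (Fin n) (Fin n) ℝ) : Matrix (Fin n) (Fin n) ℝ :=
  Matrix.of fun i j => if j < i then A i j else 0

/-- The splitting matrix `(D + L) D⁻¹ (D + Lᵀ)` of a symmetric Gauss-Seidel sweep. -/
def sgsSplitting (D L : Matrix (Fin n) (Fin n) ℝ) : Matrix (Fin n) (Fin n) ℝ :=
  (D + L) * D⁻¹ * (D + Lᵀ)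

/-- The energy norm `‖A^{1/2} X A^{-1/2}‖₂` of a matrix `X`. -/
def energyNorm (A X : Matrix (Fin n) (Fin n) ℝ) : ℝ :=
  ‖CFC.sqrt A * X * (CFC.sqrt A)⁻¹‖

/-- One update `θ ↦ θ + M⁻¹ (f + ξ - A θ)` of the random smoother with draw `ξ`. -/
def randomSmoother (A M : Matrix (Fin n) (Fin n) ℝ) (f ξ θ : Vec n) : Vec n :=
  θ + mv M⁻¹ (f + ξ - mv A θ)

/-- The random smoother applied successively with the draws `ξ 0, …, ξ (k - 1)`. -/
def smoothing (A M : Matrix (Fin n) (Fin n) ℝ) (f : Vec n) (ξ : ℕ → Vec n) : ℕ → Vec n → Vec n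
  | 0, θ => θ
  | j + 1, θ => randomSmoother A M f (ξ j) (smoothing A M f ξ j θ)

end Splitting

/-! ### The linear Bayesian inverse problem and its discretisation -/

/-- A Gaussian prior `N(0, 𝒜⁻¹)` (with `cov = 𝒜⁻¹` compact, self-adjoint, positive definite and
`sqrtCov = 𝒜^{-1/2}` its positive square root), a bounded observation operator `obs` with noise
covariance `Γ`, and a nested sequence of finite-dimensional subspaces `space ℓ` of
`V = D(𝒜^{1/2}) = range 𝒜^{-1/2}`, each with a basis. -/
structure InverseProblem (H : Type*) [NormedAddCommGroup H] [InnerProductSpace ℝ H]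
    [CompleteSpace H] (β : ℕ) where
  cov : H →L[ℝ] H
  cov_compact : IsCompactOperator cov
  cov_selfAdjoint : IsSelfAdjoint cov
  cov_pos : ∀ x : H, x ≠ 0 → 0 < ⟪cov x, x⟫_ℝ
  sqrtCov : H →L[ℝ] H
  sqrtCov_isPositive : sqrtCov.IsPositive
  sqrtCov_sq : sqrtCov ∘L sqrtCov = cov
  obs : H →L[ℝ] Vec β
  Γ : Matrix (Fin β) (Fin β) ℝ
  Γ_posDef : Γ.PosDef
  n : ℕ → ℕ
  space : ℕ → Submodule ℝ (LinearMap.range (sqrtCov : H →ₗ[ℝ] H))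
  space_le : ∀ ℓ, space ℓ ≤ space (ℓ + 1)
  basis : ∀ ℓ, Module.Basis (Fin (n ℓ)) ℝ (space ℓ)

namespace InverseProblem

variable {H : Type*} [NormedAddCommGroup H] [InnerProductSpace ℝ H] [CompleteSpace H] {β : ℕ}
  (p : InverseProblem H β)

theorem sqrtCov_injective : Function.Injective (p.sqrtCov : H →ₗ[ℝ] H) := by
  refine (injective_iff_map_eq_zero _).2 fun x hx => ?_
  by_contra hne
  have h := p.cov_pos x hne
  have hx' : p.sqrtCov x = 0 := hx
  rw [← p.sqrtCov_sq, ContinuousLinearMap.comp_apply, hx', map_zero, inner_zero_left] at h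
  exact lt_irrefl _ h

/-- The space `V = D(𝒜^{1/2})`, the range of `𝒜^{-1/2}`. -/
abbrev V : Submodule ℝ H := LinearMap.range (p.sqrtCov : H →ₗ[ℝ] H)

/-- The operator `𝒜^{1/2} : V → H`, the inverse of `𝒜^{-1/2}`. -/
def sqrtA : p.V →ₗ[ℝ] H :=
  (LinearEquiv.ofInjective (p.sqrtCov : H →ₗ[ℝ] H) p.sqrtCov_injective).symm

/-- The bilinear form `a(ζ, φ) = ⟨𝒜^{1/2} ζ, 𝒜^{1/2} φ⟩`. -/
def a (ζ φ : p.V) : ℝ := ⟪p.sqrtA ζ, p.sqrtA φ⟫_ℝ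

/-- The norm `‖v‖_V = a(v, v)^{1/2}`. -/
def normV (v : p.V) : ℝ := √(p.a v v)

/-- `u ∈ V` solves `a(u, φ) = ⟨f, φ⟩` for all `φ ∈ V`. -/
def IsWeakSolution (f : H) (u : p.V) : Prop :=
  ∀ φ : p.V, p.a u φ = ⟪f, (φ : H)⟫_ℝ

/-- The basis functions. -/
def φ (ℓ : ℕ) (j : Fin (p.n ℓ)) : p.V := (p.basis ℓ j : p.V)

/-- The map `P_ℓ x = ∑ j, x j φ_j`. -/
def Pmap (ℓ : ℕ) (x : Vec (p.n ℓ)) : p.V := ∑ j, x j • p.φ ℓ j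

/-- The prior precision matrix on level `ℓ`. -/
def A (ℓ : ℕ) : Matrix (Fin (p.n ℓ)) (Fin (p.n ℓ)) ℝ :=
  Matrix.of fun j k => p.a (p.φ ℓ j) (p.φ ℓ k)

/-- The matrix of the observation operator on level `ℓ`. -/
def B (ℓ : ℕ) : Matrix (Fin (p.n ℓ)) (Fin β) ℝ :=
  Matrix.of fun j k => p.obs (p.φ ℓ j : H) k

/-- The posterior precision matrix on level `ℓ`. -/
def postA (ℓ : ℕ) : Matrix (Fin (p.n ℓ)) (Fin (p.n ℓ)) ℝ :=
  p.A ℓ + p.B ℓ * p.Γ⁻¹ * (p.B ℓ)ᵀ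

/-- The posterior mean on level `ℓ` for the observation `y`. -/
def postMean (ℓ : ℕ) (y : Vec β) : Vec (p.n ℓ) :=
  mv ((p.A ℓ)⁻¹ * p.B ℓ * (p.Γ + (p.B ℓ)ᵀ * (p.A ℓ)⁻¹ * p.B ℓ)⁻¹) y

/-- The posterior distribution on level `ℓ`. -/
def posterior (ℓ : ℕ) (y : Vec β) : Measure (Vec (p.n ℓ)) :=
  multivariateGaussian (p.postMean ℓ y) (p.postA ℓ)⁻¹

/-- The right-hand side `f_ℓ = B_ℓ Γ⁻¹ y`. -/
def rhs (ℓ : ℕ) (y : Vec β) : Vec (p.n ℓ) := mv (p.B ℓ * p.Γ⁻¹) y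

/-- The vector of the functional `⟨·, χ⟩` on level `ℓ`. -/
def F (χ : H) (ℓ : ℕ) : Vec (p.n ℓ) := WithLp.toLp 2 fun j => ⟪(p.φ ℓ j : H), χ⟫_ℝ

/-- The canonical prolongation, the matrix of `P_{ℓ+1}⁻¹ P_ℓ`. -/
def prolong (ℓ : ℕ) : Matrix (Fin (p.n (ℓ + 1))) (Fin (p.n ℓ)) ℝ :=
  Matrix.of fun j k =>
    (p.basis (ℓ + 1)).repr ⟨p.φ ℓ k, p.space_le ℓ (p.basis ℓ k).2⟩ j

/-- The symmetric Gauss-Seidel splitting matrix of the prior precision matrix. -/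
def sgs (ℓ : ℕ) : Matrix (Fin (p.n ℓ)) (Fin (p.n ℓ)) ℝ :=
  sgsSplitting (diagPart (p.A ℓ)) (lowerPart (p.A ℓ))

/-- The low-rank symmetric Gauss-Seidel splitting matrix of the posterior precision matrix,
`(D + B Γ⁻¹ Bᵀ + L) (D + B Γ⁻¹ Bᵀ)⁻¹ (D + B Γ⁻¹ Bᵀ + Lᵀ)`, where `A = D + L + Lᵀ`. -/
def postSgs (ℓ : ℕ) : Matrix (Fin (p.n ℓ)) (Fin (p.n ℓ)) ℝ :=
  sgsSplitting (diagPart (p.A ℓ) + p.B ℓ * p.Γ⁻¹ * (p.B ℓ)ᵀ) (lowerPart (p.A ℓ))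

/-! ### Assumptions on the discretisation -/

/-- Norm equivalence for the bases. -/
def NormEquivalence : Prop :=
  ∃ (Φ : ℕ → ℝ) (c₁ c₂ : ℝ), Antitone Φ ∧ (∀ ℓ, 0 ≤ Φ ℓ) ∧ 0 < c₁ ∧ 0 < c₂ ∧
    ∀ (ℓ : ℕ) (x : Vec (p.n ℓ)),
      c₁ * ‖(p.Pmap ℓ x : H)‖ ≤ Φ ℓ * ‖x‖ ∧ Φ ℓ * ‖x‖ ≤ c₂ * ‖(p.Pmap ℓ x : H)‖

/-- Regularity of weak solutions in a normed subspace `W` of `V`, and approximation of the elements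
of `W` in `V_ℓ` with rate `√Ψ(ℓ)`. -/
def RegularityApproximation (Ψ : ℕ → ℝ) : Prop :=
  ∃ (W : Submodule ℝ p.V) (normW : Seminorm ℝ W), (∀ w, normW w = 0 → w = 0) ∧
    (∃ C : ℝ, 0 < C ∧ ∀ (f : H) (u : p.V), p.IsWeakSolution f u →
      ∃ hu : u ∈ W, normW ⟨u, hu⟩ ≤ C * ‖f‖) ∧
    Antitone Ψ ∧ (∀ ℓ, 0 ≤ Ψ ℓ) ∧
    ∀ (ℓ : ℕ) (w : W), ⨅ v : p.space ℓ, p.normV ((w : p.V) - (v : p.V)) ≤ √(Ψ ℓ) * normW w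

/-- Comparability of `Ψ` on consecutive levels, and the inverse inequality
`‖φ‖_V ≤ ‖φ‖_H / √Ψ(ℓ)` on `V_ℓ`. -/
def InverseInequality (Ψ : ℕ → ℝ) : Prop :=
  (∃ C : ℝ, 1 < C ∧ ∀ ℓ, Ψ ℓ ≤ C * Ψ (ℓ + 1)) ∧
    ∀ (ℓ : ℕ) (v : p.V), v ∈ p.space ℓ → √(Ψ ℓ) * p.normV v ≤ ‖(v : H)‖

/-! ### The multigrid Monte Carlo algorithm -/

/-- One V-cycle update `θ ↦ MGMC_ℓ(f, θ)` for the posterior, with an exact sampler on level `0` and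
`k` pre- and `k` post-smoothing steps on every level above. The exact sampler uses the draw `ζ`;
`ξ ℓ false j` and `ξ ℓ true j` are the draws of the `j`-th pre- and post-smoothing step on level
`ℓ + 1`. -/
def vCycle (k : ℕ) (ζ : Vec (p.n 0)) (ξ : (ℓ : ℕ) → Bool → ℕ → Vec (p.n (ℓ + 1))) :
    (ℓ : ℕ) → Vec (p.n ℓ) → Vec (p.n ℓ) → Vec (p.n ℓ)
  | 0, f, _ => mv (p.postA 0)⁻¹ f + ζ
  | ℓ + 1, f, θ =>
    let θpre := smoothing (p.postA (ℓ + 1)) (p.postSgs (ℓ + 1)) f (ξ ℓ false) k θ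
    let fc := mv (p.prolong ℓ)ᵀ (f - mv (p.postA (ℓ + 1)) θpre)
    let ψ := vCycle k ζ ξ ℓ fc 0
    smoothing (p.postA (ℓ + 1)) (p.postSgs (ℓ + 1)) f (ξ ℓ true) k (θpre + mv (p.prolong ℓ) ψ)

/-- The iteration matrix of the V-cycle. -/
def iterMatrix (k : ℕ) : (ℓ : ℕ) → Matrix (Fin (p.n ℓ)) (Fin (p.n ℓ)) ℝ
  | 0 => 0
  | ℓ + 1 =>
    let S := (p.postSgs (ℓ + 1))⁻¹ * (p.postSgs (ℓ + 1) - p.postA (ℓ + 1))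
    let R := (p.postA ℓ)⁻¹ * (p.prolong ℓ)ᵀ * p.postA (ℓ + 1)
    let T := 1 - p.prolong ℓ * R
    S ^ k * (T + p.prolong ℓ * iterMatrix k ℓ * R) * S ^ k

/-- Indices of all Gaussian draws of a chain on level `L`: the step of the chain, and then either
the draw of the coarse sampler or a level `ℓ + 1 ≤ L`, pre/post, and a smoothing step. -/
abbrev DrawIndex (L k : ℕ) : Type := ℕ × Option (Fin L × Bool × Fin k)

/-- The dimension of a draw. -/
def drawDim (L k : ℕ) : DrawIndex L k → ℕ
  | (_, none) => p.n 0
  | (_, some (ℓ, _, _)) => p.n (ℓ + 1)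

/-- The family of all draws of a chain on level `L`. -/
def draws {Ω : Type*} (L k : ℕ) (ζ : ℕ → Ω → Vec (p.n 0))
    (ξ : ℕ → (ℓ : ℕ) → Bool → ℕ → Ω → Vec (p.n (ℓ + 1))) :
    (i : DrawIndex L k) → Ω → Vec (p.drawDim L k i)
  | (m, none) => ζ m
  | (m, some (ℓ, b, j)) => ξ m ℓ b j

/-- `θ 0, θ 1, …` is a Markov chain generated by the MGMC update on level `L` for the posterior with
observation `y`, from a square integrable initial state that is independent of all the draws. The
draws are independent, those of the coarse sampler have law `N(0, Ã₀⁻¹)`, those of the smoother with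
splitting matrix `M` on level `ℓ + 1` have law `N(0, M + Mᵀ - Ã)`. -/
def IsMGMCChain {Ω : Type*} [MeasurableSpace Ω] (k L : ℕ) (y : Vec β) (P : Measure Ω)
    (θ : ℕ → Ω → Vec (p.n L)) : Prop :=
  ∃ (ζ : ℕ → Ω → Vec (p.n 0)) (ξ : ℕ → (ℓ : ℕ) → Bool → ℕ → Ω → Vec (p.n (ℓ + 1))),
    (∀ i, Measurable (p.draws L k ζ ξ i)) ∧
    (∀ m, HasLaw (ζ m) (multivariateGaussian 0 (p.postA 0)⁻¹) P) ∧
    (∀ m, ∀ ℓ < L, ∀ b, ∀ j < k, HasLaw (ξ m ℓ b j)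
      (multivariateGaussian 0
        (p.postSgs (ℓ + 1) + (p.postSgs (ℓ + 1))ᵀ - p.postA (ℓ + 1))) P) ∧
    iIndepFun (p.draws L k ζ ξ) P ∧
    Measurable (θ 0) ∧ MemLp (θ 0) 2 P ∧
    IndepFun (θ 0) (fun ω i => p.draws L k ζ ξ i ω) P ∧
    ∀ m ω, θ (m + 1) ω =
      p.vCycle k (ζ m ω) (fun ℓ b j => ξ m ℓ b j ω) L (p.rhs L y) (θ m ω)

/-- The covariance matrix of a random vector. -/
def covMatrix {Ω : Type*} [MeasurableSpace Ω] {n : ℕ} (P : Measure Ω) (X : Ω → Vec n) :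
    Matrix (Fin n) (Fin n) ℝ :=
  Matrix.of fun i j => cov[fun ω => X ω i, fun ω => X ω j; P]

/-- The moment bound on the initial state, in the energy norm of the posterior precision matrix. -/
def InitialBound {Ω : Type*} [MeasurableSpace Ω] (L : ℕ) (P : Measure Ω) (C₀ : ℝ)
    (θ₀ : Ω → Vec (p.n L)) : Prop :=
  max ‖mv (CFC.sqrt (p.postA L)) (∫ ω, θ₀ ω ∂P)‖
    ‖CFC.sqrt (p.postA L) * covMatrix P θ₀ * CFC.sqrt (p.postA L)‖ < C₀

/-! ### Integrated autocorrelation time and Monte Carlo estimator -/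

/-- The autocorrelation at lag `s` of the scalar process `Q 0, Q 1, …` at time `m`. -/
def autocorr {Ω : Type*} [MeasurableSpace Ω] (P : Measure Ω) (Q : ℕ → Ω → ℝ) (m s : ℕ) : ℝ :=
  cov[Q (m + s), Q m; P] / cov[Q m, Q m; P]

/-- `τ` is the integrated autocorrelation time `1 + 2 ∑_{s ≥ 1} autocorr s` at time `m`: the variance
in the denominator is positive and the series converges with this value. -/
def HasIACT {Ω : Type*} [MeasurableSpace Ω] (P : Measure Ω) (Q : ℕ → Ω → ℝ) (m : ℕ) (τ : ℝ) : Prop :=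
  0 < cov[Q m, Q m; P] ∧ Summable (fun s : ℕ => autocorr P Q m (s + 1)) ∧
    τ = 1 + 2 * ∑' s : ℕ, autocorr P Q m (s + 1)

/-- The quantity of interest `F_Lᵀ θ` along the chain. -/
def qoi {Ω : Type*} (χ : H) (L : ℕ) (θ : ℕ → Ω → Vec (p.n L)) (m : ℕ) (ω : Ω) : ℝ :=
  ⟪p.F χ L, θ m ω⟫_ℝ

/-- `τ` equals `1 + 2 ∑_{s ≥ 1} (Fᵀ X^s Ã⁻¹ F) / (Fᵀ Ã⁻¹ F)`, with a convergent series, where `X` is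
the iteration matrix on level `L`. -/
def IsTauInt (k L : ℕ) (χ : H) (τ : ℝ) : Prop :=
  HasSum (fun s : ℕ =>
    ⟪p.F χ L, mv (p.iterMatrix k L ^ (s + 1) * (p.postA L)⁻¹) (p.F χ L)⟫_ℝ /
      ⟪p.F χ L, mv (p.postA L)⁻¹ (p.F χ L)⟫_ℝ) ((τ - 1) / 2)

/-- The energy norm of the iteration matrix on level `L`. -/
def rate (k L : ℕ) : ℝ := energyNorm (p.postA L) (p.iterMatrix k L)

/-- The Monte Carlo estimator `(1/M) ∑_{m=1}^M F_Lᵀ θ_m`. -/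
def estimator {Ω : Type*} (χ : H) (L : ℕ) (θ : ℕ → Ω → Vec (p.n L)) (M : ℕ) (ω : Ω) : ℝ :=
  (1 / (M : ℝ)) * ∑ m ∈ Finset.Icc 1 M, p.qoi χ L θ m ω

/-- The posterior mean of the quantity of interest. -/
def target (χ : H) (L : ℕ) (y : Vec β) : ℝ := ∫ x, ⟪p.F χ L, x⟫_ℝ ∂p.posterior L y

end InverseProblem

end MGMC

end

noncomputable section

namespace MGMC

/-! ### Matrices acting on Euclidean vectors -/

section MatVec

variable {l m n : ℕ}

/-! The argument has a deterministic half, a level-independent bound on the V-cycle in the energy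
norm, and a probabilistic half, which needs only the means and covariances of the draws.

Contraction. Write `J` for the prolongation, `R` for the energy projection to the coarse level, `T =
1 - J R`, `S` for the smoother iteration and `Q = A (1 - S) = A M⁻¹ A`. The low-rank symmetric
Gauss-Seidel matrix satisfies `M ≥ A`, so `A S` and `Q` are positive semidefinite and `(S^k)ᵀ (A +
Q) S^k ≤ A` for `k ≥ 1`. The approximation property gives `A T ≤ C Q`. If the coarse iteration
satisfies `0 ≤ Ac Xc ≤ q Ac`, the middle of the cycle is at most `q A + (1 - q) A T ≤ q (A + Q)` as
soon as `(1 - q) C ≤ q`, and the two smoothing sweeps return it to `q A`. Thus `0 ≤ A X ≤ q A`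
propagates from level to level (`cycle_energy`) with the fixed value `q = C / (1 + C)`.

The constant `C` of the posterior comes from assumptions on the prior. A posterior solution is a
prior solution with a modified right-hand side, so duality bounds the `H`-norm of functions
orthogonal to the coarse space (`exists_galerkin_bound`). Moreover the posterior smoother is at most
the prior smoother plus the observation term (`inner_postSgs_le`), which norm equivalence and the
inverse inequality control (`exists_smoother_bound`).

Sampling. One cycle is `θ ↦ X (θ - μ) + μ + η` with `η` centred, and the smoother and coarse
covariances combine so that `Cov η = A⁻¹ - X A⁻¹ Xᵀ` (`vCycle_eq`, `cross_noise_self`). The chain is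
therefore a linear recursion: the lag-`s` covariance at time `m` is `X^s (A⁻¹ + X^m (K₀ - A⁻¹)
(X^m)ᵀ)`. In energy coordinates `X` becomes the symmetric matrix `G = A^{1/2} X A^{-1/2}` of norm `σ
≤ q < 1`, and the functional becomes `w = A^{-1/2} F`. Geometric series in `σ` bound the stationary
autocorrelation time and the perturbation of order `σ^(2m)` caused by the initial state. For the
mean square error the same formula is used around the posterior mean, with `w` and the mean bounded
uniformly in the level; geometrically decaying correlations then give the `1/M` rate. -/

theorem mv_mul (A : Matrix (Fin l) (Fin m) ℝ) (B : Matrix (Fin m) (Fin n) ℝ) (x : Vec n) :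
    mv (A * B) x = mv A (mv B x) := by
  simp [mv, Matrix.mulVec_mulVec]

theorem mv_add (A : Matrix (Fin m) (Fin n) ℝ) (x y : Vec n) : mv A (x + y) = mv A x + mv A y := by
  simp [mv, Matrix.mulVec_add]

theorem mv_sub (A : Matrix (Fin m) (Fin n) ℝ) (x y : Vec n) : mv A (x - y) = mv A x - mv A y := by
  simp [mv, Matrix.mulVec_sub]

theorem mv_smul (A : Matrix (Fin m) (Fin n) ℝ) (c : ℝ) (x : Vec n) :
    mv A (c • x) = c • mv A x := by
  simp [mv, Matrix.mulVec_smul]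

theorem mv_neg (A : Matrix (Fin m) (Fin n) ℝ) (x : Vec n) : mv A (-x) = -mv A x := by
  simp [mv, Matrix.mulVec_neg]

theorem mv_zero (A : Matrix (Fin m) (Fin n) ℝ) : mv A (0 : Vec n) = 0 := by
  simp [mv]

theorem add_mv (A B : Matrix (Fin m) (Fin n) ℝ) (x : Vec n) : mv (A + B) x = mv A x + mv B x := by
  simp [mv, Matrix.add_mulVec]

theorem sub_mv (A B : Matrix (Fin m) (Fin n) ℝ) (x : Vec n) : mv (A - B) x = mv A x - mv B x := by
  simp [mv, Matrix.sub_mulVec]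

theorem smul_mv (c : ℝ) (A : Matrix (Fin m) (Fin n) ℝ) (x : Vec n) :
    mv (c • A) x = c • mv A x := by
  simp [mv, Matrix.smul_mulVec]

theorem zero_mv (x : Vec n) : mv (0 : Matrix (Fin m) (Fin n) ℝ) x = 0 := by
  simp [mv]

theorem one_mv (x : Vec n) : mv 1 x = x := by
  simp [mv]

theorem mv_apply (A : Matrix (Fin m) (Fin n) ℝ) (x : Vec n) (i : Fin m) :
    mv A x i = ∑ j, A i j * x j := rfl

theorem inner_eq_sum (x y : Vec n) : ⟪x, y⟫_ℝ = ∑ i, x i * y i := by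
  simp [PiLp.inner_apply, mul_comm]

theorem inner_mv_left (A : Matrix (Fin m) (Fin n) ℝ) (x : Vec n) (y : Vec m) :
    ⟪mv A x, y⟫_ℝ = ⟪x, mv Aᵀ y⟫_ℝ := by
  simp only [inner_eq_sum, mv_apply, Matrix.transpose_apply, Finset.sum_mul, Finset.mul_sum]
  rw [Finset.sum_comm]
  exact Finset.sum_congr rfl fun i _ => Finset.sum_congr rfl fun j _ => by ring

theorem inner_mv_right (A : Matrix (Fin m) (Fin n) ℝ) (x : Vec m) (y : Vec n) :
    ⟪x, mv A y⟫_ℝ = ⟪mv Aᵀ x, y⟫_ℝ := by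
  rw [inner_mv_left, Matrix.transpose_transpose]

theorem norm_mv_le (A : Matrix (Fin m) (Fin n) ℝ) (x : Vec n) : ‖mv A x‖ ≤ ‖A‖ * ‖x‖ :=
  Matrix.l2_opNorm_mulVec A x

theorem norm_le_of_norm_mv_le {A : Matrix (Fin m) (Fin n) ℝ} {c : ℝ} (hc : 0 ≤ c)
    (h : ∀ x, ‖mv A x‖ ≤ c * ‖x‖) : ‖A‖ ≤ c := by
  rw [Matrix.l2_opNorm_def]
  exact ContinuousLinearMap.opNorm_le_bound _ hc h

theorem inner_mv_le (A : Matrix (Fin m) (Fin n) ℝ) (x : Vec m) (y : Vec n) :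
    |⟪x, mv A y⟫_ℝ| ≤ ‖A‖ * (‖x‖ * ‖y‖) :=
  calc |⟪x, mv A y⟫_ℝ| ≤ ‖x‖ * ‖mv A y‖ := abs_real_inner_le_norm _ _
    _ ≤ ‖x‖ * (‖A‖ * ‖y‖) := by gcongr; exact norm_mv_le A y
    _ = _ := by ring

theorem posSemidef_iff_inner {A : Matrix (Fin n) (Fin n) ℝ} :
    A.PosSemidef ↔ Aᵀ = A ∧ ∀ x : Vec n, 0 ≤ ⟪x, mv A x⟫_ℝ := by
  rw [Matrix.posSemidef_iff_dotProduct_mulVec, Matrix.IsHermitian,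
    Matrix.conjTranspose_eq_transpose_of_trivial]
  refine and_congr_right fun _ => ⟨fun h x => ?_, fun h x => ?_⟩
  · simpa [inner_eq_sum, dotProduct, mv] using h x.ofLp
  · simpa [inner_eq_sum, dotProduct, mv] using h (WithLp.toLp 2 x)

theorem posDef_iff_inner {A : Matrix (Fin n) (Fin n) ℝ} :
    A.PosDef ↔ Aᵀ = A ∧ ∀ x : Vec n, x ≠ 0 → 0 < ⟪x, mv A x⟫_ℝ := by
  rw [Matrix.posDef_iff_dotProduct_mulVec, Matrix.IsHermitian,
    Matrix.conjTranspose_eq_transpose_of_trivial]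
  refine and_congr_right fun _ => ⟨fun h x hx => ?_, fun h x hx => ?_⟩
  · have := @h x.ofLp (by simpa using hx)
    simpa [inner_eq_sum, dotProduct, mv] using this
  · have := h (WithLp.toLp 2 x) (by simpa using hx)
    simpa [inner_eq_sum, dotProduct, mv] using this

end MatVec

/-! ### Positive semidefinite matrices -/

section Psd

variable {m n : ℕ} {A M : Matrix (Fin n) (Fin n) ℝ}

theorem transpose_eq_of_posSemidef (hA : A.PosSemidef) : Aᵀ = A :=
  (posSemidef_iff_inner.1 hA).1

theorem transpose_eq_of_posDef (hA : A.PosDef) : Aᵀ = A :=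
  transpose_eq_of_posSemidef hA.posSemidef

theorem inner_mv_nonneg (hA : A.PosSemidef) (x : Vec n) : 0 ≤ ⟪x, mv A x⟫_ℝ :=
  (posSemidef_iff_inner.1 hA).2 x

theorem posSemidef_transpose_mul_mul (hA : A.PosSemidef) (B : Matrix (Fin n) (Fin m) ℝ) :
    (Bᵀ * A * B).PosSemidef := by
  simpa using hA.conjTranspose_mul_mul_same B

theorem posSemidef_mul_mul_transpose (hA : A.PosSemidef) (B : Matrix (Fin m) (Fin n) ℝ) :
    (B * A * Bᵀ).PosSemidef := by
  simpa using hA.mul_mul_conjTranspose_same B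

theorem inv_mul_of_posDef (hA : A.PosDef) : A⁻¹ * A = 1 :=
  Matrix.nonsing_inv_mul _ ((Matrix.isUnit_iff_isUnit_det A).1 hA.isUnit)

theorem mul_inv_of_posDef (hA : A.PosDef) : A * A⁻¹ = 1 :=
  Matrix.mul_nonsing_inv _ ((Matrix.isUnit_iff_isUnit_det A).1 hA.isUnit)

/-- The Cauchy-Schwarz inequality for the form of a positive semidefinite matrix. -/
theorem inner_mv_sq_le (hA : A.PosSemidef) (x y : Vec n) :
    ⟪x, mv A y⟫_ℝ ^ 2 ≤ ⟪x, mv A x⟫_ℝ * ⟪y, mv A y⟫_ℝ := by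
  obtain ⟨B, rfl⟩ := CStarAlgebra.nonneg_iff_eq_star_mul_self.mp hA.nonneg
  have h : ∀ u v : Vec n, ⟪u, mv (star B * B) v⟫_ℝ = ⟪mv B u, mv B v⟫_ℝ := fun u v => by
    rw [mv_mul, inner_mv_left, Matrix.star_eq_conjTranspose,
      Matrix.conjTranspose_eq_transpose_of_trivial]
  simp only [h, sq]
  have := real_inner_mul_inner_self_le (mv B x) (mv B y)
  exact this

/-- Cauchy-Schwarz for the form of `M` at the pair `x`, `M⁻¹ y`: the forms of `M` and `M⁻¹` are dual
to each other. -/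
theorem inner_sq_le_of_posDef (hM : M.PosDef) (x y : Vec n) :
    ⟪x, y⟫_ℝ ^ 2 ≤ ⟪x, mv M x⟫_ℝ * ⟪y, mv M⁻¹ y⟫_ℝ := by
  have h := inner_mv_sq_le hM.posSemidef x (mv M⁻¹ y)
  rwa [← mv_mul, mul_inv_of_posDef hM, one_mv, real_inner_comm y (mv M⁻¹ y)] at h

/-- Cauchy-Schwarz for the form of `A` at the pair `A x`, `x` turns a bound on the quadratic form
into one on the operator norm. This is why the cycle analysis keeps track of a lower bound by zero
together with the upper bound by `q`. -/
theorem norm_le_of_posSemidef {q : ℝ} (hq : 0 ≤ q) (hA : A.PosSemidef)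
    (h : (q • (1 : Matrix (Fin n) (Fin n) ℝ) - A).PosSemidef) : ‖A‖ ≤ q := by
  have hb : ∀ x : Vec n, ⟪x, mv A x⟫_ℝ ≤ q * ‖x‖ ^ 2 := fun x => by
    have := inner_mv_nonneg h x
    rw [sub_mv, smul_mv, one_mv, inner_sub_right, inner_smul_right,
      real_inner_self_eq_norm_sq] at this
    linarith
  refine norm_le_of_norm_mv_le hq fun x => ?_
  have h1 := inner_mv_sq_le hA (mv A x) x
  rw [real_inner_self_eq_norm_sq] at h1
  have h2 := hb x
  have h3 := hb (mv A x)
  have h4 := inner_mv_nonneg hA x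
  have h5 := inner_mv_nonneg hA (mv A x)
  rcases (norm_nonneg (mv A x)).eq_or_lt with h0 | h0
  · rw [← h0]; positivity
  · have h6 : (‖mv A x‖ ^ 2) ^ 2 ≤ (q * ‖mv A x‖ ^ 2) * (q * ‖x‖ ^ 2) :=
      h1.trans (mul_le_mul h3 h2 h4 (by positivity))
    have h7 : ‖mv A x‖ ^ 2 ≤ (q * ‖x‖) ^ 2 := by
      have : ‖mv A x‖ ^ 2 * ‖mv A x‖ ^ 2 ≤ (q * ‖x‖) ^ 2 * ‖mv A x‖ ^ 2 := by
        calc _ = (‖mv A x‖ ^ 2) ^ 2 := by ring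
          _ ≤ _ := h6
          _ = _ := by ring
      exact le_of_mul_le_mul_right this (by positivity)
    exact (abs_le_of_sq_le_sq' h7 (by positivity)).2

/-- A positive definite matrix has an invertible symmetric square root. -/
theorem sqrt_spec (hA : A.PosDef) :
    CFC.sqrt A * CFC.sqrt A = A ∧ (CFC.sqrt A)ᵀ = CFC.sqrt A ∧
      (CFC.sqrt A)⁻¹ * CFC.sqrt A = 1 ∧ CFC.sqrt A * (CFC.sqrt A)⁻¹ = 1 ∧
      ((CFC.sqrt A)⁻¹)ᵀ = (CFC.sqrt A)⁻¹ := by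
  have h1 : CFC.sqrt A * CFC.sqrt A = A := CFC.sqrt_mul_sqrt_self _ hA.posSemidef.nonneg
  have h2 : (CFC.sqrt A)ᵀ = CFC.sqrt A :=
    transpose_eq_of_posSemidef (CFC.sqrt_nonneg A).posSemidef
  have hu : IsUnit (CFC.sqrt A).det := by
    have := (Matrix.isUnit_iff_isUnit_det A).1 hA.isUnit
    rw [← h1, Matrix.det_mul] at this
    exact isUnit_of_mul_isUnit_left this
  exact ⟨h1, h2, Matrix.nonsing_inv_mul _ hu, Matrix.mul_nonsing_inv _ hu, by
    rw [Matrix.transpose_nonsing_inv, h2]⟩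

end Psd

/-! ### One multigrid cycle in the energy norm -/

section Cycle

variable {m n : ℕ} {A M : Matrix (Fin n) (Fin n) ℝ}

/-- The iteration matrix of a symmetric smoother whose splitting matrix dominates `A`. -/
theorem smoother_spec (hA : A.PosDef) (hMA : (M - A).PosSemidef) :
    A * (M⁻¹ * (M - A)) = (M⁻¹ * (M - A))ᵀ * A ∧
    A * (1 - M⁻¹ * (M - A)) = A * M⁻¹ * A ∧
    (A * (M⁻¹ * (M - A))).PosSemidef ∧ (A * (1 - M⁻¹ * (M - A))).PosSemidef := by
  have hM : M.PosDef := by simpa using Matrix.PosDef.posSemidef_add hMA hA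
  have hMt := transpose_eq_of_posDef hM
  have hAt := transpose_eq_of_posDef hA
  have h1 := inv_mul_of_posDef hM
  have h2 := mul_inv_of_posDef hM
  have hMit : (M⁻¹)ᵀ = M⁻¹ := by rw [Matrix.transpose_nonsing_inv, hMt]
  have hS : M⁻¹ * (M - A) = 1 - M⁻¹ * A := by rw [mul_sub, h1]
  have hSt : (1 - M⁻¹ * A)ᵀ = 1 - A * M⁻¹ := by
    rw [Matrix.transpose_sub, Matrix.transpose_one, Matrix.transpose_mul, hAt, hMit]
  have hQ : A * (1 - (1 - M⁻¹ * A)) = A * M⁻¹ * A := by rw [sub_sub_cancel, mul_assoc]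
  refine ⟨?_, by rw [hS, hQ], ?_, ?_⟩
  · rw [hS, hSt]; noncomm_ring
  -- With `N = M⁻¹ A` and `S = 1 - N`, the difference `A S - Sᵀ A S` equals `Nᵀ A S = Nᵀ (M - A) N`,
  -- so `M ≥ A` makes `A S` a sum of two nonnegative forms.
  · have e : A * (M⁻¹ * (M - A)) =
        (M⁻¹ * (M - A))ᵀ * A * (M⁻¹ * (M - A)) + (M⁻¹ * A)ᵀ * (M - A) * (M⁻¹ * A) := by
      have e1 : (M⁻¹ * A)ᵀ * (M - A) = A * (1 - M⁻¹ * A) := by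
        rw [Matrix.transpose_mul, hAt, hMit, mul_assoc, hS]
      rw [e1, hS, hSt]
      noncomm_ring
    rw [e]
    exact (posSemidef_transpose_mul_mul hA.posSemidef _).add (posSemidef_transpose_mul_mul hMA _)
  · rw [hS, hQ]
    have := posSemidef_transpose_mul_mul hM.inv.posSemidef A
    rwa [hAt] at this

/-- Powers of a symmetric smoother reduce the energy by at least the energy of the defect. -/
theorem smoother_pow_energy {S : Matrix (Fin n) (Fin n) ℝ} (hAS : A * S = Sᵀ * A)
    (hSp : (A * S).PosSemidef) (hQp : (A * (1 - S)).PosSemidef) {k : ℕ} (hk : 1 ≤ k) :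
    (A - (S ^ k)ᵀ * (A + A * (1 - S)) * S ^ k).PosSemidef := by
  have hAS' : ∀ Y : Matrix (Fin n) (Fin n) ℝ, Sᵀ * (A * Y) = A * (S * Y) := fun Y => by
    rw [← mul_assoc, ← hAS, mul_assoc]
  have htr : ∀ Y : Matrix (Fin n) (Fin n) ℝ, (1 - S)ᵀ * (A * Y) = A * ((1 - S) * Y) := fun Y => by
    rw [Matrix.transpose_sub, Matrix.transpose_one, sub_mul, hAS', sub_mul, one_mul, one_mul,
      mul_sub]
  have h1 : (A - Sᵀ * (A + A * (1 - S)) * S).PosSemidef := by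
    -- Since `S` is self-adjoint for the form of `A`, this is the scalar identity `1 - s² (2 - s) =
    -- (1 - s) + s (1 - s)²`.
    have e : A - Sᵀ * (A + A * (1 - S)) * S = A * (1 - S) + (1 - S)ᵀ * (A * S) * (1 - S) := by
      rw [htr, mul_add, hAS', ← hAS]
      noncomm_ring
    rw [e]
    exact hQp.add (posSemidef_transpose_mul_mul hSp _)
  have h2 : (A - Sᵀ * A * S).PosSemidef := by
    have e : A - Sᵀ * A * S = (A - Sᵀ * (A + A * (1 - S)) * S) + Sᵀ * (A * (1 - S)) * S := by
      noncomm_ring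
    rw [e]
    exact h1.add (posSemidef_transpose_mul_mul hQp _)
  have h3 : ∀ j, (A - (S ^ j)ᵀ * A * S ^ j).PosSemidef := fun j => by
    induction j with
    | zero => simpa using Matrix.PosSemidef.zero
    | succ j ih =>
      have e : A - (S ^ (j + 1))ᵀ * A * S ^ (j + 1) =
          (A - (S ^ j)ᵀ * A * S ^ j) + (S ^ j)ᵀ * (A - Sᵀ * A * S) * S ^ j := by
        rw [pow_succ' S j, Matrix.transpose_mul]
        noncomm_ring
      rw [e]
      exact ih.add (posSemidef_transpose_mul_mul h2 _)
  obtain ⟨j, rfl⟩ := Nat.exists_eq_add_of_le' hk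
  have e : A - (S ^ (j + 1))ᵀ * (A + A * (1 - S)) * S ^ (j + 1) =
      (A - (S ^ j)ᵀ * A * S ^ j) + (S ^ j)ᵀ * (A - Sᵀ * (A + A * (1 - S)) * S) * S ^ j := by
    rw [pow_succ' S j, Matrix.transpose_mul]
    noncomm_ring
  rw [e]
  exact (h3 j).add (posSemidef_transpose_mul_mul h1 _)

/-- The defect of the coarse projection. -/
theorem coarse_defect {Ac : Matrix (Fin m) (Fin m) ℝ} {J : Matrix (Fin n) (Fin m) ℝ}
    (hA : A.PosDef) (hAc : Ac.PosDef) (hJ : Jᵀ * A * J = Ac)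
    {R : Matrix (Fin m) (Fin n) ℝ} (hR : R = Ac⁻¹ * Jᵀ * A) :
    A * J = Rᵀ * Ac ∧ Jᵀ * A * (1 - J * R) = 0 ∧
    (1 - J * R)ᵀ * A * (1 - J * R) = A * (1 - J * R) := by
  have hAt := transpose_eq_of_posDef hA
  have hAct := transpose_eq_of_posDef hAc
  have hAcit : (Ac⁻¹)ᵀ = Ac⁻¹ := by rw [Matrix.transpose_nonsing_inv, hAct]
  have hRt : Rᵀ = A * J * Ac⁻¹ := by
    rw [hR, Matrix.transpose_mul, Matrix.transpose_mul, hAt, hAcit, Matrix.transpose_transpose,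
      Matrix.mul_assoc]
  have hJT : Jᵀ * A * (1 - J * R) = 0 := by
    have : Jᵀ * A * (J * R) = Jᵀ * A := by
      rw [← Matrix.mul_assoc, hJ, hR, ← Matrix.mul_assoc, ← Matrix.mul_assoc,
        mul_inv_of_posDef hAc, Matrix.one_mul]
    rw [Matrix.mul_sub, this, Matrix.mul_one, sub_self]
  refine ⟨?_, hJT, ?_⟩
  · rw [hRt, Matrix.mul_assoc, inv_mul_of_posDef hAc, Matrix.mul_one]
  · have : (1 - J * R)ᵀ = 1 - Rᵀ * Jᵀ := by simp [Matrix.transpose_sub, Matrix.transpose_mul]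
    rw [this, sub_mul, sub_mul, Matrix.mul_assoc Rᵀ Jᵀ A, Matrix.mul_assoc Rᵀ, hJT]
    simp

/-- The approximation property in the form of an inequality between quadratic forms. -/
theorem approximation_form {Ac : Matrix (Fin m) (Fin m) ℝ} {J : Matrix (Fin n) (Fin m) ℝ}
    {C : ℝ} (hC : 0 ≤ C) (hA : A.PosDef) (hAc : Ac.PosDef) (hJ : Jᵀ * A * J = Ac)
    (hMA : (M - A).PosSemidef)
    (happ : ∀ e : Vec n, mv (Jᵀ * A) e = 0 → ⟪e, mv M e⟫_ℝ ≤ C * ⟪e, mv A e⟫_ℝ)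
    {R : Matrix (Fin m) (Fin n) ℝ} (hR : R = Ac⁻¹ * Jᵀ * A) :
    (C • (A * M⁻¹ * A) - A * (1 - J * R)).PosSemidef := by
  obtain ⟨-, hJT, hTT⟩ := coarse_defect hA hAc hJ hR
  have hM : M.PosDef := by simpa using Matrix.PosDef.posSemidef_add hMA hA
  have hAt := transpose_eq_of_posDef hA
  have hTp : (A * (1 - J * R)).PosSemidef := by
    rw [← hTT]; exact posSemidef_transpose_mul_mul hA.posSemidef _
  have hQp : (A * M⁻¹ * A).PosSemidef := by
    have := posSemidef_transpose_mul_mul hM.inv.posSemidef A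
    rwa [hAt] at this
  refine posSemidef_iff_inner.2 ⟨?_, fun x => ?_⟩
  · rw [Matrix.transpose_sub, Matrix.transpose_smul, transpose_eq_of_posSemidef hQp,
      transpose_eq_of_posSemidef hTp]
  -- The projected vector `e` satisfies `⟪e, A e⟫ = ⟪e, A x⟫`. Duality between `M` and `M⁻¹` bounds
  -- its square by `⟪e, M e⟫ ⟪x, A M⁻¹ A x⟫`; the hypothesis on `e` replaces the first factor by `C
  -- ⟪e, A e⟫`, and one factor cancels.
  · set e := mv (1 - J * R) x with he
    have h1 : ⟪e, mv A e⟫_ℝ = ⟪x, mv (A * (1 - J * R)) x⟫_ℝ := by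
      rw [← hTT, he, inner_mv_left, ← mv_mul, ← mv_mul, mul_assoc]
    have h2 : ⟪x, mv (A * (1 - J * R)) x⟫_ℝ = ⟪e, mv A x⟫_ℝ := by
      rw [mv_mul, ← he, inner_mv_right, hAt, real_inner_comm]
    have h3 := inner_sq_le_of_posDef hM e (mv A x)
    have h4 := happ e (by rw [he, ← mv_mul, hJT, zero_mv])
    have h5 : ⟪mv A x, mv M⁻¹ (mv A x)⟫_ℝ = ⟪x, mv (A * M⁻¹ * A) x⟫_ℝ := by
      rw [inner_mv_left, hAt, mv_mul, mv_mul]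
    rw [h5, ← h2] at h3
    rw [h1] at h4
    have h6 := inner_mv_nonneg hTp x
    have h7 := inner_mv_nonneg hQp x
    rw [sub_mv, smul_mv, inner_sub_right, inner_smul_right]
    have h8 : ⟪x, mv (A * (1 - J * R)) x⟫_ℝ * ⟪x, mv (A * (1 - J * R)) x⟫_ℝ ≤
        (C * ⟪x, mv (A * M⁻¹ * A) x⟫_ℝ) * ⟪x, mv (A * (1 - J * R)) x⟫_ℝ :=
      calc _ = ⟪x, mv (A * (1 - J * R)) x⟫_ℝ ^ 2 := by ring
        _ ≤ _ := h3
        _ ≤ _ := mul_le_mul_of_nonneg_right h4 h7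
        _ = _ := by ring
    rcases h6.eq_or_lt with h0 | h0
    · rw [← h0, sub_zero]
      exact mul_nonneg hC h7
    · linarith [le_of_mul_le_mul_right h8 h0]

/-- The two-level step of the V-cycle analysis: if the coarse iteration is `q`-contractive in
energy and the approximation property holds with constant `C`, then the fine iteration is
`q`-contractive in energy as soon as `(1 - q) C ≤ q`. -/
theorem cycle_energy {Ac Xc : Matrix (Fin m) (Fin m) ℝ} {J : Matrix (Fin n) (Fin m) ℝ}
    {C q : ℝ} {k : ℕ} (hk : 1 ≤ k) (hC : 0 ≤ C) (hA : A.PosDef) (hAc : Ac.PosDef)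
    (hJ : Jᵀ * A * J = Ac) (hMA : (M - A).PosSemidef)
    (happ : ∀ e : Vec n, mv (Jᵀ * A) e = 0 → ⟪e, mv M e⟫_ℝ ≤ C * ⟪e, mv A e⟫_ℝ)
    (hq : 0 ≤ q) (hq1 : q ≤ 1) (hqC : (1 - q) * C ≤ q)
    (hX : (Ac * Xc).PosSemidef) (hXq : (q • Ac - Ac * Xc).PosSemidef)
    {S : Matrix (Fin n) (Fin n) ℝ} (hSdef : S = M⁻¹ * (M - A))
    {R : Matrix (Fin m) (Fin n) ℝ} (hR : R = Ac⁻¹ * Jᵀ * A)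
    {X : Matrix (Fin n) (Fin n) ℝ} (hXdef : X = S ^ k * (1 - J * R + J * Xc * R) * S ^ k) :
    (A * X).PosSemidef ∧ (q • A - A * X).PosSemidef := by
  obtain ⟨hAS, hQ, hASp, hQp⟩ := smoother_spec hA hMA
  rw [← hSdef] at hAS hQ hASp hQp
  obtain ⟨hAJ, -, hTT⟩ := coarse_defect hA hAc hJ hR
  have hTC := approximation_form hC hA hAc hJ hMA happ hR
  rw [← hQ] at hTC
  have hTp : (A * (1 - J * R)).PosSemidef := by
    rw [← hTT]; exact posSemidef_transpose_mul_mul hA.posSemidef _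
  have hpow : A * S ^ k = (S ^ k)ᵀ * A := by
    rw [Matrix.transpose_pow]
    exact (SemiconjBy.pow_right (show SemiconjBy A S Sᵀ from hAS) k)
  have hAX : A * X = (S ^ k)ᵀ * (A * (1 - J * R) + Rᵀ * (Ac * Xc) * R) * S ^ k := by
    rw [hXdef, ← mul_assoc, ← mul_assoc, hpow, mul_assoc (S ^ k)ᵀ, mul_add, ← Matrix.mul_assoc A,
      ← Matrix.mul_assoc A, hAJ, Matrix.mul_assoc Rᵀ]
  constructor
  · rw [hAX]
    exact posSemidef_transpose_mul_mul (hTp.add (posSemidef_transpose_mul_mul hX R)) _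
  · have hAsplit : A - A * (1 - J * R) = Rᵀ * Ac * R := by
      rw [mul_sub, mul_one, sub_sub_cancel, ← hAJ, Matrix.mul_assoc]
    -- The gap splits into four nonnegative parts: the energy lost in smoothing, the coarse
    -- contraction, the approximation property with weight `1 - q`, and a surplus of `A (1 - S)`
    -- with weight `q - (1 - q) C`.
    have e : q • A - A * X =
        q • (A - (S ^ k)ᵀ * (A + A * (1 - S)) * S ^ k) +
        (S ^ k)ᵀ * (Rᵀ * (q • Ac - Ac * Xc) * R +
          (1 - q) • (C • (A * (1 - S)) - A * (1 - J * R)) +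
          (q - (1 - q) * C) • (A * (1 - S))) * S ^ k := by
      have e1 : Rᵀ * (q • Ac - Ac * Xc) * R =
          q • (A - A * (1 - J * R)) - Rᵀ * (Ac * Xc) * R := by
        rw [hAsplit, Matrix.mul_sub, Matrix.sub_mul, Matrix.mul_smul, Matrix.smul_mul]
      have e2 : Rᵀ * (q • Ac - Ac * Xc) * R +
          (1 - q) • (C • (A * (1 - S)) - A * (1 - J * R)) +
          (q - (1 - q) * C) • (A * (1 - S)) =
          q • (A + A * (1 - S)) - (A * (1 - J * R) + Rᵀ * (Ac * Xc) * R) := by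
        rw [e1]; module
      rw [e2, hAX, mul_sub (S ^ k)ᵀ (q • _), sub_mul, Matrix.mul_smul, Matrix.smul_mul, smul_sub]
      abel
    rw [e]
    refine ((smoother_pow_energy hAS hASp hQp hk).smul hq).add
      (posSemidef_transpose_mul_mul ((((posSemidef_transpose_mul_mul hXq R).add
        (hTC.smul (sub_nonneg.2 hq1))).add (hQp.smul (sub_nonneg.2 hqC)))) _)

/-- Conversion of energy bounds into the symmetric matrix `A^{1/2} X A^{-1/2}`. -/
theorem energy_conj {X : Matrix (Fin n) (Fin n) ℝ} {q : ℝ} (hA : A.PosDef) (hq : 0 ≤ q)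
    (hX : (A * X).PosSemidef) (hXq : (q • A - A * X).PosSemidef) :
    (CFC.sqrt A * X * (CFC.sqrt A)⁻¹).PosSemidef ∧ energyNorm A X ≤ q := by
  obtain ⟨h1, h2, h3, h4, h5⟩ := sqrt_spec hA
  have e : CFC.sqrt A * X * (CFC.sqrt A)⁻¹ =
      ((CFC.sqrt A)⁻¹)ᵀ * (A * X) * (CFC.sqrt A)⁻¹ := by
    nth_rewrite 4 [← h1]
    rw [h5, mul_assoc (CFC.sqrt A) (CFC.sqrt A), ← mul_assoc _ (CFC.sqrt A), h3, one_mul]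
  have hp : (CFC.sqrt A * X * (CFC.sqrt A)⁻¹).PosSemidef := by
    rw [e]; exact posSemidef_transpose_mul_mul hX _
  refine ⟨hp, norm_le_of_posSemidef hq hp ?_⟩
  have e1 : q • (1 : Matrix (Fin n) (Fin n) ℝ) - CFC.sqrt A * X * (CFC.sqrt A)⁻¹ =
      ((CFC.sqrt A)⁻¹)ᵀ * (q • A - A * X) * (CFC.sqrt A)⁻¹ := by
    rw [mul_sub, sub_mul, ← e, Matrix.mul_smul, Matrix.smul_mul]
    congr 2
    nth_rewrite 2 [← h1]
    rw [h5, ← mul_assoc, h3, one_mul, h4]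
  rw [e1]
  exact posSemidef_transpose_mul_mul hXq _

end Cycle

/-! ### Symmetric Gauss-Seidel splittings -/

section SymmetricGaussSeidel

variable {n : ℕ} {A D E L : Matrix (Fin n) (Fin n) ℝ}

theorem diagPart_add_lowerPart (hA : Aᵀ = A) :
    diagPart A + lowerPart A + (lowerPart A)ᵀ = A := by
  ext i j
  have hij : A j i = A i j := by rw [← Matrix.transpose_apply A, hA]
  simp only [diagPart, lowerPart, Matrix.add_apply, Matrix.of_apply, Matrix.transpose_apply]
  rcases lt_trichotomy i j with h | h | h
  · simp [Matrix.diagonal_apply_ne _ h.ne, h, h.not_gt, hij]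
  · subst h; simp
  · simp [Matrix.diagonal_apply_ne _ h.ne', h, h.not_gt]

theorem diagPart_posDef (hA : A.PosDef) : (diagPart A).PosDef :=
  Matrix.PosDef.diagonal fun _ => hA.diag_pos

/-- The splitting exceeds `D + L + Lᵀ` by exactly `L D⁻¹ Lᵀ`. This remainder gives the domination of
the precision matrix by its smoother and the comparison of the prior and posterior smoothers. -/
theorem sgsSplitting_eq (hD : D.PosDef) :
    sgsSplitting D L = D + L + Lᵀ + L * D⁻¹ * Lᵀ := by
  have h1 := inv_mul_of_posDef hD
  have h2 := mul_inv_of_posDef hD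
  calc sgsSplitting D L = (D * D⁻¹) * D + L * (D⁻¹ * D) + (D * D⁻¹) * Lᵀ + L * D⁻¹ * Lᵀ := by
        unfold sgsSplitting; noncomm_ring
    _ = _ := by rw [h1, h2]; simp

/-- Inversion is antitone on positive definite matrices. -/
theorem inner_inv_le (hD : D.PosDef) (hE : E.PosSemidef) (z : Vec n) :
    ⟪z, mv (D + E)⁻¹ z⟫_ℝ ≤ ⟪z, mv D⁻¹ z⟫_ℝ := by
  have hDE : (D + E).PosDef := hD.add_posSemidef hE
  set u := mv (D + E)⁻¹ z with hu
  -- With `u = (D + E)⁻¹ z`, this bounds `⟪z, u⟫²` by `⟪u, D u⟫ ⟪z, D⁻¹ z⟫`; since `⟪u, D u⟫ ≤ ⟪z,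
  -- u⟫`, one factor cancels.
  have h1 := inner_sq_le_of_posDef hD u z
  have h2 : ⟪u, mv D u⟫_ℝ ≤ ⟪z, u⟫_ℝ := by
    have : mv (D + E) u = z := by rw [hu, ← mv_mul, mul_inv_of_posDef hDE, one_mv]
    have h := inner_mv_nonneg hE u
    calc ⟪u, mv D u⟫_ℝ ≤ ⟪u, mv D u⟫_ℝ + ⟪u, mv E u⟫_ℝ := by linarith
      _ = ⟪u, mv (D + E) u⟫_ℝ := by rw [add_mv, inner_add_right]
      _ = _ := by rw [this, real_inner_comm]
  have h3 := inner_mv_nonneg hD.inv.posSemidef z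
  have h4 := inner_mv_nonneg hDE.inv.posSemidef z
  rw [← hu] at h4
  rw [real_inner_comm] at h1
  rcases h4.eq_or_lt with h0 | h0
  · rwa [← h0]
  · have : ⟪z, u⟫_ℝ * ⟪z, u⟫_ℝ ≤ ⟪z, mv D⁻¹ z⟫_ℝ * ⟪z, u⟫_ℝ := by
      nlinarith [mul_le_mul_of_nonneg_right h2 h3]
    exact le_of_mul_le_mul_right this h0

end SymmetricGaussSeidel

namespace InverseProblem

variable {H : Type*} [NormedAddCommGroup H] [InnerProductSpace ℝ H] [CompleteSpace H] {β : ℕ}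
  (p : InverseProblem H β)

/-! ### The variational space and its discretisation -/

theorem sqrtCov_sqrtA (v : p.V) : p.sqrtCov (p.sqrtA v) = v :=
  congrArg Subtype.val
    ((LinearEquiv.ofInjective (p.sqrtCov : H →ₗ[ℝ] H) p.sqrtCov_injective).apply_symm_apply v)

theorem exists_sqrtA_eq (z : H) : ∃ v : p.V, p.sqrtA v = z :=
  ⟨LinearEquiv.ofInjective (p.sqrtCov : H →ₗ[ℝ] H) p.sqrtCov_injective z,
    LinearEquiv.symm_apply_apply _ z⟩

theorem inner_sqrtCov (x y : H) : ⟪p.sqrtCov x, y⟫_ℝ = ⟪x, p.sqrtCov y⟫_ℝ :=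
  p.sqrtCov_isPositive.isSymmetric x y

theorem normV_eq (v : p.V) : p.normV v = ‖p.sqrtA v‖ := by
  rw [normV, a, real_inner_self_eq_norm_sq, Real.sqrt_sq (norm_nonneg _)]

theorem a_self (v : p.V) : p.a v v = p.normV v ^ 2 := by
  rw [normV_eq, a, real_inner_self_eq_norm_sq]

theorem a_comm (u v : p.V) : p.a u v = p.a v u := real_inner_comm _ _

theorem abs_a_le (u v : p.V) : |p.a u v| ≤ p.normV u * p.normV v := by
  rw [normV_eq, normV_eq]
  exact abs_real_inner_le_norm _ _

theorem normV_nonneg (v : p.V) : 0 ≤ p.normV v := Real.sqrt_nonneg _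

theorem norm_le_normV (v : p.V) : ‖(v : H)‖ ≤ ‖p.sqrtCov‖ * p.normV v := by
  rw [normV_eq, ← sqrtCov_sqrtA]
  exact p.sqrtCov.le_opNorm _

theorem Pmap_mem (ℓ : ℕ) (x : Vec (p.n ℓ)) : p.Pmap ℓ x ∈ p.space ℓ :=
  Submodule.sum_mem _ fun j _ => Submodule.smul_mem _ _ (p.basis ℓ j).2

theorem exists_Pmap_eq {ℓ : ℕ} {v : p.V} (hv : v ∈ p.space ℓ) : ∃ x, p.Pmap ℓ x = v := by
  refine ⟨WithLp.toLp 2 ((p.basis ℓ).repr ⟨v, hv⟩), ?_⟩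
  have := congrArg Subtype.val ((p.basis ℓ).sum_repr ⟨v, hv⟩)
  simpa only [Pmap, φ, Submodule.coe_sum, Submodule.coe_smul] using this

theorem Pmap_eq_zero {ℓ : ℕ} {x : Vec (p.n ℓ)} (hx : p.Pmap ℓ x = 0) : x = 0 := by
  have h : ∑ j, x j • p.basis ℓ j = 0 := by
    apply Subtype.ext
    simpa [Pmap, φ] using hx
  ext j
  exact Fintype.linearIndependent_iff.1 (p.basis ℓ).linearIndependent _ h j

theorem inner_A (ℓ : ℕ) (x y : Vec (p.n ℓ)) :
    ⟪x, mv (p.A ℓ) y⟫_ℝ = p.a (p.Pmap ℓ x) (p.Pmap ℓ y) := by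
  simp only [inner_eq_sum, mv_apply, a, Pmap, map_sum, map_smul, sum_inner, inner_sum,
    real_inner_smul_left, inner_smul_right, A, Matrix.of_apply, Finset.mul_sum]
  rw [Finset.sum_comm]
  refine Finset.sum_congr rfl fun i _ => Finset.sum_congr rfl fun j _ => by ring

theorem mv_B_transpose (ℓ : ℕ) (x : Vec (p.n ℓ)) :
    mv (p.B ℓ)ᵀ x = p.obs (p.Pmap ℓ x : H) := by
  ext k
  simp [mv_apply, Pmap, B, mul_comm]

theorem inner_F (χ : H) (ℓ : ℕ) (x : Vec (p.n ℓ)) :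
    ⟪p.F χ ℓ, x⟫_ℝ = ⟪(p.Pmap ℓ x : H), χ⟫_ℝ := by
  simp [inner_eq_sum, F, Pmap, sum_inner, real_inner_smul_left, mul_comm]

theorem inner_lowRank (ℓ : ℕ) (x y : Vec (p.n ℓ)) :
    ⟪x, mv (p.B ℓ * p.Γ⁻¹ * (p.B ℓ)ᵀ) y⟫_ℝ =
      ⟪p.obs (p.Pmap ℓ x : H), mv p.Γ⁻¹ (p.obs (p.Pmap ℓ y : H))⟫_ℝ := by
  rw [mv_mul, mv_mul, inner_mv_right, mv_B_transpose, mv_B_transpose]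

theorem lowRank_posSemidef (ℓ : ℕ) : (p.B ℓ * p.Γ⁻¹ * (p.B ℓ)ᵀ).PosSemidef :=
  posSemidef_mul_mul_transpose p.Γ_posDef.inv.posSemidef _

theorem A_posDef (ℓ : ℕ) : (p.A ℓ).PosDef := by
  refine posDef_iff_inner.2 ⟨?_, fun x hx => ?_⟩
  · ext i j
    exact p.a_comm _ _
  · rw [inner_A, a_self]
    refine pow_pos ((p.normV_nonneg _).lt_of_ne' fun h => hx (p.Pmap_eq_zero ?_)) 2
    rw [normV_eq, norm_eq_zero] at h
    apply Subtype.ext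
    rw [← sqrtCov_sqrtA, h, map_zero]
    rfl

theorem postA_posDef (ℓ : ℕ) : (p.postA ℓ).PosDef :=
  (p.A_posDef ℓ).add_posSemidef (p.lowRank_posSemidef ℓ)

/-- The bilinear form of the posterior precision. -/
def postForm (u v : p.V) : ℝ := p.a u v + ⟪p.obs (u : H), mv p.Γ⁻¹ (p.obs (v : H))⟫_ℝ

theorem inner_postA (ℓ : ℕ) (x y : Vec (p.n ℓ)) :
    ⟪x, mv (p.postA ℓ) y⟫_ℝ = p.postForm (p.Pmap ℓ x) (p.Pmap ℓ y) := by
  rw [postA, add_mv, inner_add_right, inner_A, inner_lowRank, postForm]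

/-- Prolongation changes coordinates but not the function represented. Forms on nested levels
therefore agree, which is the source of the Galerkin identity `prolong_postA`. -/
theorem Pmap_prolong (ℓ : ℕ) (x : Vec (p.n ℓ)) :
    p.Pmap (ℓ + 1) (mv (p.prolong ℓ) x) = p.Pmap ℓ x := by
  have h : ∀ k, ∑ j, p.prolong ℓ j k • p.φ (ℓ + 1) j = p.φ ℓ k := fun k => by
    have := congrArg Subtype.val
      ((p.basis (ℓ + 1)).sum_repr ⟨p.φ ℓ k, p.space_le ℓ (p.basis ℓ k).2⟩)
    simpa only [prolong, φ, Submodule.coe_sum, Submodule.coe_smul, Matrix.of_apply] using this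
  simp only [Pmap, mv_apply, Finset.sum_smul]
  rw [Finset.sum_comm]
  refine Finset.sum_congr rfl fun k _ => ?_
  rw [← h k, Finset.smul_sum]
  exact Finset.sum_congr rfl fun j _ => by rw [smul_smul, mul_comm]

theorem eq_of_inner_mv {n : ℕ} {A B : Matrix (Fin n) (Fin n) ℝ}
    (h : ∀ x y : Vec n, ⟪x, mv A y⟫_ℝ = ⟪x, mv B y⟫_ℝ) : A = B := by
  ext i j
  simpa [inner_eq_sum, mv_apply] using h (EuclideanSpace.single i 1) (EuclideanSpace.single j 1)

theorem prolong_postA (ℓ : ℕ) :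
    (p.prolong ℓ)ᵀ * p.postA (ℓ + 1) * p.prolong ℓ = p.postA ℓ := by
  refine eq_of_inner_mv fun x y => ?_
  rw [mv_mul, mv_mul, inner_mv_right, Matrix.transpose_transpose, inner_postA, inner_postA,
    Pmap_prolong, Pmap_prolong]

/-! ### The smoother of the posterior -/

theorem lowRank_add_diag_posDef (ℓ : ℕ) :
    (diagPart (p.A ℓ) + p.B ℓ * p.Γ⁻¹ * (p.B ℓ)ᵀ).PosDef :=
  (diagPart_posDef (p.A_posDef ℓ)).add_posSemidef (p.lowRank_posSemidef ℓ)

/-- The observation term is absorbed into the block playing the role of the diagonal, so it cancels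
against the one in the posterior precision and only the quadratic remainder is left. -/
theorem postSgs_sub (ℓ : ℕ) :
    p.postSgs ℓ - p.postA ℓ = lowerPart (p.A ℓ) *
      (diagPart (p.A ℓ) + p.B ℓ * p.Γ⁻¹ * (p.B ℓ)ᵀ)⁻¹ * (lowerPart (p.A ℓ))ᵀ := by
  have hA := diagPart_add_lowerPart (transpose_eq_of_posDef (p.A_posDef ℓ))
  have hc : ∀ D E L L' X A : Matrix (Fin (p.n ℓ)) (Fin (p.n ℓ)) ℝ,
      D + E + L + L' + X - (A + E) = (D + L + L') - A + X := fun D E L L' X A => by abel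
  rw [postSgs, sgsSplitting_eq (p.lowRank_add_diag_posDef ℓ), postA, hc, hA, sub_self, zero_add]

theorem sgs_sub (ℓ : ℕ) :
    p.sgs ℓ - p.A ℓ = lowerPart (p.A ℓ) * (diagPart (p.A ℓ))⁻¹ * (lowerPart (p.A ℓ))ᵀ := by
  have hA := diagPart_add_lowerPart (transpose_eq_of_posDef (p.A_posDef ℓ))
  rw [sgs, sgsSplitting_eq (diagPart_posDef (p.A_posDef ℓ)), hA, add_sub_cancel_left]

theorem postSgs_sub_posSemidef (ℓ : ℕ) : (p.postSgs ℓ - p.postA ℓ).PosSemidef := by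
  rw [postSgs_sub]
  exact posSemidef_mul_mul_transpose (p.lowRank_add_diag_posDef ℓ).inv.posSemidef _

/-- Enlarging the diagonal block by a nonnegative matrix shrinks its inverse, so the remainder `L (D
+ B Γ⁻¹ Bᵀ)⁻¹ Lᵀ` of the posterior is at most the prior remainder `L D⁻¹ Lᵀ`. This lets the
assumption on the prior smoother control the posterior one. -/
theorem inner_postSgs_le (ℓ : ℕ) (x : Vec (p.n ℓ)) :
    ⟪x, mv (p.postSgs ℓ) x⟫_ℝ ≤
      ⟪x, mv (p.sgs ℓ) x⟫_ℝ + ⟪x, mv (p.B ℓ * p.Γ⁻¹ * (p.B ℓ)ᵀ) x⟫_ℝ := by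
  have h0 : ∀ K : Matrix (Fin (p.n ℓ)) (Fin (p.n ℓ)) ℝ,
      ⟪x, mv (lowerPart (p.A ℓ) * K * (lowerPart (p.A ℓ))ᵀ) x⟫_ℝ =
        ⟪mv (lowerPart (p.A ℓ))ᵀ x, mv K (mv (lowerPart (p.A ℓ))ᵀ x)⟫_ℝ := fun K => by
    rw [mv_mul, mv_mul, inner_mv_right]
  have h1 := h0 (diagPart (p.A ℓ) + p.B ℓ * p.Γ⁻¹ * (p.B ℓ)ᵀ)⁻¹
  have h2 := h0 (diagPart (p.A ℓ))⁻¹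
  rw [← postSgs_sub] at h1
  rw [← sgs_sub] at h2
  have h3 := inner_inv_le (diagPart_posDef (p.A_posDef ℓ)) (p.lowRank_posSemidef ℓ)
    (mv (lowerPart (p.A ℓ))ᵀ x)
  rw [postA, sub_mv, inner_sub_right, add_mv, inner_add_right] at h1
  rw [sub_mv, inner_sub_right] at h2
  linarith

theorem postSgs_posDef (ℓ : ℕ) : (p.postSgs ℓ).PosDef := by
  simpa using Matrix.PosDef.posSemidef_add (p.postSgs_sub_posSemidef ℓ) (p.postA_posDef ℓ)

/-- Ensures that the Gaussian law prescribed for the smoothing draws really has this matrix as its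
covariance. -/
theorem smootherCov_posSemidef (ℓ : ℕ) :
    (p.postSgs ℓ + (p.postSgs ℓ)ᵀ - p.postA ℓ).PosSemidef := by
  rw [transpose_eq_of_posDef (p.postSgs_posDef ℓ), add_sub_assoc]
  exact (p.postSgs_posDef ℓ).posSemidef.add (p.postSgs_sub_posSemidef ℓ)

/-! ### Duality argument for the posterior form -/

/-- A bound for the low-rank part of the posterior form in the energy norm of the prior. -/
def obsBound : ℝ := ‖p.Γ⁻¹‖ * ‖p.obs‖ ^ 2 * ‖p.sqrtCov‖ ^ 2

theorem obsBound_nonneg : 0 ≤ p.obsBound := by unfold obsBound; positivity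

theorem abs_inner_obs_le (u v : H) :
    |⟪p.obs u, mv p.Γ⁻¹ (p.obs v)⟫_ℝ| ≤ ‖p.Γ⁻¹‖ * ‖p.obs‖ ^ 2 * (‖u‖ * ‖v‖) :=
  calc |⟪p.obs u, mv p.Γ⁻¹ (p.obs v)⟫_ℝ| ≤ ‖p.Γ⁻¹‖ * (‖p.obs u‖ * ‖p.obs v‖) := inner_mv_le _ _ _
    _ ≤ ‖p.Γ⁻¹‖ * ((‖p.obs‖ * ‖u‖) * (‖p.obs‖ * ‖v‖)) := by
      gcongr <;> exact p.obs.le_opNorm _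
    _ = _ := by ring

theorem postForm_le (u v : p.V) :
    p.postForm u v ≤ (1 + p.obsBound) * (p.normV u * p.normV v) := by
  have h1 := (le_abs_self _).trans (p.abs_a_le u v)
  have h2 := (le_abs_self _).trans (p.abs_inner_obs_le (u : H) (v : H))
  have h3 : ‖(u : H)‖ * ‖(v : H)‖ ≤ (‖p.sqrtCov‖ * p.normV u) * (‖p.sqrtCov‖ * p.normV v) :=
    mul_le_mul (p.norm_le_normV u) (p.norm_le_normV v) (norm_nonneg _)
      (mul_nonneg (norm_nonneg _) (p.normV_nonneg u))
  have h4 := mul_le_mul_of_nonneg_left h3 (show 0 ≤ ‖p.Γ⁻¹‖ * ‖p.obs‖ ^ 2 by positivity)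
  unfold postForm obsBound
  nlinarith

/-- Coercivity with constant one: the data can only add precision. Together with `postForm_le` it
makes the prior and posterior energies equivalent independently of the level. -/
theorem normV_sq_le_postForm (v : p.V) : p.normV v ^ 2 ≤ p.postForm v v := by
  rw [postForm, a_self]
  linarith [inner_mv_nonneg p.Γ_posDef.inv.posSemidef (p.obs (v : H))]

/-- Solvability of the variational problem of the posterior form. -/
theorem exists_post_solution (f : H) :
    ∃ u : p.V, ∀ φ : p.V, p.postForm u φ = ⟪f, (φ : H)⟫_ℝ := by
  set T : H →L[ℝ] Vec β := p.obs ∘L p.sqrtCov with hT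
  -- The low-rank structure reduces solvability to the finite system `(Γ + T T*) c = T 𝒜^{-1/2} f`
  -- with `T = obs ∘ 𝒜^{-1/2}`. Setting `𝒜^{1/2} u = 𝒜^{-1/2} f - T* c` then gives `obs u = Γ c`, so
  -- the term `Γ⁻¹ obs u = c` in the form compensates `T* c`.
  let N : Vec β →ₗ[ℝ] Vec β :=
    { toFun := fun c => mv p.Γ c + T (ContinuousLinearMap.adjoint T c)
      map_add' := fun c d => by rw [mv_add, map_add, map_add]; abel
      map_smul' := fun r c => by rw [mv_smul, map_smul, map_smul, smul_add]; rfl }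
  have hN : Function.Injective N := by
    refine (injective_iff_map_eq_zero N).2 fun c hc => ?_
    by_contra hne
    have h1 := (posDef_iff_inner.1 p.Γ_posDef).2 c hne
    have h2 : ⟪c, N c⟫_ℝ = ⟪c, mv p.Γ c⟫_ℝ + ‖ContinuousLinearMap.adjoint T c‖ ^ 2 := by
      change ⟪c, mv p.Γ c + T (ContinuousLinearMap.adjoint T c)⟫_ℝ = _
      rw [inner_add_right, ← ContinuousLinearMap.adjoint_inner_left, real_inner_self_eq_norm_sq]
    rw [hc, inner_zero_right] at h2
    nlinarith [sq_nonneg ‖ContinuousLinearMap.adjoint T c‖]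
  obtain ⟨c, hc⟩ := LinearMap.injective_iff_surjective.1 hN (T (p.sqrtCov f))
  obtain ⟨u, hu⟩ := p.exists_sqrtA_eq (p.sqrtCov f - ContinuousLinearMap.adjoint T c)
  refine ⟨u, fun φ => ?_⟩
  have hobs : ∀ v : p.V, p.obs (v : H) = T (p.sqrtA v) := fun v => by
    rw [hT, ContinuousLinearMap.comp_apply, sqrtCov_sqrtA]
  have h1 : p.obs (u : H) = mv p.Γ c := by
    rw [hobs, hu, map_sub, ← hc]
    exact add_sub_cancel_right _ _
  have hΓt : (p.Γ⁻¹)ᵀ = p.Γ⁻¹ := transpose_eq_of_posDef p.Γ_posDef.inv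
  rw [postForm, h1, inner_mv_right, hΓt, ← mv_mul, inv_mul_of_posDef p.Γ_posDef, one_mv, a, hu,
    inner_sub_left, ContinuousLinearMap.adjoint_inner_left, ← hobs, inner_sqrtCov, sqrtCov_sqrtA]
  ring

/-- Functions in `V_{ℓ+1}` that are orthogonal to `V_ℓ` in the posterior form are small in `H`. -/
theorem exists_galerkin_bound {Ψ : ℕ → ℝ} (h₂ : p.RegularityApproximation Ψ) :
    ∃ C : ℝ, 0 ≤ C ∧ ∀ (ℓ : ℕ) (e : p.V), (∀ v ∈ p.space ℓ, p.postForm v e = 0) →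
      ‖(e : H)‖ ^ 2 ≤ C * Ψ ℓ * p.normV e ^ 2 := by
  obtain ⟨W, normW, -, ⟨C, hC, hreg⟩, -, hΨ, happ⟩ := h₂
  have hκ := p.obsBound_nonneg
  refine ⟨(C * (1 + p.obsBound) ^ 2) ^ 2, by positivity, fun ℓ e he => ?_⟩
  -- Duality: test the problem with right-hand side `e` by `e` itself. Orthogonality permits
  -- subtracting any coarse function from `u`, and regularity of `u` makes the remainder of order
  -- `√Ψ(ℓ)`.
  obtain ⟨u, hu⟩ := p.exists_post_solution (e : H)
  have hsub : ∀ v w : p.V, p.postForm (v - w) e = p.postForm v e - p.postForm w e := fun v w => by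
    simp only [postForm, a, map_sub, inner_sub_left, Submodule.coe_sub]
    ring
  -- the solution as a weak solution of the prior problem
  set f' : H := (e : H) - ContinuousLinearMap.adjoint p.obs (mv p.Γ⁻¹ (p.obs (u : H))) with hf'
  have hweak : p.IsWeakSolution f' u := fun φ => by
    have hΓt : (p.Γ⁻¹)ᵀ = p.Γ⁻¹ := transpose_eq_of_posDef p.Γ_posDef.inv
    rw [hf', inner_sub_left, ContinuousLinearMap.adjoint_inner_left, ← hu φ, postForm,
      inner_mv_right, hΓt]
    ring
  have huV : p.normV u ≤ ‖p.sqrtCov‖ * ‖(e : H)‖ := by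
    have h1 := p.normV_sq_le_postForm u
    rw [hu u] at h1
    have h2 := (le_abs_self _).trans (abs_real_inner_le_norm (e : H) (u : H))
    have h3 := mul_le_mul_of_nonneg_left (p.norm_le_normV u) (norm_nonneg (e : H))
    rcases (p.normV_nonneg u).eq_or_lt with h0 | h0
    · rw [← h0]; positivity
    · refine le_of_mul_le_mul_right ?_ h0
      nlinarith
  have huH : ‖(u : H)‖ ≤ ‖p.sqrtCov‖ ^ 2 * ‖(e : H)‖ :=
    calc _ ≤ ‖p.sqrtCov‖ * p.normV u := p.norm_le_normV u
      _ ≤ ‖p.sqrtCov‖ * (‖p.sqrtCov‖ * ‖(e : H)‖) := by gcongr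
      _ = _ := by ring
  have hf'n : ‖f'‖ ≤ (1 + p.obsBound) * ‖(e : H)‖ := by
    have h1 : ‖ContinuousLinearMap.adjoint p.obs (mv p.Γ⁻¹ (p.obs (u : H)))‖ ≤
        p.obsBound * ‖(e : H)‖ :=
      calc _ ≤ ‖ContinuousLinearMap.adjoint p.obs‖ * ‖mv p.Γ⁻¹ (p.obs (u : H))‖ :=
            ContinuousLinearMap.le_opNorm _ _
        _ ≤ ‖p.obs‖ * (‖p.Γ⁻¹‖ * (‖p.obs‖ * (‖p.sqrtCov‖ ^ 2 * ‖(e : H)‖))) := by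
            rw [LinearIsometryEquiv.norm_map]
            gcongr
            refine (norm_mv_le _ _).trans ?_
            gcongr
            refine (p.obs.le_opNorm _).trans ?_
            gcongr
        _ = _ := by unfold obsBound; ring
    calc ‖f'‖ ≤ ‖(e : H)‖ + _ := norm_sub_le _ _
      _ ≤ ‖(e : H)‖ + p.obsBound * ‖(e : H)‖ := by gcongr
      _ = _ := by ring
  obtain ⟨huW, hnW⟩ := hreg f' u hweak
  have hinf := happ ℓ ⟨u, huW⟩
  have hk : 0 ≤ (1 + p.obsBound) * p.normV e := mul_nonneg (by linarith) (p.normV_nonneg e)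
  have h1 : ‖(e : H)‖ ^ 2 ≤ ((1 + p.obsBound) * p.normV e) *
      ⨅ v : p.space ℓ, p.normV (u - (v : p.V)) := by
    -- The best approximation need not be known to be attained, so the inequality is proved for each
    -- coarse function and the infimum taken afterwards.
    rw [Real.mul_iInf_of_nonneg hk]
    refine le_ciInf fun v => ?_
    have h := p.postForm_le (u - (v : p.V)) e
    rw [hsub, hu e, he v v.2, sub_zero, real_inner_self_eq_norm_sq] at h
    linarith
  have h2 : ‖(e : H)‖ * ‖(e : H)‖ ≤
      (C * (1 + p.obsBound) ^ 2 * √(Ψ ℓ) * p.normV e) * ‖(e : H)‖ :=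
    calc _ = ‖(e : H)‖ ^ 2 := by ring
      _ ≤ _ := h1
      _ ≤ ((1 + p.obsBound) * p.normV e) * (√(Ψ ℓ) * (C * ((1 + p.obsBound) * ‖(e : H)‖))) := by
        refine mul_le_mul_of_nonneg_left (hinf.trans ?_) hk
        gcongr
        exact hnW.trans (by gcongr)
      _ = _ := by ring
  have h3 : ‖(e : H)‖ ≤ C * (1 + p.obsBound) ^ 2 * √(Ψ ℓ) * p.normV e := by
    rcases (norm_nonneg (e : H)).eq_or_lt with h0 | h0
    · rw [← h0]
      have := p.normV_nonneg e
      positivity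
    · exact le_of_mul_le_mul_right h2 h0
  calc ‖(e : H)‖ ^ 2 ≤ (C * (1 + p.obsBound) ^ 2 * √(Ψ ℓ) * p.normV e) ^ 2 := by gcongr
    _ = (C * (1 + p.obsBound) ^ 2) ^ 2 * √(Ψ ℓ) ^ 2 * p.normV e ^ 2 := by ring
    _ = _ := by rw [Real.sq_sqrt (hΨ ℓ)]

/-- The smoother of the posterior is bounded by the scaled norm of `H`. -/
theorem exists_smoother_bound {Ψ : ℕ → ℝ} (h₁ : p.NormEquivalence)
    (hΨ : ∀ ℓ, 0 ≤ Ψ ℓ) (hΨa : Antitone Ψ) (h₃ : p.InverseInequality Ψ)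
    (hsgs : ∃ c : ℝ, ∀ ℓ, 1 ≤ ℓ → ‖p.sgs ℓ‖ ≤ c * ‖p.A ℓ‖) :
    ∃ C : ℝ, 0 ≤ C ∧ ∀ (ℓ : ℕ), 1 ≤ ℓ → ∀ x : Vec (p.n ℓ),
      Ψ ℓ * ⟪x, mv (p.postSgs ℓ) x⟫_ℝ ≤ C * ‖(p.Pmap ℓ x : H)‖ ^ 2 := by
  obtain ⟨Φ, c₁, c₂, -, hΦ, hc₁, hc₂, heq⟩ := h₁
  obtain ⟨c, hc⟩ := hsgs
  -- The first term bounds the prior smoother: `Ψ ‖A‖ ≤ (Φ / c₁)²`, while `Φ ‖x‖ ≤ c₂ ‖P x‖`, so `Φ`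
  -- drops out. The second bounds the observation term, using that `Ψ` is largest at level zero.
  refine ⟨|c| * (c₂ / c₁) ^ 2 + Ψ 0 * (‖p.Γ⁻¹‖ * ‖p.obs‖ ^ 2), by have := hΨ 0; positivity,
    fun ℓ hℓ x => ?_⟩
  have hA : Ψ ℓ * ‖p.A ℓ‖ ≤ (Φ ℓ / c₁) ^ 2 := by
    have : ‖Ψ ℓ • p.A ℓ‖ ≤ (Φ ℓ / c₁) ^ 2 := by
      have hps := (p.A_posDef ℓ).posSemidef.smul (hΨ ℓ)
      refine norm_le_of_posSemidef (by positivity) hps (posSemidef_iff_inner.2 ⟨?_, fun z => ?_⟩)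
      · rw [Matrix.transpose_sub, Matrix.transpose_smul, Matrix.transpose_one,
          transpose_eq_of_posSemidef hps]
      · have h1 := h₃.2 ℓ _ (p.Pmap_mem ℓ z)
        have h2 := (heq ℓ z).1
        have h3 : ‖(p.Pmap ℓ z : H)‖ ≤ Φ ℓ / c₁ * ‖z‖ := by
          rw [div_mul_eq_mul_div, le_div_iff₀ hc₁]; linarith
        have h4 : (√(Ψ ℓ) * p.normV (p.Pmap ℓ z)) ^ 2 ≤ (Φ ℓ / c₁ * ‖z‖) ^ 2 :=
          pow_le_pow_left₀ (mul_nonneg (Real.sqrt_nonneg _) (p.normV_nonneg _)) (h1.trans h3) 2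
        rw [mul_pow, Real.sq_sqrt (hΨ ℓ), mul_pow] at h4
        rw [sub_mv, smul_mv, smul_mv, one_mv, inner_sub_right, inner_smul_right, inner_smul_right,
          inner_A, a_self, real_inner_self_eq_norm_sq]
        linarith
    rwa [norm_smul, Real.norm_of_nonneg (hΨ ℓ)] at this
  have h1 := p.inner_postSgs_le ℓ x
  have h2 := (le_abs_self _).trans (p.abs_inner_obs_le (p.Pmap ℓ x : H) (p.Pmap ℓ x : H))
  rw [← inner_lowRank] at h2
  have h3 : ⟪x, mv (p.sgs ℓ) x⟫_ℝ ≤ (|c| * ‖p.A ℓ‖) * (‖x‖ * ‖x‖) := by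
    refine ((le_abs_self _).trans (inner_mv_le _ _ _)).trans ?_
    gcongr
    refine (hc ℓ hℓ).trans ?_
    gcongr
    exact le_abs_self c
  have h4 : (Φ ℓ * ‖x‖) ^ 2 ≤ (c₂ * ‖(p.Pmap ℓ x : H)‖) ^ 2 :=
    pow_le_pow_left₀ (mul_nonneg (hΦ ℓ) (norm_nonneg _)) (heq ℓ x).2 2
  calc Ψ ℓ * ⟪x, mv (p.postSgs ℓ) x⟫_ℝ
      ≤ Ψ ℓ * ((|c| * ‖p.A ℓ‖) * (‖x‖ * ‖x‖) +
        ‖p.Γ⁻¹‖ * ‖p.obs‖ ^ 2 * (‖(p.Pmap ℓ x : H)‖ * ‖(p.Pmap ℓ x : H)‖)) := by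
        refine mul_le_mul_of_nonneg_left ?_ (hΨ ℓ)
        linarith
    _ = |c| * ((Ψ ℓ * ‖p.A ℓ‖) * ‖x‖ ^ 2) +
        Ψ ℓ * (‖p.Γ⁻¹‖ * ‖p.obs‖ ^ 2) * ‖(p.Pmap ℓ x : H)‖ ^ 2 := by ring
    _ ≤ |c| * ((Φ ℓ / c₁) ^ 2 * ‖x‖ ^ 2) +
        Ψ 0 * (‖p.Γ⁻¹‖ * ‖p.obs‖ ^ 2) * ‖(p.Pmap ℓ x : H)‖ ^ 2 := by
        gcongr
        exact hΨa (Nat.zero_le ℓ)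
    _ = |c| / c₁ ^ 2 * (Φ ℓ * ‖x‖) ^ 2 +
        Ψ 0 * (‖p.Γ⁻¹‖ * ‖p.obs‖ ^ 2) * ‖(p.Pmap ℓ x : H)‖ ^ 2 := by
        field_simp
    _ ≤ |c| / c₁ ^ 2 * (c₂ * ‖(p.Pmap ℓ x : H)‖) ^ 2 +
        Ψ 0 * (‖p.Γ⁻¹‖ * ‖p.obs‖ ^ 2) * ‖(p.Pmap ℓ x : H)‖ ^ 2 := by gcongr
    _ = _ := by field_simp

/-- The approximation property of the posterior, measured in the norm of its smoother. -/
theorem exists_approximation {Ψ : ℕ → ℝ} (h₁ : p.NormEquivalence)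
    (h₂ : p.RegularityApproximation Ψ) (h₃ : p.InverseInequality Ψ)
    (hsgs : ∃ c : ℝ, ∀ ℓ, 1 ≤ ℓ → ‖p.sgs ℓ‖ ≤ c * ‖p.A ℓ‖) :
    ∃ C : ℝ, 0 ≤ C ∧ ∀ (ℓ : ℕ) (e : Vec (p.n (ℓ + 1))),
      mv ((p.prolong ℓ)ᵀ * p.postA (ℓ + 1)) e = 0 →
      ⟪e, mv (p.postSgs (ℓ + 1)) e⟫_ℝ ≤ C * ⟪e, mv (p.postA (ℓ + 1)) e⟫_ℝ := by
  obtain ⟨C₁, hC₁, hgal⟩ := p.exists_galerkin_bound h₂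
  obtain ⟨-, -, -, -, hΨa, hΨ, -⟩ := h₂
  obtain ⟨C₂, hC₂, hsm⟩ := p.exists_smoother_bound h₁ hΨ hΨa h₃ hsgs
  obtain ⟨⟨C₃, hC₃, hΨs⟩, -⟩ := h₃
  -- `C₁` is the duality constant, `C₂` the smoother constant, and `C₃` pays for passing from `Ψ ℓ`
  -- in the coarse approximation to `Ψ (ℓ + 1)` in the fine smoother bound.
  refine ⟨C₂ * C₁ * C₃, by positivity, fun ℓ e he => ?_⟩
  have hg := hgal ℓ (p.Pmap (ℓ + 1) e) fun v hv => by
    obtain ⟨x, rfl⟩ := p.exists_Pmap_eq hv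
    rw [← Pmap_prolong, ← inner_postA, inner_mv_left, ← mv_mul, he, inner_zero_right]
  have hV : p.normV (p.Pmap (ℓ + 1) e) ^ 2 ≤ ⟪e, mv (p.postA (ℓ + 1)) e⟫_ℝ := by
    rw [inner_postA]; exact p.normV_sq_le_postForm _
  have hg' : ‖(p.Pmap (ℓ + 1) e : H)‖ ^ 2 ≤
      C₁ * (C₃ * Ψ (ℓ + 1)) * ⟪e, mv (p.postA (ℓ + 1)) e⟫_ℝ := by
    refine hg.trans ?_
    have := hΨ (ℓ + 1)
    gcongr
    exact hΨs ℓ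
  -- If `Ψ` vanishes at the fine level, the duality bound forces `e = 0`; otherwise the factor `Ψ (ℓ
  -- + 1)` can be cancelled.
  rcases (hΨ (ℓ + 1)).eq_or_lt with h0 | h0
  · rw [← h0] at hg'
    have h1 : ‖(p.Pmap (ℓ + 1) e : H)‖ = 0 := by
      have : ‖(p.Pmap (ℓ + 1) e : H)‖ ^ 2 ≤ 0 := by simpa using hg'
      exact pow_eq_zero_iff two_ne_zero |>.1 (le_antisymm this (sq_nonneg _))
    have h2 : e = 0 := p.Pmap_eq_zero (Subtype.ext (norm_eq_zero.1 h1))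
    simp [h2]
  · refine le_of_mul_le_mul_left ?_ h0
    calc _ ≤ C₂ * ‖(p.Pmap (ℓ + 1) e : H)‖ ^ 2 := hsm (ℓ + 1) (Nat.le_add_left _ _) e
      _ ≤ C₂ * (C₁ * (C₃ * Ψ (ℓ + 1)) * ⟪e, mv (p.postA (ℓ + 1)) e⟫_ℝ) := by gcongr
      _ = _ := by ring

/-- The V-cycle contracts the energy norm uniformly in the level. -/
theorem exists_cycle_contraction {Ψ : ℕ → ℝ} (h₁ : p.NormEquivalence)
    (h₂ : p.RegularityApproximation Ψ) (h₃ : p.InverseInequality Ψ)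
    (hsgs : ∃ c : ℝ, ∀ ℓ, 1 ≤ ℓ → ‖p.sgs ℓ‖ ≤ c * ‖p.A ℓ‖) {k : ℕ} (hk : 1 ≤ k) :
    ∃ q : ℝ, 0 ≤ q ∧ q < 1 ∧ ∀ ℓ, (p.postA ℓ * p.iterMatrix k ℓ).PosSemidef ∧
      (q • p.postA ℓ - p.postA ℓ * p.iterMatrix k ℓ).PosSemidef := by
  obtain ⟨C, hC, happ⟩ := p.exists_approximation h₁ h₂ h₃ hsgs
  -- The value `C / (1 + C)` solves `(1 - q) C = q`, the least rate admitted by the two-level step.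
  -- It does not deteriorate under recursion because `C` is the same on all levels.
  have hq1 : C / (1 + C) < 1 := by rw [div_lt_one (by linarith)]; linarith
  have hq0 : 0 ≤ C / (1 + C) := by positivity
  refine ⟨C / (1 + C), hq0, hq1, fun ℓ => ?_⟩
  induction ℓ with
  | zero =>
    rw [iterMatrix, mul_zero, sub_zero]
    exact ⟨Matrix.PosSemidef.zero, (p.postA_posDef 0).posSemidef.smul hq0⟩
  | succ ℓ ih =>
    refine cycle_energy hk hC (p.postA_posDef (ℓ + 1)) (p.postA_posDef ℓ) (p.prolong_postA ℓ)
      (p.postSgs_sub_posSemidef (ℓ + 1)) (happ ℓ) hq0 hq1.le (le_of_eq ?_) ih.1 ih.2 rfl rfl rfl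
    field_simp
    ring

end InverseProblem

/-! ### Second moments of random vectors -/

section Cross

variable {Ω : Type*} [MeasurableSpace Ω] {P : Measure Ω} {l m n : ℕ}

/-- The matrix of mixed second moments of two random vectors. -/
def cross (P : Measure Ω) (X : Ω → Vec m) (Y : Ω → Vec n) : Matrix (Fin m) (Fin n) ℝ :=
  Matrix.of fun i j => ∫ ω, X ω i * Y ω j ∂P

theorem continuous_mv (A : Matrix (Fin m) (Fin n) ℝ) : Continuous (mv A) :=
  (PiLp.continuous_toLp 2 _).comp
    ((Continuous.matrix_mulVec continuous_const continuous_id).comp (PiLp.continuous_ofLp 2 _))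

theorem memLp_apply {X : Ω → Vec n} (hX : MemLp X 2 P) (i : Fin n) :
    MemLp (fun ω => X ω i) 2 P :=
  (EuclideanSpace.proj (𝕜 := ℝ) i).comp_memLp' hX

theorem memLp_mv {X : Ω → Vec n} (hX : MemLp X 2 P) (A : Matrix (Fin m) (Fin n) ℝ) :
    MemLp (fun ω => mv A (X ω)) 2 P :=
  hX.of_le_mul ((continuous_mv A).comp_aestronglyMeasurable hX.1)
    (Filter.Eventually.of_forall fun ω => norm_mv_le A (X ω))

theorem memLp_add {X Y : Ω → Vec n} (hX : MemLp X 2 P) (hY : MemLp Y 2 P) :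
    MemLp (fun ω => X ω + Y ω) 2 P := hX.add hY

theorem integrable_apply_mul {X : Ω → Vec m} {Y : Ω → Vec n} (hX : MemLp X 2 P)
    (hY : MemLp Y 2 P) (i : Fin m) (j : Fin n) : Integrable (fun ω => X ω i * Y ω j) P :=
  (memLp_apply hX i).integrable_mul (memLp_apply hY j)

theorem cross_transpose (X : Ω → Vec m) (Y : Ω → Vec n) : (cross P X Y)ᵀ = cross P Y X := by
  ext i j
  simp [cross, mul_comm]

theorem cross_eq_zero_comm {X : Ω → Vec m} {Y : Ω → Vec n} (h : cross P X Y = 0) :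
    cross P Y X = 0 := by
  rw [← cross_transpose, h, Matrix.transpose_zero]

theorem cross_add_left {X X' : Ω → Vec m} {Y : Ω → Vec n} (hX : MemLp X 2 P)
    (hX' : MemLp X' 2 P) (hY : MemLp Y 2 P) :
    cross P (fun ω => X ω + X' ω) Y = cross P X Y + cross P X' Y := by
  ext i j
  simp only [cross, Matrix.of_apply, Matrix.add_apply, PiLp.add_apply, add_mul]
  exact integral_add (integrable_apply_mul hX hY i j) (integrable_apply_mul hX' hY i j)

theorem cross_mv_left {X : Ω → Vec m} {Y : Ω → Vec n} (hX : MemLp X 2 P) (hY : MemLp Y 2 P)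
    (A : Matrix (Fin l) (Fin m) ℝ) : cross P (fun ω => mv A (X ω)) Y = A * cross P X Y := by
  ext i j
  simp only [cross, Matrix.of_apply, Matrix.mul_apply, mv_apply, Finset.sum_mul]
  rw [integral_finsetSum _ fun r _ => by
    simpa only [mul_assoc] using (integrable_apply_mul hX hY r j).const_mul (A i r)]
  exact Finset.sum_congr rfl fun r _ => by simp only [mul_assoc]; rw [integral_const_mul]

theorem cross_add_right {X : Ω → Vec m} {Y Y' : Ω → Vec n} (hX : MemLp X 2 P)
    (hY : MemLp Y 2 P) (hY' : MemLp Y' 2 P) :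
    cross P X (fun ω => Y ω + Y' ω) = cross P X Y + cross P X Y' := by
  rw [← cross_transpose, cross_add_left hY hY' hX, Matrix.transpose_add, cross_transpose,
    cross_transpose]

theorem cross_mv_right {X : Ω → Vec m} {Y : Ω → Vec n} (hX : MemLp X 2 P) (hY : MemLp Y 2 P)
    (A : Matrix (Fin l) (Fin n) ℝ) : cross P X (fun ω => mv A (Y ω)) = cross P X Y * Aᵀ := by
  rw [← cross_transpose, cross_mv_left hY hX, Matrix.transpose_mul, cross_transpose]

theorem cross_zero_left (Y : Ω → Vec n) : cross P (fun _ => (0 : Vec m)) Y = 0 := by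
  ext i j
  simp [cross]

/-- The second moments of the sum of two uncorrelated random vectors. -/
theorem cross_add_self {X Y : Ω → Vec n} (hX : MemLp X 2 P) (hY : MemLp Y 2 P)
    (h : cross P X Y = 0) :
    cross P (fun ω => X ω + Y ω) (fun ω => X ω + Y ω) = cross P X X + cross P Y Y := by
  rw [cross_add_left hX hY (memLp_add hX hY), cross_add_right hX hX hY, cross_add_right hY hX hY, h,
    cross_eq_zero_comm h, add_zero, zero_add]

theorem cross_mv_mv {r : ℕ} {X : Ω → Vec m} {Y : Ω → Vec n} (hX : MemLp X 2 P)
    (hY : MemLp Y 2 P) (A : Matrix (Fin l) (Fin m) ℝ) (B : Matrix (Fin r) (Fin n) ℝ) :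
    cross P (fun ω => mv A (X ω)) (fun ω => mv B (Y ω)) = A * cross P X Y * Bᵀ := by
  rw [cross_mv_left hX (memLp_mv hY B), cross_mv_right hX hY, Matrix.mul_assoc]

theorem inner_cross {X : Ω → Vec m} {Y : Ω → Vec n} (hX : MemLp X 2 P) (hY : MemLp Y 2 P)
    (u : Vec m) (v : Vec n) :
    ⟪u, mv (cross P X Y) v⟫_ℝ = ∫ ω, ⟪u, X ω⟫_ℝ * ⟪v, Y ω⟫_ℝ ∂P := by
  have h : ∀ ω, ⟪u, X ω⟫_ℝ * ⟪v, Y ω⟫_ℝ = ∑ i, ∑ j, u i * v j * (X ω i * Y ω j) := fun ω => by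
    rw [inner_eq_sum, inner_eq_sum, Finset.sum_mul_sum]
    exact Finset.sum_congr rfl fun i _ => Finset.sum_congr rfl fun j _ => by ring
  simp only [h]
  rw [integral_finsetSum _ fun i _ => integrable_finsetSum _ fun j _ =>
    (integrable_apply_mul hX hY i j).const_mul _]
  rw [inner_eq_sum]
  refine Finset.sum_congr rfl fun i _ => ?_
  rw [integral_finsetSum _ fun j _ => (integrable_apply_mul hX hY i j).const_mul _, mv_apply,
    Finset.mul_sum]
  refine Finset.sum_congr rfl fun j _ => ?_
  rw [integral_const_mul, cross, Matrix.of_apply]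
  ring

theorem cross_posSemidef {X : Ω → Vec n} (hX : MemLp X 2 P) : (cross P X X).PosSemidef := by
  refine posSemidef_iff_inner.2 ⟨cross_transpose X X, fun u => ?_⟩
  rw [inner_cross hX hX]
  exact integral_nonneg fun ω => mul_self_nonneg _

theorem cross_eq_zero_of_indepFun {X : Ω → Vec m} {Y : Ω → Vec n} (h : IndepFun X Y P)
    (hX : MemLp X 2 P) (hY : MemLp Y 2 P) (h0 : ∀ i, ∫ ω, X ω i ∂P = 0) : cross P X Y = 0 := by
  ext i j
  have hij : IndepFun (fun ω => X ω i) (fun ω => Y ω j) P :=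
    h.comp (φ := fun x : Vec m => x i) (ψ := fun y : Vec n => y j) (by fun_prop) (by fun_prop)
  rw [cross, Matrix.of_apply, hij.integral_fun_mul_eq_mul_integral (memLp_apply hX i).1
    (memLp_apply hY j).1, h0, zero_mul, Matrix.zero_apply]

/-- Being uncorrelated with constants means having mean zero. -/
theorem integral_apply_eq_zero_of_cross {X : Ω → Vec n}
    (h : cross P X (fun _ => EuclideanSpace.single (0 : Fin 1) (1 : ℝ)) = 0) (i : Fin n) :
    ∫ ω, X ω i ∂P = 0 := by
  have := congrFun (congrFun h i) 0
  simpa [cross] using this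

theorem cross_const_eq_zero {X : Ω → Vec n} (h : ∀ i, ∫ ω, X ω i ∂P = 0) (c : Vec m) :
    cross P X (fun _ => c) = 0 := by
  ext i j
  simp [cross, integral_mul_const, h]

theorem integral_vec_apply {X : Ω → Vec n} (hX : Integrable X P) (i : Fin n) :
    (∫ ω, X ω ∂P) i = ∫ ω, X ω i ∂P :=
  ((EuclideanSpace.proj (𝕜 := ℝ) i).integral_comp_comm hX).symm

theorem covMatrix_eq_cross [IsProbabilityMeasure P] {X : Ω → Vec n} (hX : MemLp X 2 P) :
    InverseProblem.covMatrix P X =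
      cross P (fun ω => X ω - ∫ ω, X ω ∂P) (fun ω => X ω - ∫ ω, X ω ∂P) := by
  ext i j
  have h := integral_vec_apply (hX.integrable one_le_two)
  simp only [InverseProblem.covMatrix, cross, covariance, Matrix.of_apply, PiLp.sub_apply, h]

/-- Moments of a random vector with a Gaussian law. -/
theorem gaussian_moments {X : Ω → Vec n} {μ : Vec n} {S : Matrix (Fin n) (Fin n) ℝ}
    (hS : S.PosSemidef) (hX : HasLaw X (multivariateGaussian μ S) P) :
    MemLp X 2 P ∧ ∫ ω, X ω ∂P = μ ∧ InverseProblem.covMatrix P X = S := by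
  refine ⟨?_, ?_, ?_⟩
  · have h : MemLp id 2 (multivariateGaussian μ S) := IsGaussian.memLp_two_id
    rw [← hX.map_eq] at h
    exact h.comp_of_map hX.aemeasurable
  · rw [hX.integral_eq]
    exact integral_id_multivariateGaussian
  · ext i j
    rw [InverseProblem.covMatrix, Matrix.of_apply,
      ← covariance_eval_multivariateGaussian (μ := μ) hS i j]
    exact hX.covariance_fun_comp (f := fun x : Vec n => x i) (g := fun x : Vec n => x j)
      (by fun_prop) (by fun_prop)

theorem centered_gaussian_moments [IsProbabilityMeasure P] {X : Ω → Vec n}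
    {S : Matrix (Fin n) (Fin n) ℝ} (hS : S.PosSemidef)
    (hX : HasLaw X (multivariateGaussian 0 S) P) :
    MemLp X 2 P ∧ (∀ i, ∫ ω, X ω i ∂P = 0) ∧ cross P X X = S := by
  obtain ⟨h1, h2, h3⟩ := gaussian_moments hS hX
  refine ⟨h1, fun i => ?_, ?_⟩
  · rw [← integral_vec_apply (h1.integrable one_le_two), h2, PiLp.zero_apply]
  · rw [← h3, covMatrix_eq_cross h1, h2]
    simp only [sub_zero]

end Cross

/-! ### The random smoother -/

section Smoother

variable {Ω : Type*} [MeasurableSpace Ω] {P : Measure Ω} {m n : ℕ}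
  {A M : Matrix (Fin n) (Fin n) ℝ}

theorem smoothing_succ_zero (hM : M⁻¹ * M = 1) (ξ : ℕ → Vec n) (k : ℕ) :
    smoothing A M 0 ξ (k + 1) 0 =
      mv (M⁻¹ * (M - A)) (smoothing A M 0 ξ k 0) + mv M⁻¹ (ξ k) := by
  simp only [smoothing, randomSmoother, zero_add]
  rw [mul_sub, hM, sub_mv, one_mv, mv_sub, mv_mul]
  abel

/-- The random smoother is affine, with the solution of the linear system as a fixed point. -/
theorem smoothing_eq (hM : M⁻¹ * M = 1) (ξ : ℕ → Vec n) (k : ℕ) (μ θ : Vec n) :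
    smoothing A M (mv A μ) ξ k θ =
      mv ((M⁻¹ * (M - A)) ^ k) (θ - μ) + μ + smoothing A M 0 ξ k 0 := by
  induction k with
  | zero => simp [smoothing, one_mv]
  | succ k ih =>
    rw [smoothing_succ_zero hM, smoothing, ih, pow_succ', mv_mul]
    generalize mv ((M⁻¹ * (M - A)) ^ k) (θ - μ) = u
    generalize smoothing A M 0 ξ k 0 = v
    rw [randomSmoother, mul_sub, hM]
    simp only [sub_mv, one_mv, mv_mul, mv_add, mv_sub]
    abel

variable {ξ : ℕ → Ω → Vec n} {k : ℕ}

theorem memLp_smoothing (hM : M⁻¹ * M = 1) (hξ : ∀ j < k, MemLp (ξ j) 2 P) :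
    MemLp (fun ω => smoothing A M 0 (fun j => ξ j ω) k 0) 2 P := by
  induction k with
  | zero => exact MemLp.zero
  | succ k ih =>
    simp only [smoothing_succ_zero hM]
    exact (memLp_mv (ih fun j hj => hξ j (hj.trans k.lt_succ_self)) _).add
      (memLp_mv (hξ k k.lt_succ_self) _)

theorem cross_smoothing_eq_zero (hM : M⁻¹ * M = 1) (hξ : ∀ j < k, MemLp (ξ j) 2 P)
    {Y : Ω → Vec m} (hY : MemLp Y 2 P) (h : ∀ j < k, cross P (ξ j) Y = 0) :
    cross P (fun ω => smoothing A M 0 (fun j => ξ j ω) k 0) Y = 0 := by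
  induction k with
  | zero => exact cross_zero_left Y
  | succ k ih =>
    have hlt : ∀ j < k, j < k + 1 := fun j hj => hj.trans k.lt_succ_self
    have hν := memLp_smoothing (A := A) hM fun j hj => hξ j (hlt j hj)
    have hk := hξ k k.lt_succ_self
    simp only [smoothing_succ_zero hM]
    rw [cross_add_left (memLp_mv hν _) (memLp_mv hk _) hY, cross_mv_left hν hY,
      cross_mv_left hk hY, h k k.lt_succ_self,
      ih (fun j hj => hξ j (hlt j hj)) fun j hj => h j (hlt j hj), Matrix.mul_zero,
      Matrix.mul_zero, add_zero]

/-- The noise of the random smoother leaves `N(0, A⁻¹)` invariant. -/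
theorem cross_smoothing_self (hA : A.PosDef) (hM : M.PosDef) (hξ : ∀ j < k, MemLp (ξ j) 2 P)
    (hcov : ∀ j < k, cross P (ξ j) (ξ j) = M + Mᵀ - A)
    (hort : ∀ i < k, ∀ j < k, i ≠ j → cross P (ξ i) (ξ j) = 0) :
    cross P (fun ω => smoothing A M 0 (fun j => ξ j ω) k 0)
      (fun ω => smoothing A M 0 (fun j => ξ j ω) k 0) =
      A⁻¹ - (M⁻¹ * (M - A)) ^ k * A⁻¹ * ((M⁻¹ * (M - A)) ^ k)ᵀ := by
  have hM1 := inv_mul_of_posDef hM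
  have hM2 := mul_inv_of_posDef hM
  have hA1 := inv_mul_of_posDef hA
  have hA2 := mul_inv_of_posDef hA
  induction k with
  | zero => simp [smoothing, cross_zero_left]
  | succ k ih =>
    have hlt : ∀ j < k, j < k + 1 := fun j hj => hj.trans k.lt_succ_self
    have hν := memLp_smoothing (A := A) hM1 fun j hj => hξ j (hlt j hj)
    have hk := hξ k k.lt_succ_self
    have h0 : cross P (fun ω => smoothing A M 0 (fun j => ξ j ω) k 0) (ξ k) = 0 :=
      cross_smoothing_eq_zero hM1 (fun j hj => hξ j (hlt j hj)) hk
        fun j hj => hort j (hlt j hj) k k.lt_succ_self hj.ne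
    have ih' := ih (fun j hj => hξ j (hlt j hj)) (fun j hj => hcov j (hlt j hj))
      fun i hi j hj => hort i (hlt i hi) j (hlt j hj)
    simp only [smoothing_succ_zero hM1]
    rw [cross_add_self (memLp_mv hν _) (memLp_mv hk _)
      (by rw [cross_mv_mv hν hk, h0, Matrix.mul_zero, Matrix.zero_mul]),
      cross_mv_mv hν hν, cross_mv_mv hk hk, ih', hcov k k.lt_succ_self]
    -- Invariance for a single step: the covariance `M + Mᵀ - A` is chosen so that the injected
    -- noise equals the covariance lost by `A⁻¹` under `S`.
    have hN : M⁻¹ * (M + Mᵀ - A) * (M⁻¹)ᵀ =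
        A⁻¹ - (M⁻¹ * (M - A)) * A⁻¹ * (M⁻¹ * (M - A))ᵀ := by
      have hAt := transpose_eq_of_posDef hA
      have hMt := transpose_eq_of_posDef hM
      have hMit : (M⁻¹)ᵀ = M⁻¹ := by rw [Matrix.transpose_nonsing_inv, hMt]
      rw [Matrix.transpose_mul, Matrix.transpose_sub, hAt, hMt, hMit]
      have e1 : M⁻¹ * (M + M - A) * M⁻¹ = (M⁻¹ * M) * M⁻¹ + (M⁻¹ * M) * M⁻¹ - M⁻¹ * A * M⁻¹ := by
        noncomm_ring
      have e2 : M⁻¹ * (M - A) * A⁻¹ * ((M - A) * M⁻¹) =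
          (M⁻¹ * M) * A⁻¹ * (M * M⁻¹) - M⁻¹ * (A * A⁻¹) * (M * M⁻¹) -
            (M⁻¹ * M) * (A⁻¹ * A) * M⁻¹ + M⁻¹ * (A * A⁻¹) * A * M⁻¹ := by
        noncomm_ring
      rw [e1, e2, hM1, hM2, hA1, hA2]
      noncomm_ring
    rw [hN]
    generalize M⁻¹ * (M - A) = S
    rw [pow_succ' S k, Matrix.transpose_mul]
    noncomm_ring

end Smoother

/-! ### Second moments of one multigrid Monte Carlo cycle -/

section CoarseCovariance

variable {m n : ℕ} {A : Matrix (Fin n) (Fin n) ℝ}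

/-- The coarse correction with exact coarse second moments leaves `A⁻¹` invariant. -/
theorem coarse_covariance {Ac Xc : Matrix (Fin m) (Fin m) ℝ} {J : Matrix (Fin n) (Fin m) ℝ}
    (hA : A.PosDef) (hAc : Ac.PosDef) (hJ : Jᵀ * A * J = Ac)
    {R : Matrix (Fin m) (Fin n) ℝ} (hR : R = Ac⁻¹ * Jᵀ * A) :
    (1 - J * R + J * Xc * R) * A⁻¹ * (1 - J * R + J * Xc * R)ᵀ +
      J * (Ac⁻¹ - Xc * Ac⁻¹ * Xcᵀ) * Jᵀ = A⁻¹ := by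
  have hAt := transpose_eq_of_posDef hA
  have hAct := transpose_eq_of_posDef hAc
  have hAcit : (Ac⁻¹)ᵀ = Ac⁻¹ := by rw [Matrix.transpose_nonsing_inv, hAct]
  have hRt : Rᵀ = A * J * Ac⁻¹ := by
    rw [hR, Matrix.transpose_mul, Matrix.transpose_mul, hAt, hAcit, Matrix.transpose_transpose,
      Matrix.mul_assoc]
  have h1 : R * A⁻¹ = Ac⁻¹ * Jᵀ := by
    rw [hR, Matrix.mul_assoc, mul_inv_of_posDef hA, Matrix.mul_one]
  have h2 : A⁻¹ * Rᵀ = J * Ac⁻¹ := by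
    rw [hRt, ← Matrix.mul_assoc, ← Matrix.mul_assoc, inv_mul_of_posDef hA, Matrix.one_mul]
  have h3 : R * (J * Ac⁻¹) = Ac⁻¹ := by
    rw [hR, Matrix.mul_assoc Ac⁻¹, Matrix.mul_assoc Ac⁻¹, ← Matrix.mul_assoc (Jᵀ * A), hJ,
      mul_inv_of_posDef hAc, Matrix.mul_one]
  have hZt : (1 - J * R + J * Xc * R)ᵀ = 1 - Rᵀ * Jᵀ + Rᵀ * (Xcᵀ * Jᵀ) := by
    simp [Matrix.transpose_add, Matrix.transpose_sub, Matrix.transpose_mul]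
  -- Here `J Ac⁻¹ Jᵀ` is the part of `A⁻¹` seen by the coarse space. Multiplying the matrix by `R`
  -- cancels that part and leaves only the contribution of `Xc`, exactly what the coarse noise
  -- restores.
  have h4 : A⁻¹ * (1 - J * R + J * Xc * R)ᵀ =
      A⁻¹ - J * Ac⁻¹ * Jᵀ + J * Ac⁻¹ * (Xcᵀ * Jᵀ) := by
    rw [hZt, mul_add, mul_sub, mul_one, ← Matrix.mul_assoc, ← Matrix.mul_assoc, h2]
  have h5 : R * (A⁻¹ * (1 - J * R + J * Xc * R)ᵀ) = Ac⁻¹ * (Xcᵀ * Jᵀ) := by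
    rw [h4, Matrix.mul_add, Matrix.mul_sub, h1, ← Matrix.mul_assoc R, h3, ← Matrix.mul_assoc R, h3,
      sub_self, zero_add]
  rw [Matrix.mul_assoc, add_mul, sub_mul, one_mul, Matrix.mul_assoc J R, Matrix.mul_assoc (J * Xc) R,
    h5, h4, Matrix.mul_sub, Matrix.sub_mul]
  simp only [Matrix.mul_assoc]
  abel

end CoarseCovariance

/-! ### Affine structure of the V-cycle. -/

namespace InverseProblem

variable {H : Type*} [NormedAddCommGroup H] [InnerProductSpace ℝ H] [CompleteSpace H] {β : ℕ}
  (p : InverseProblem H β)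

/-- The iteration matrix of one smoothing step. -/
def smoothIter (ℓ : ℕ) : Matrix (Fin (p.n ℓ)) (Fin (p.n ℓ)) ℝ :=
  (p.postSgs ℓ)⁻¹ * (p.postSgs ℓ - p.postA ℓ)

/-- The energy projection onto the coarse level. -/
def energyRestrict (ℓ : ℕ) : Matrix (Fin (p.n ℓ)) (Fin (p.n (ℓ + 1))) ℝ :=
  (p.postA ℓ)⁻¹ * (p.prolong ℓ)ᵀ * p.postA (ℓ + 1)

/-- The iteration matrix of the coarse correction. -/
def coarseIter (k ℓ : ℕ) : Matrix (Fin (p.n (ℓ + 1))) (Fin (p.n (ℓ + 1))) ℝ :=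
  1 - p.prolong ℓ * p.energyRestrict ℓ +
    p.prolong ℓ * p.iterMatrix k ℓ * p.energyRestrict ℓ

/-- The noise added by `k` smoothing steps. -/
def smootherNoise (k ℓ : ℕ) (ξ : ℕ → Vec (p.n ℓ)) : Vec (p.n ℓ) :=
  smoothing (p.postA ℓ) (p.postSgs ℓ) 0 ξ k 0

theorem iterMatrix_succ (k ℓ : ℕ) :
    p.iterMatrix k (ℓ + 1) =
      p.smoothIter (ℓ + 1) ^ k * p.coarseIter k ℓ * p.smoothIter (ℓ + 1) ^ k := rfl

theorem postA_mul_energyRestrict (ℓ : ℕ) :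
    p.postA ℓ * p.energyRestrict ℓ = (p.prolong ℓ)ᵀ * p.postA (ℓ + 1) := by
  rw [energyRestrict, ← Matrix.mul_assoc, ← Matrix.mul_assoc,
    mul_inv_of_posDef (p.postA_posDef ℓ), Matrix.one_mul]

variable (k : ℕ) (ζ : Vec (p.n 0)) (ξ : (ℓ : ℕ) → Bool → ℕ → Vec (p.n (ℓ + 1)))

/-- The induction step, kept in factored form because it is needed twice: for affinity of the cycle
and for the recursion of its noise. The coarse residual equation is itself a system with known
solution, so the affine form of the coarse cycle applies to it. -/
theorem vCycle_succ_of_affine (ℓ : ℕ)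
    (ih : ∀ μ θ, p.vCycle k ζ ξ ℓ (mv (p.postA ℓ) μ) θ =
      mv (p.iterMatrix k ℓ) (θ - μ) + μ + p.vCycle k ζ ξ ℓ 0 0)
    (μ θ : Vec (p.n (ℓ + 1))) :
    p.vCycle k ζ ξ (ℓ + 1) (mv (p.postA (ℓ + 1)) μ) θ =
      mv (p.smoothIter (ℓ + 1) ^ k)
        (mv (p.coarseIter k ℓ)
          (mv (p.smoothIter (ℓ + 1) ^ k) (θ - μ) + p.smootherNoise k (ℓ + 1) (ξ ℓ false)) +
          mv (p.prolong ℓ) (p.vCycle k ζ ξ ℓ 0 0)) + μ +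
        p.smootherNoise k (ℓ + 1) (ξ ℓ true) := by
  have hM := inv_mul_of_posDef (p.postSgs_posDef (ℓ + 1))
  rw [vCycle]
  simp only [smoothing_eq hM]
  rw [← smoothIter, ← smootherNoise, ← smootherNoise]
  set d := mv (p.smoothIter (ℓ + 1) ^ k) (θ - μ) + p.smootherNoise k (ℓ + 1) (ξ ℓ false) with hd
  have e1 : mv (p.smoothIter (ℓ + 1) ^ k) (θ - μ) + μ +
      p.smootherNoise k (ℓ + 1) (ξ ℓ false) = d + μ := by rw [hd]; abel
  rw [e1]
  -- The restricted residual of an error `d` is the coarse matrix applied to `-R d`: the exact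
  -- coarse correction would remove the energy projection of the error.
  have e2 : mv (p.prolong ℓ)ᵀ (mv (p.postA (ℓ + 1)) μ - mv (p.postA (ℓ + 1)) (d + μ)) =
      mv (p.postA ℓ) (-mv (p.energyRestrict ℓ) d) := by
    rw [← mv_sub, ← mv_mul, ← postA_mul_energyRestrict, sub_add_cancel_right, mv_mul, mv_neg]
  rw [e2, ih]
  have e3 : d + μ + mv (p.prolong ℓ) (mv (p.iterMatrix k ℓ) (0 - -mv (p.energyRestrict ℓ) d) +
      -mv (p.energyRestrict ℓ) d + p.vCycle k ζ ξ ℓ 0 0) - μ =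
      mv (p.coarseIter k ℓ) d + mv (p.prolong ℓ) (p.vCycle k ζ ξ ℓ 0 0) := by
    rw [coarseIter, zero_sub, neg_neg, mv_add, mv_add, mv_neg, add_mv, sub_mv, one_mv, mv_mul,
      mv_mul, mv_mul]
    abel
  rw [e3]

/-- The V-cycle is affine, with the solution of the linear system as a fixed point. -/
theorem vCycle_eq (ℓ : ℕ) (μ θ : Vec (p.n ℓ)) :
    p.vCycle k ζ ξ ℓ (mv (p.postA ℓ) μ) θ =
      mv (p.iterMatrix k ℓ) (θ - μ) + μ + p.vCycle k ζ ξ ℓ 0 0 := by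
  induction ℓ with
  | zero =>
    rw [vCycle, vCycle, iterMatrix, ← mv_mul, inv_mul_of_posDef (p.postA_posDef 0), one_mv,
      zero_mv, mv_zero, zero_add, zero_add]
  | succ ℓ ih =>
    have h0 := p.vCycle_succ_of_affine k ζ ξ ℓ ih 0 0
    rw [mv_zero, sub_zero, mv_zero, zero_add, add_zero] at h0
    rw [p.vCycle_succ_of_affine k ζ ξ ℓ ih, h0, iterMatrix_succ, mv_mul, mv_mul, mv_add, mv_add,
      mv_add, mv_add]
    abel

/-- The noise of the V-cycle in terms of the noise on the coarse level. -/
theorem vCycle_noise_succ (ℓ : ℕ) :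
    p.vCycle k ζ ξ (ℓ + 1) 0 0 =
      mv (p.smoothIter (ℓ + 1) ^ k * p.coarseIter k ℓ)
        (p.smootherNoise k (ℓ + 1) (ξ ℓ false)) +
      mv (p.smoothIter (ℓ + 1) ^ k * p.prolong ℓ) (p.vCycle k ζ ξ ℓ 0 0) +
      p.smootherNoise k (ℓ + 1) (ξ ℓ true) := by
  have h0 := p.vCycle_succ_of_affine k ζ ξ ℓ (p.vCycle_eq k ζ ξ ℓ) 0 0
  rw [mv_zero, sub_zero, mv_zero, zero_add, add_zero] at h0
  rw [h0, mv_mul, mv_mul, mv_add]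

end InverseProblem

/-! ### Covariance of the cycle noise and reduction of the chain to a linear recursion. -/

namespace InverseProblem

variable {H : Type*} [NormedAddCommGroup H] [InnerProductSpace ℝ H] [CompleteSpace H] {β : ℕ}
  (p : InverseProblem H β) {Ω : Type*} [MeasurableSpace Ω]

/-- The second moment properties of the draws of one V-cycle on level `L`. -/
structure IsUncorrelatedDraws (k L : ℕ) (P : Measure Ω) (ζ : Ω → Vec (p.n 0))
    (ξ : (ℓ : ℕ) → Bool → ℕ → Ω → Vec (p.n (ℓ + 1))) : Prop where
  memLp_coarse : MemLp ζ 2 P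
  memLp_smoother : ∀ ℓ < L, ∀ b, ∀ j < k, MemLp (ξ ℓ b j) 2 P
  cross_coarse : cross P ζ ζ = (p.postA 0)⁻¹
  cross_smoother : ∀ ℓ < L, ∀ b, ∀ j < k, cross P (ξ ℓ b j) (ξ ℓ b j) =
    p.postSgs (ℓ + 1) + (p.postSgs (ℓ + 1))ᵀ - p.postA (ℓ + 1)
  cross_coarse_smoother : ∀ ℓ < L, ∀ b, ∀ j < k, cross P ζ (ξ ℓ b j) = 0
  cross_ne : ∀ ℓ < L, ∀ b, ∀ j < k, ∀ ℓ' < L, ∀ b', ∀ j' < k, (ℓ, b, j) ≠ (ℓ', b', j') →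
    cross P (ξ ℓ b j) (ξ ℓ' b' j') = 0

variable {p} {k L : ℕ} {P : Measure Ω} {ζ : Ω → Vec (p.n 0)}
  {ξ : (ℓ : ℕ) → Bool → ℕ → Ω → Vec (p.n (ℓ + 1))}

namespace IsUncorrelatedDraws

theorem memLp_smootherNoise (h : p.IsUncorrelatedDraws k L P ζ ξ) {ℓ : ℕ} (hℓ : ℓ < L) (b : Bool) :
    MemLp (fun ω => p.smootherNoise k (ℓ + 1) fun j => ξ ℓ b j ω) 2 P :=
  memLp_smoothing (inv_mul_of_posDef (p.postSgs_posDef (ℓ + 1))) (h.memLp_smoother ℓ hℓ b)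

theorem cross_smootherNoise_eq_zero (h : p.IsUncorrelatedDraws k L P ζ ξ) {ℓ m : ℕ} (hℓ : ℓ < L)
    (b : Bool) {Y : Ω → Vec m} (hY : MemLp Y 2 P) (h0 : ∀ j < k, cross P (ξ ℓ b j) Y = 0) :
    cross P (fun ω => p.smootherNoise k (ℓ + 1) fun j => ξ ℓ b j ω) Y = 0 :=
  cross_smoothing_eq_zero (inv_mul_of_posDef (p.postSgs_posDef (ℓ + 1)))
    (h.memLp_smoother ℓ hℓ b) hY h0

theorem memLp_noise (h : p.IsUncorrelatedDraws k L P ζ ξ) {ℓ : ℕ} (hℓ : ℓ ≤ L) :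
    MemLp (fun ω => p.vCycle k (ζ ω) (fun ℓ b j => ξ ℓ b j ω) ℓ 0 0) 2 P := by
  induction ℓ with
  | zero => simpa [vCycle, mv_zero] using h.memLp_coarse
  | succ ℓ ih =>
    simp only [vCycle_noise_succ]
    exact ((memLp_mv (h.memLp_smootherNoise hℓ false) _).add
      (memLp_mv (ih (Nat.le_of_succ_le hℓ)) _)).add (h.memLp_smootherNoise hℓ true)

/-- The noise is linear in the draws. On level `ℓ` it involves only the coarse draw and the draws
indexed below `ℓ`, so orthogonality to those suffices; this is what separates it from the smoother
draws of the next level. -/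
theorem cross_noise_eq_zero (h : p.IsUncorrelatedDraws k L P ζ ξ) {m : ℕ} {Y : Ω → Vec m}
    (hY : MemLp Y 2 P) (hζ : cross P ζ Y = 0) {ℓ : ℕ} (hℓ : ℓ ≤ L)
    (hξ : ∀ ℓ' < ℓ, ∀ b, ∀ j < k, cross P (ξ ℓ' b j) Y = 0) :
    cross P (fun ω => p.vCycle k (ζ ω) (fun ℓ b j => ξ ℓ b j ω) ℓ 0 0) Y = 0 := by
  induction ℓ with
  | zero => simpa [vCycle, mv_zero] using hζ
  | succ ℓ ih =>
    have h1 := h.memLp_smootherNoise hℓ false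
    have h2 := h.memLp_noise (Nat.le_of_succ_le hℓ)
    simp only [vCycle_noise_succ]
    rw [cross_add_left (memLp_add (memLp_mv h1 _) (memLp_mv h2 _)) (h.memLp_smootherNoise hℓ true) hY,
      cross_add_left (memLp_mv h1 _) (memLp_mv h2 _) hY, cross_mv_left h1 hY, cross_mv_left h2 hY,
      ih (Nat.le_of_succ_le hℓ) fun ℓ' hℓ' => hξ ℓ' (hℓ'.trans ℓ.lt_succ_self),
      h.cross_smootherNoise_eq_zero hℓ _ hY (hξ ℓ ℓ.lt_succ_self _),
      h.cross_smootherNoise_eq_zero hℓ _ hY (hξ ℓ ℓ.lt_succ_self _)]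
    simp

/-- The noise of the V-cycle leaves the second moments of the posterior invariant. -/
theorem cross_noise_self (h : p.IsUncorrelatedDraws k L P ζ ξ) {ℓ : ℕ} (hℓ : ℓ ≤ L) :
    cross P (fun ω => p.vCycle k (ζ ω) (fun ℓ b j => ξ ℓ b j ω) ℓ 0 0)
      (fun ω => p.vCycle k (ζ ω) (fun ℓ b j => ξ ℓ b j ω) ℓ 0 0) =
      (p.postA ℓ)⁻¹ - p.iterMatrix k ℓ * (p.postA ℓ)⁻¹ * (p.iterMatrix k ℓ)ᵀ := by
  induction ℓ with
  | zero => simpa [vCycle, mv_zero, iterMatrix] using h.cross_coarse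
  | succ ℓ ih =>
    have hℓ' := Nat.le_of_succ_le hℓ
    have h1 := h.memLp_smootherNoise hℓ false
    have h2 := h.memLp_noise hℓ'
    have h3 := h.memLp_smootherNoise hℓ true
    have h12 := memLp_mv h1 (p.smoothIter (ℓ + 1) ^ k * p.coarseIter k ℓ)
    have h22 := memLp_mv h2 (p.smoothIter (ℓ + 1) ^ k * p.prolong ℓ)
    -- coarse noise and smoother noises are uncorrelated
    have hne : ∀ b, ∀ ℓ' < ℓ, ∀ b', ∀ j' < k, ∀ j < k, cross P (ξ ℓ' b' j') (ξ ℓ b j) = 0 :=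
      fun b ℓ' hl b' j' hj' j hj => h.cross_ne ℓ' (hl.trans hℓ) b' j' hj' ℓ hℓ b j hj
        fun e => hl.ne (congrArg Prod.fst e)
    have hc : ∀ b, cross P (fun ω => p.smootherNoise k (ℓ + 1) fun j => ξ ℓ b j ω)
        (fun ω => p.vCycle k (ζ ω) (fun ℓ b j => ξ ℓ b j ω) ℓ 0 0) = 0 := fun b =>
      h.cross_smootherNoise_eq_zero hℓ b h2 fun j hj => cross_eq_zero_comm
        (h.cross_noise_eq_zero (h.memLp_smoother ℓ hℓ b j hj)
          (h.cross_coarse_smoother ℓ hℓ b j hj) hℓ'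
          fun ℓ' hl b' j' hj' => hne b ℓ' hl b' j' hj' j hj)
    have hft : cross P (fun ω => p.smootherNoise k (ℓ + 1) fun j => ξ ℓ false j ω)
        (fun ω => p.smootherNoise k (ℓ + 1) fun j => ξ ℓ true j ω) = 0 :=
      h.cross_smootherNoise_eq_zero hℓ _ h3 fun j hj => cross_eq_zero_comm
        (h.cross_smootherNoise_eq_zero hℓ _ (h.memLp_smoother ℓ hℓ _ j hj) fun j' hj' =>
          h.cross_ne ℓ hℓ _ j' hj' ℓ hℓ _ j hj (by simp))
    have hself : ∀ b, cross P (fun ω => p.smootherNoise k (ℓ + 1) fun j => ξ ℓ b j ω)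
        (fun ω => p.smootherNoise k (ℓ + 1) fun j => ξ ℓ b j ω) = (p.postA (ℓ + 1))⁻¹ -
          p.smoothIter (ℓ + 1) ^ k * (p.postA (ℓ + 1))⁻¹ * (p.smoothIter (ℓ + 1) ^ k)ᵀ := fun b =>
      cross_smoothing_self (p.postA_posDef (ℓ + 1)) (p.postSgs_posDef (ℓ + 1))
        (h.memLp_smoother ℓ hℓ b) (h.cross_smoother ℓ hℓ b) fun i hi j hj hij =>
          h.cross_ne ℓ hℓ b i hi ℓ hℓ b j hj (by simpa using hij)
    have hkey := coarse_covariance (Xc := p.iterMatrix k ℓ) (p.postA_posDef (ℓ + 1))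
      (p.postA_posDef ℓ) (p.prolong_postA ℓ) (show p.energyRestrict ℓ = _ from rfl)
    rw [← coarseIter] at hkey
    simp only [vCycle_noise_succ]
    rw [cross_add_self (memLp_add h12 h22) h3, cross_add_self h12 h22, cross_mv_mv h1 h1,
      cross_mv_mv h2 h2, hself, hself, ih hℓ', iterMatrix_succ]
    · generalize p.smoothIter (ℓ + 1) ^ k = S at *
      generalize p.coarseIter k ℓ = Z at *
      simp only [Matrix.transpose_mul]
      -- `hkey` rewrites the prolonged coarse noise as `A⁻¹ - Z A⁻¹ Zᵀ`. The three noise covariances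
      -- then telescope to `A⁻¹ - (S Z S) A⁻¹ (S Z S)ᵀ`.
      have e : S * p.prolong ℓ * ((p.postA ℓ)⁻¹ - p.iterMatrix k ℓ * (p.postA ℓ)⁻¹ *
          (p.iterMatrix k ℓ)ᵀ) * ((p.prolong ℓ)ᵀ * Sᵀ) =
          S * ((p.postA (ℓ + 1))⁻¹ - Z * (p.postA (ℓ + 1))⁻¹ * Zᵀ) * Sᵀ := by
        rw [← eq_sub_iff_add_eq'] at hkey
        rw [← hkey]
        simp only [Matrix.mul_assoc]
      rw [e]
      noncomm_ring
    · rw [cross_mv_mv h1 h2, hc, Matrix.mul_zero, Matrix.zero_mul]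
    · rw [cross_add_left h12 h22 h3, cross_mv_left h1 h3, cross_mv_left h2 h3, hft,
        cross_eq_zero_comm (hc true)]
      simp

end IsUncorrelatedDraws

/-- A chain of multigrid Monte Carlo updates is a linear recursion with uncorrelated noise. -/
theorem IsMGMCChain.exists_noise [IsProbabilityMeasure P] {y : Vec β} {θ : ℕ → Ω → Vec (p.n L)}
    (h : p.IsMGMCChain k L y P θ) :
    MemLp (θ 0) 2 P ∧ ∃ η : ℕ → Ω → Vec (p.n L), (∀ m, MemLp (η m) 2 P) ∧
      (∀ m, cross P (η m) (η m) =
        (p.postA L)⁻¹ - p.iterMatrix k L * (p.postA L)⁻¹ * (p.iterMatrix k L)ᵀ) ∧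
      (∀ m j, m ≠ j → cross P (η m) (η j) = 0) ∧
      (∀ m, cross P (η m) (θ 0) = 0) ∧ (∀ m i, ∫ ω, η m ω i ∂P = 0) ∧
      ∀ μ, mv (p.postA L) μ = p.rhs L y → ∀ m ω,
        θ (m + 1) ω - μ = mv (p.iterMatrix k L) (θ m ω - μ) + η m ω := by
  obtain ⟨ζ, ξ, -, hζ, hξ, hind, -, hθ, hθind, hrec⟩ := h
  have hζm := fun m => centered_gaussian_moments (p.postA_posDef 0).inv.posSemidef (hζ m)
  have hξm := fun m ℓ hℓ b j hj =>
    centered_gaussian_moments (p.smootherCov_posSemidef (ℓ + 1)) (hξ m ℓ hℓ b j hj)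
  have hD : ∀ i, MemLp (p.draws L k ζ ξ i) 2 P ∧ ∀ r, ∫ ω, p.draws L k ζ ξ i ω r ∂P = 0 := by
    rintro ⟨m, _ | ⟨ℓ, b, j⟩⟩
    · exact ⟨(hζm m).1, (hζm m).2.1⟩
    · exact ⟨(hξm m ℓ ℓ.2 b j j.2).1, (hξm m ℓ ℓ.2 b j j.2).2.1⟩
  have hDD : ∀ i j, i ≠ j → cross P (p.draws L k ζ ξ i) (p.draws L k ζ ξ j) = 0 := fun i j hij =>
    cross_eq_zero_of_indepFun (hind.indepFun hij) (hD i).1 (hD j).1 (hD i).2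
  have hDθ : ∀ i, cross P (p.draws L k ζ ξ i) (θ 0) = 0 := fun i =>
    cross_eq_zero_of_indepFun
      ((hθind.comp (φ := id) (ψ := fun d : (∀ i, Vec (p.drawDim L k i)) => d i) measurable_id
        (measurable_pi_apply i)).symm) (hD i).1 hθ (hD i).2
  -- reduction to the draws with their indices
  have hstep : ∀ m, p.IsUncorrelatedDraws k L P (ζ m) (ξ m) := fun m =>
    { memLp_coarse := (hζm m).1
      memLp_smoother := fun ℓ hℓ b j hj => (hξm m ℓ hℓ b j hj).1
      cross_coarse := (hζm m).2.2
      cross_smoother := fun ℓ hℓ b j hj => (hξm m ℓ hℓ b j hj).2.2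
      cross_coarse_smoother := fun ℓ hℓ b j hj =>
        hDD (m, none) (m, some (⟨ℓ, hℓ⟩, b, ⟨j, hj⟩)) (by simp)
      cross_ne := fun ℓ hℓ b j hj ℓ' hℓ' b' j' hj' hne =>
        hDD (m, some (⟨ℓ, hℓ⟩, b, ⟨j, hj⟩)) (m, some (⟨ℓ', hℓ'⟩, b', ⟨j', hj'⟩))
          (by simpa using hne) }
  have hort : ∀ m {r : ℕ} {Y : Ω → Vec r}, MemLp Y 2 P →
      (∀ i, cross P (p.draws L k ζ ξ (m, i)) Y = 0) →
      cross P (fun ω => p.vCycle k (ζ m ω) (fun ℓ b j => ξ m ℓ b j ω) L 0 0) Y = 0 :=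
    fun m r Y hY h0 => (hstep m).cross_noise_eq_zero hY (h0 none) le_rfl
      fun ℓ hℓ b j hj => h0 (some (⟨ℓ, hℓ⟩, b, ⟨j, hj⟩))
  refine ⟨hθ, fun m ω => p.vCycle k (ζ m ω) (fun ℓ b j => ξ m ℓ b j ω) L 0 0,
    fun m => (hstep m).memLp_noise le_rfl, fun m => (hstep m).cross_noise_self le_rfl,
    fun m j hmj => ?_, fun m => hort m hθ fun i => hDθ _, fun m => ?_, fun μ hμ m ω => ?_⟩
  -- Orthogonality is applied once in each argument; the draws involved have different indices
  -- because they belong to different steps of the chain.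
  · refine hort m ((hstep j).memLp_noise le_rfl) fun i => cross_eq_zero_comm ?_
    exact hort j (hD _).1 fun i' => hDD _ _ fun e => hmj (congrArg Prod.fst e).symm
  · exact integral_apply_eq_zero_of_cross (hort m (memLp_const _) fun i =>
      cross_const_eq_zero (hD _).2 _)
  · rw [hrec, ← hμ, vCycle_eq]
    abel

end InverseProblem

/-! ### Linear recursions with uncorrelated noise -/

section Recursion

variable {Ω : Type*} [MeasurableSpace Ω] {P : Measure Ω} {n : ℕ}
  {X N : Matrix (Fin n) (Fin n) ℝ} {e η : ℕ → Ω → Vec n}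

theorem memLp_recursion (he : MemLp (e 0) 2 P) (hη : ∀ m, MemLp (η m) 2 P)
    (hrec : ∀ m ω, e (m + 1) ω = mv X (e m ω) + η m ω) (m : ℕ) : MemLp (e m) 2 P := by
  induction m with
  | zero => exact he
  | succ m ih =>
    rw [show e (m + 1) = fun ω => mv X (e m ω) + η m ω from funext (hrec m)]
    exact (memLp_mv ih X).add (hη m)

/-- The state at time `m` depends linearly on the initial state and the noises before time `m`. With
a noise as `Y` this is causality; with a constant `Y` it says that the mean stays zero. -/
theorem cross_recursion_eq_zero (he : MemLp (e 0) 2 P) (hη : ∀ m, MemLp (η m) 2 P)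
    (hrec : ∀ m ω, e (m + 1) ω = mv X (e m ω) + η m ω) {r : ℕ} {Y : Ω → Vec r}
    (hY : MemLp Y 2 P) (m : ℕ) (h0 : cross P (e 0) Y = 0)
    (h : ∀ j < m, cross P (η j) Y = 0) : cross P (e m) Y = 0 := by
  induction m with
  | zero => exact h0
  | succ m ih =>
    have hm := memLp_recursion he hη hrec m
    rw [show e (m + 1) = fun ω => mv X (e m ω) + η m ω from funext (hrec m),
      cross_add_left (memLp_mv hm X) (hη m) hY, cross_mv_left hm hY,
      ih fun j hj => h j (hj.trans m.lt_succ_self), h m m.lt_succ_self, Matrix.mul_zero, add_zero]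

/-- The second moments of a linear recursion whose noise leaves `K` invariant. -/
theorem cross_recursion {K : Matrix (Fin n) (Fin n) ℝ} (he : MemLp (e 0) 2 P)
    (hη : ∀ m, MemLp (η m) 2 P) (hrec : ∀ m ω, e (m + 1) ω = mv X (e m ω) + η m ω)
    (hηη : ∀ m, cross P (η m) (η m) = K - X * K * Xᵀ)
    (hne : ∀ m j, m ≠ j → cross P (η m) (η j) = 0) (h0 : ∀ m, cross P (η m) (e 0) = 0)
    (m s : ℕ) :
    cross P (e (m + s)) (e m) = X ^ s * (K + X ^ m * (cross P (e 0) (e 0) - K) * (X ^ m)ᵀ) := by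
  have hmem := memLp_recursion he hη hrec
  have horth : ∀ m j, m ≤ j → cross P (e m) (η j) = 0 := fun m j hmj =>
    cross_recursion_eq_zero he hη hrec (hη j) m (cross_eq_zero_comm (h0 j))
      fun i hi => hne i j (hi.trans_le hmj).ne
  have hfun : ∀ m, e (m + 1) = fun ω => mv X (e m ω) + η m ω := fun m => funext (hrec m)
  induction s with
  | zero =>
    rw [add_zero, pow_zero, one_mul]
    -- At lag zero this is the discrete Lyapunov recursion: `K` is a fixed point, and the deviation
    -- from it is conjugated by `X` at each step.
    induction m with
    | zero => simp
    | succ m ih =>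
      rw [hfun, cross_add_self (memLp_mv (hmem m) X) (hη m)
        (by rw [cross_mv_left (hmem m) (hη m), horth m m le_rfl, Matrix.mul_zero]),
        cross_mv_mv (hmem m) (hmem m), ih, hηη, pow_succ' X m, Matrix.transpose_mul]
      noncomm_ring
  | succ s ih =>
    rw [← add_assoc, hfun, cross_add_left (memLp_mv (hmem _) X) (hη _) (hmem m),
      cross_mv_left (hmem _) (hmem m), ih,
      cross_eq_zero_comm (horth m (m + s) (Nat.le_add_right m s)), add_zero, pow_succ' X s,
      mul_assoc X]

end Recursion

/-! ### Bounds in the energy norm -/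

section EnergyBounds

variable {n : ℕ} {A G D X : Matrix (Fin n) (Fin n) ℝ}

/-- Only an inequality, since in dimension zero the identity has norm zero. -/
theorem norm_one_le : ‖(1 : Matrix (Fin n) (Fin n) ℝ)‖ ≤ 1 :=
  norm_le_of_norm_mv_le zero_le_one fun x => by rw [one_mv, one_mul]

theorem norm_pow_mv_le (G : Matrix (Fin n) (Fin n) ℝ) (s : ℕ) (w : Vec n) :
    ‖mv (G ^ s) w‖ ≤ ‖G‖ ^ s * ‖w‖ := by
  induction s with
  | zero => simp [one_mv]
  | succ s ih =>
    rw [pow_succ', mv_mul, pow_succ', mul_assoc]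
    exact (norm_mv_le _ _).trans (by gcongr)

theorem abs_inner_pow_le (G : Matrix (Fin n) (Fin n) ℝ) (s : ℕ) (w : Vec n) :
    |⟪w, mv (G ^ s) w⟫_ℝ| ≤ ‖G‖ ^ s * ‖w‖ ^ 2 :=
  calc _ ≤ ‖w‖ * ‖mv (G ^ s) w‖ := abs_real_inner_le_norm _ _
    _ ≤ ‖w‖ * (‖G‖ ^ s * ‖w‖) := by gcongr; exact norm_pow_mv_le G s w
    _ = _ := by ring

theorem inner_pow_mul_pow (hG : Gᵀ = G) (s m : ℕ) (w : Vec n) :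
    ⟪w, mv (G ^ s * D * G ^ m) w⟫_ℝ = ⟪mv (G ^ s) w, mv D (mv (G ^ m) w)⟫_ℝ := by
  rw [mv_mul, mv_mul, inner_mv_right, Matrix.transpose_pow, hG]

theorem abs_inner_pow_mul_pow_le (hG : Gᵀ = G) (s m : ℕ) (w : Vec n) :
    |⟪w, mv (G ^ (s + m) * D * G ^ m) w⟫_ℝ| ≤ ‖D‖ * ‖G‖ ^ (s + 2 * m) * ‖w‖ ^ 2 := by
  rw [inner_pow_mul_pow hG]
  calc _ ≤ ‖D‖ * (‖mv (G ^ (s + m)) w‖ * ‖mv (G ^ m) w‖) := inner_mv_le _ _ _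
    _ ≤ ‖D‖ * ((‖G‖ ^ (s + m) * ‖w‖) * (‖G‖ ^ m * ‖w‖)) := by
      gcongr <;> exact norm_pow_mv_le _ _ _
    _ = _ := by ring

/-- In the application `1 + D` is a scaled covariance, hence nonnegative. The initial state can thus
lower the stationary variance by at most a fraction `‖G‖^(2m)`, however large `D` is, and the
variance stays positive. -/
theorem inner_pow_mul_pow_ge (hG : Gᵀ = G) (hD : (1 + D).PosSemidef) (m : ℕ) (w : Vec n) :
    -(‖G‖ ^ (2 * m) * ‖w‖ ^ 2) ≤ ⟪w, mv (G ^ m * D * G ^ m) w⟫_ℝ := by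
  rw [inner_pow_mul_pow hG]
  have h1 := inner_mv_nonneg hD (mv (G ^ m) w)
  rw [add_mv, one_mv, inner_add_right, real_inner_self_eq_norm_sq] at h1
  have h2 : ‖mv (G ^ m) w‖ ^ 2 ≤ (‖G‖ ^ m * ‖w‖) ^ 2 := by gcongr; exact norm_pow_mv_le _ _ _
  have h3 : (‖G‖ ^ m * ‖w‖) ^ 2 = ‖G‖ ^ (2 * m) * ‖w‖ ^ 2 := by ring
  linarith

/-- The second moments of a linear recursion in energy coordinates. -/
theorem second_moment_form (hA : A.PosDef)
    (hG : (CFC.sqrt A * X * (CFC.sqrt A)⁻¹)ᵀ = CFC.sqrt A * X * (CFC.sqrt A)⁻¹)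
    (K : Matrix (Fin n) (Fin n) ℝ) (F : Vec n) (s m : ℕ) :
    ⟪F, mv (X ^ s * (A⁻¹ + X ^ m * (K - A⁻¹) * (X ^ m)ᵀ)) F⟫_ℝ =
      ⟪mv (CFC.sqrt A)⁻¹ F,
        mv ((CFC.sqrt A * X * (CFC.sqrt A)⁻¹) ^ s) (mv (CFC.sqrt A)⁻¹ F)⟫_ℝ +
      ⟪mv (CFC.sqrt A)⁻¹ F, mv ((CFC.sqrt A * X * (CFC.sqrt A)⁻¹) ^ (s + m) *
        (CFC.sqrt A * K * CFC.sqrt A - 1) * (CFC.sqrt A * X * (CFC.sqrt A)⁻¹) ^ m)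
        (mv (CFC.sqrt A)⁻¹ F)⟫_ℝ := by
  obtain ⟨h1, h2, h3, h4, h5⟩ := sqrt_spec hA
  have hAi : A⁻¹ = (CFC.sqrt A)⁻¹ * (CFC.sqrt A)⁻¹ := by
    rw [← Matrix.mul_inv_rev, h1]
  generalize CFC.sqrt A = Q at *
  set G := Q * X * Q⁻¹ with hGdef
  have hXG : ∀ j, X ^ j * Q⁻¹ = Q⁻¹ * G ^ j := fun j => by
    have : SemiconjBy Q⁻¹ G X := by
      change Q⁻¹ * G = X * Q⁻¹
      rw [hGdef, mul_assoc, ← mul_assoc, h3, one_mul]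
    exact (this.pow_right j).eq.symm
  have hK : K - A⁻¹ = Q⁻¹ * (Q * K * Q - 1) * Q⁻¹ := by
    have : Q⁻¹ * (Q * K * Q - 1) * Q⁻¹ = (Q⁻¹ * Q) * K * (Q * Q⁻¹) - Q⁻¹ * Q⁻¹ := by
      noncomm_ring
    rw [this, h3, h4, one_mul, mul_one, hAi]
  have hXt : Q⁻¹ * (X ^ m)ᵀ = G ^ m * Q⁻¹ := by
    have := congrArg Matrix.transpose (hXG m)
    rwa [Matrix.transpose_mul, Matrix.transpose_mul, h5, Matrix.transpose_pow G, hG] at this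
  have key : X ^ s * (A⁻¹ + X ^ m * (K - A⁻¹) * (X ^ m)ᵀ) =
      Q⁻¹ * (G ^ s + G ^ (s + m) * (Q * K * Q - 1) * G ^ m) * Q⁻¹ := by
    rw [hK, hAi]
    generalize Q * K * Q - 1 = D
    calc X ^ s * (Q⁻¹ * Q⁻¹ + X ^ m * (Q⁻¹ * D * Q⁻¹) * (X ^ m)ᵀ)
        = (X ^ s * Q⁻¹) * Q⁻¹ + (X ^ (s + m) * Q⁻¹) * D * (Q⁻¹ * (X ^ m)ᵀ) := by
          rw [pow_add]; noncomm_ring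
      _ = _ := by rw [hXG, hXG, hXt]; noncomm_ring
  rw [key, mv_mul, mv_mul, inner_mv_right, h5, add_mv, inner_add_right]

end EnergyBounds

/-! ### Autocorrelation series -/

/-- Perturbation of an autocorrelation series. -/
theorem autocorrelation_perturbation {a σ c : ℝ} {m : ℕ} {g h : ℕ → ℝ} (ha : 0 < a)
    (hσ : 0 ≤ σ) (hσ1 : σ < 1) (hm : 1 ≤ m) (hg : ∀ s, |g s| ≤ σ ^ s * a)
    (hh : ∀ s, |h s| ≤ c * σ ^ (s + 2 * m) * a) (hh0 : -(σ ^ (2 * m) * a) ≤ h 0) :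
    0 < a + h 0 ∧ Summable (fun s => (g (s + 1) + h (s + 1)) / (a + h 0)) ∧
      |(1 + 2 * ∑' s, (g (s + 1) + h (s + 1)) / (a + h 0)) - (1 + 2 * ∑' s, g (s + 1) / a)| ≤
        4 * c * (σ ^ (2 * m + 1) / ((1 - σ) * (1 - σ ^ (2 * m)))) := by
  have hρ : σ ^ (2 * m) < 1 := pow_lt_one₀ hσ hσ1 (by omega)
  have hρ' : 0 < 1 - σ ^ (2 * m) := by linarith
  have hden : a * (1 - σ ^ (2 * m)) ≤ a + h 0 := by linarith
  have hpos : 0 < a + h 0 := lt_of_lt_of_le (by positivity) hden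
  have hgeo : Summable fun s : ℕ => σ ^ s := summable_geometric_of_lt_one hσ hσ1
  have hsg : Summable (fun s => g (s + 1) / a) := by
    refine Summable.of_norm_bounded hgeo fun s => ?_
    rw [Real.norm_eq_abs, abs_div, abs_of_pos ha, div_le_iff₀ ha]
    refine (hg (s + 1)).trans ?_
    gcongr ?_ * _
    exact pow_le_pow_of_le_one hσ hσ1.le (Nat.le_succ s)
  have hdiff : ∀ s, |(g (s + 1) + h (s + 1)) / (a + h 0) - g (s + 1) / a| ≤
      2 * c * σ ^ (2 * m + 1) / (1 - σ ^ (2 * m)) * σ ^ s := fun s => by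
    -- Over a common denominator, both products in the numerator carry a factor of `h`, and each is
    -- of size `c σ^(s + 1 + 2m) a²`. This gives the factor `2 c`; the factor two in front of the
    -- series makes it `4 c`.
    have e : (g (s + 1) + h (s + 1)) / (a + h 0) - g (s + 1) / a =
        (h (s + 1) * a - g (s + 1) * h 0) / (a * (a + h 0)) := by
      field_simp
      ring
    have h1 : |h (s + 1) * a - g (s + 1) * h 0| ≤ 2 * c * σ ^ (2 * m + 1) * σ ^ s * (a * a) := by
      have h2 : |h (s + 1) * a| ≤ (c * σ ^ (s + 1 + 2 * m) * a) * a := by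
        rw [abs_mul, abs_of_pos ha]
        exact mul_le_mul_of_nonneg_right (hh _) ha.le
      have h3 : |g (s + 1) * h 0| ≤ (σ ^ (s + 1) * a) * (c * σ ^ (0 + 2 * m) * a) := by
        rw [abs_mul]
        exact mul_le_mul (hg _) (hh 0) (abs_nonneg _) (by positivity)
      calc _ ≤ |h (s + 1) * a| + |g (s + 1) * h 0| := abs_sub _ _
        _ ≤ _ := add_le_add h2 h3
        _ = _ := by ring
    rw [e, abs_div, abs_of_pos (mul_pos ha hpos), div_le_iff₀ (mul_pos ha hpos)]
    -- The sign of `c` is not assumed; it enters only through this product, which dominates an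
    -- absolute value.
    have h0 : 0 ≤ 2 * c * σ ^ (2 * m + 1) * σ ^ s := by
      have := (abs_nonneg _).trans h1
      exact nonneg_of_mul_nonneg_left this (mul_pos ha ha)
    calc _ ≤ _ := h1
      _ = 2 * c * σ ^ (2 * m + 1) * σ ^ s / (1 - σ ^ (2 * m)) * (a * (a * (1 - σ ^ (2 * m)))) := by
        field_simp
      _ ≤ 2 * c * σ ^ (2 * m + 1) * σ ^ s / (1 - σ ^ (2 * m)) * (a * (a + h 0)) := by
        have : 0 ≤ 2 * c * σ ^ (2 * m + 1) * σ ^ s / (1 - σ ^ (2 * m)) := div_nonneg h0 hρ'.le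
        gcongr
      _ = _ := by ring
  have hsd : Summable (fun s => (g (s + 1) + h (s + 1)) / (a + h 0) - g (s + 1) / a) :=
    Summable.of_norm_bounded (hgeo.mul_left _) hdiff
  have hs : Summable (fun s => (g (s + 1) + h (s + 1)) / (a + h 0)) := by
    simpa using hsd.add hsg
  refine ⟨hpos, hs, ?_⟩
  have e : (1 + 2 * ∑' s, (g (s + 1) + h (s + 1)) / (a + h 0)) - (1 + 2 * ∑' s, g (s + 1) / a) =
      2 * ∑' s, ((g (s + 1) + h (s + 1)) / (a + h 0) - g (s + 1) / a) := by
    rw [hs.tsum_sub hsg]; ring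
  rw [e, abs_mul, abs_two]
  have hb : |∑' s, ((g (s + 1) + h (s + 1)) / (a + h 0) - g (s + 1) / a)| ≤
      2 * c * σ ^ (2 * m + 1) / (1 - σ ^ (2 * m)) * (1 - σ)⁻¹ := by
    rw [← Real.norm_eq_abs]
    exact tsum_of_norm_bounded ((hasSum_geometric_of_lt_one hσ hσ1).mul_left _) hdiff
  calc _ ≤ 2 * (2 * c * σ ^ (2 * m + 1) / (1 - σ ^ (2 * m)) * (1 - σ)⁻¹) := by gcongr
    _ = _ := by
      have : 1 - σ ≠ 0 := by linarith
      field_simp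
      ring

/-- Mean square of a sum of random variables with geometrically decaying correlations. -/
theorem integral_sum_sq_le {Ω : Type*} [MeasurableSpace Ω] {P : Measure Ω} {Z : ℕ → Ω → ℝ}
    {b q : ℝ} (hq : 0 ≤ q) (hq1 : q < 1) (hZ : ∀ m, MemLp (Z m) 2 P)
    (hb : ∀ m s, |∫ ω, Z (m + s) ω * Z m ω ∂P| ≤ b * q ^ s) (M : ℕ) :
    ∫ ω, (∑ m ∈ Finset.Icc 1 M, Z m ω) ^ 2 ∂P ≤ 2 * b / (1 - q) * M := by
  have hq' : 0 < 1 - q := by linarith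
  have hb0 : 0 ≤ b := by simpa using (abs_nonneg _).trans (hb 0 0)
  have hS : ∀ M, MemLp (fun ω => ∑ m ∈ Finset.Icc 1 M, Z m ω) 2 P := fun M =>
    memLp_finsetSum _ fun m _ => hZ m
  have hstep : ∀ M ω, ∑ m ∈ Finset.Icc 1 (M + 1), Z m ω =
      (∑ m ∈ Finset.Icc 1 M, Z m ω) + Z (M + 1) ω := fun M ω =>
    Finset.sum_Icc_succ_top (Nat.le_add_left 1 M) _
  have hint : ∀ {X Y : Ω → ℝ}, MemLp X 2 P → MemLp Y 2 P → Integrable (fun ω => X ω * Y ω) P :=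
    fun hX hY => hX.integrable_mul hY
  -- The bound is for every lag `s`, because adding a term shifts the earlier part of the sum to lag
  -- `1 + s`. The value `b q^s / (1 - q)` is reproduced by `b q^(1 + s) / (1 - q) + b q^s`.
  have hcross : ∀ M s, ∫ ω, Z (M + s) ω * ∑ m ∈ Finset.Icc 1 M, Z m ω ∂P ≤
      b * q ^ s / (1 - q) := fun M => by
    induction M with
    | zero => intro s; simp; positivity
    | succ M ih =>
      intro s
      have e : ∀ ω, Z (M + 1 + s) ω * ∑ m ∈ Finset.Icc 1 (M + 1), Z m ω =
          Z (M + (1 + s)) ω * (∑ m ∈ Finset.Icc 1 M, Z m ω) +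
            Z (M + 1 + s) ω * Z (M + 1) ω := fun ω => by
        rw [hstep, mul_add, add_assoc M 1 s]
      simp only [e]
      rw [integral_add (hint (hZ _) (hS M)) (hint (hZ _) (hZ _))]
      calc _ ≤ b * q ^ (1 + s) / (1 - q) + b * q ^ s :=
            add_le_add (ih (1 + s)) ((le_abs_self _).trans (hb (M + 1) s))
        _ = _ := by field_simp; ring
  induction M with
  | zero => simp
  | succ M ih =>
    have e : ∀ ω, (∑ m ∈ Finset.Icc 1 (M + 1), Z m ω) ^ 2 =
        (∑ m ∈ Finset.Icc 1 M, Z m ω) ^ 2 + 2 * (Z (M + 1) ω * ∑ m ∈ Finset.Icc 1 M, Z m ω) +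
          Z (M + 1) ω * Z (M + 1) ω := fun ω => by
      rw [hstep]; ring
    have h1 := hint (hZ (M + 1)) (hS M)
    have h2 := (le_abs_self _).trans (hb (M + 1) 0)
    have h3 := hcross M 1
    simp only [e]
    have h5 : Integrable (fun ω => (∑ m ∈ Finset.Icc 1 M, Z m ω) ^ 2 +
        2 * (Z (M + 1) ω * ∑ m ∈ Finset.Icc 1 M, Z m ω)) P :=
      (hS M).integrable_sq.add (h1.const_mul 2)
    rw [integral_add h5 (hint (hZ _) (hZ _)),
      integral_add (hS M).integrable_sq (h1.const_mul 2), integral_const_mul]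
    simp only [add_zero, pow_zero, mul_one, pow_one] at h2 h3
    have h4 : 2 * (b * q / (1 - q)) + b ≤ 2 * b / (1 - q) := by
      rw [← sub_nonneg]
      have : 2 * b / (1 - q) - (2 * (b * q / (1 - q)) + b) = b := by field_simp; ring
      rw [this]; exact hb0
    push_cast
    linarith

namespace InverseProblem

variable {H : Type*} [NormedAddCommGroup H] [InnerProductSpace ℝ H] [CompleteSpace H] {β : ℕ}
  (p : InverseProblem H β)

/-! ### The posterior mean -/

/-- The posterior mean solves the linear system with the posterior precision matrix. -/
theorem postA_postMean (ℓ : ℕ) (y : Vec β) : mv (p.postA ℓ) (p.postMean ℓ y) = p.rhs ℓ y := by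
  have hA := p.A_posDef ℓ
  set C := p.Γ + (p.B ℓ)ᵀ * (p.A ℓ)⁻¹ * p.B ℓ with hC
  have hCpos : C.PosDef :=
    p.Γ_posDef.add_posSemidef (posSemidef_transpose_mul_mul hA.inv.posSemidef _)
  rw [postMean, rhs, ← mv_mul]
  congr 1
  have h1 : p.postA ℓ * ((p.A ℓ)⁻¹ * p.B ℓ) = p.B ℓ * p.Γ⁻¹ * C := by
    rw [postA, Matrix.add_mul, ← Matrix.mul_assoc (p.A ℓ), mul_inv_of_posDef hA, Matrix.one_mul, hC,
      Matrix.mul_add, Matrix.mul_assoc (p.B ℓ) p.Γ⁻¹ p.Γ, inv_mul_of_posDef p.Γ_posDef,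
      Matrix.mul_one]
    simp only [Matrix.mul_assoc]
  rw [← Matrix.mul_assoc, h1, Matrix.mul_assoc, mul_inv_of_posDef hCpos, Matrix.mul_one]

theorem target_eq (χ : H) (L : ℕ) (y : Vec β) : p.target χ L y = ⟪p.F χ L, p.postMean L y⟫_ℝ := by
  rw [target, posterior, integral_inner IsGaussian.integrable_fun_id,
    integral_id_multivariateGaussian]

theorem norm_sqrt_mv_sq (ℓ : ℕ) (x : Vec (p.n ℓ)) :
    ‖mv (CFC.sqrt (p.postA ℓ)) x‖ ^ 2 = ⟪x, mv (p.postA ℓ) x⟫_ℝ := by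
  obtain ⟨h1, h2, -⟩ := sqrt_spec (p.postA_posDef ℓ)
  rw [← real_inner_self_eq_norm_sq, inner_mv_left, h2, ← mv_mul, h1]

/-- The posterior mean is bounded in energy norm, uniformly in the level. -/
theorem norm_sqrt_postMean_le (ℓ : ℕ) (y : Vec β) :
    ‖mv (CFC.sqrt (p.postA ℓ)) (p.postMean ℓ y)‖ ≤ √‖p.Γ⁻¹‖ * ‖y‖ := by
  set μ := p.postMean ℓ y with hμ
  have hE : 0 ≤ ⟪μ, mv (p.postA ℓ) μ⟫_ℝ := inner_mv_nonneg (p.postA_posDef ℓ).posSemidef μ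
  have h1 : ⟪μ, mv (p.postA ℓ) μ⟫_ℝ = ⟪mv (p.B ℓ)ᵀ μ, mv p.Γ⁻¹ y⟫_ℝ := by
    rw [hμ, postA_postMean, rhs, mv_mul, inner_mv_right]
  -- The energy `E` of the mean equals `⟪Bᵀ μ, Γ⁻¹ y⟫`. Cauchy-Schwarz for `Γ⁻¹` and the fact that
  -- the observation term is part of `E` give `E² ≤ E ‖Γ⁻¹‖ ‖y‖²`.
  have h2 := inner_mv_sq_le p.Γ_posDef.inv.posSemidef (mv (p.B ℓ)ᵀ μ) y
  have h3 : ⟪mv (p.B ℓ)ᵀ μ, mv p.Γ⁻¹ (mv (p.B ℓ)ᵀ μ)⟫_ℝ ≤ ⟪μ, mv (p.postA ℓ) μ⟫_ℝ := by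
    have : ⟪μ, mv (p.B ℓ * p.Γ⁻¹ * (p.B ℓ)ᵀ) μ⟫_ℝ =
        ⟪mv (p.B ℓ)ᵀ μ, mv p.Γ⁻¹ (mv (p.B ℓ)ᵀ μ)⟫_ℝ := by rw [mv_mul, mv_mul, inner_mv_right]
    rw [postA, add_mv, inner_add_right]
    linarith [inner_mv_nonneg (p.A_posDef ℓ).posSemidef μ]
  have h4 : ⟪y, mv p.Γ⁻¹ y⟫_ℝ ≤ ‖p.Γ⁻¹‖ * (‖y‖ * ‖y‖) :=
    (le_abs_self _).trans (inner_mv_le _ _ _)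
  have h5 : ⟪μ, mv (p.postA ℓ) μ⟫_ℝ ≤ (√‖p.Γ⁻¹‖ * ‖y‖) ^ 2 := by
    rw [mul_pow, Real.sq_sqrt (norm_nonneg _)]
    rw [← h1] at h2
    rcases hE.eq_or_lt with h0 | h0
    · rw [← h0]; positivity
    · refine le_of_mul_le_mul_left ?_ h0
      have := mul_le_mul h3 h4 (inner_mv_nonneg p.Γ_posDef.inv.posSemidef y) hE
      nlinarith
  rw [← norm_sqrt_mv_sq] at h5
  exact (abs_le_of_sq_le_sq' h5 (by positivity)).2

/-- The functional is bounded in the dual energy norm, uniformly in the level. -/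
theorem norm_sqrt_inv_F_le (χ : H) (ℓ : ℕ) :
    ‖mv (CFC.sqrt (p.postA ℓ))⁻¹ (p.F χ ℓ)‖ ≤ ‖p.sqrtCov χ‖ := by
  obtain ⟨h1, h2, h3, h4, h5⟩ := sqrt_spec (p.postA_posDef ℓ)
  set w := mv (CFC.sqrt (p.postA ℓ))⁻¹ (p.F χ ℓ) with hw
  -- Here `x` is the Riesz representative of the functional, so `‖w‖²` is both the value of the
  -- functional at `x` and the energy of `x`.
  set x := mv (CFC.sqrt (p.postA ℓ))⁻¹ w with hx
  have hFx : ‖w‖ ^ 2 = ⟪p.F χ ℓ, x⟫_ℝ := by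
    rw [hx, inner_mv_right, h5, ← hw, real_inner_self_eq_norm_sq]
  have hxw : ‖w‖ ^ 2 = ⟪x, mv (p.postA ℓ) x⟫_ℝ := by
    rw [← norm_sqrt_mv_sq, hx, ← mv_mul, h4, one_mv]
  have hV : p.normV (p.Pmap ℓ x) ≤ ‖w‖ := by
    have := p.normV_sq_le_postForm (p.Pmap ℓ x)
    rw [← inner_postA, ← hxw] at this
    exact (abs_le_of_sq_le_sq' this (norm_nonneg _)).2
  have h6 : ‖w‖ * ‖w‖ ≤ ‖p.sqrtCov χ‖ * ‖w‖ :=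
    calc ‖w‖ * ‖w‖ = ⟪p.sqrtCov (p.sqrtA (p.Pmap ℓ x)), χ⟫_ℝ := by
          rw [← sq, hFx, inner_F, sqrtCov_sqrtA]
      _ = ⟪p.sqrtA (p.Pmap ℓ x), p.sqrtCov χ⟫_ℝ := p.inner_sqrtCov _ _
      _ ≤ ‖p.sqrtA (p.Pmap ℓ x)‖ * ‖p.sqrtCov χ‖ := real_inner_le_norm _ _
      _ ≤ ‖w‖ * ‖p.sqrtCov χ‖ := by rw [← normV_eq]; gcongr
      _ = _ := mul_comm _ _
  rcases (norm_nonneg w).eq_or_lt with h0 | h0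
  · rw [← h0]; exact norm_nonneg _
  · exact le_of_mul_le_mul_right h6 h0

variable {p} {Ω : Type*} [MeasurableSpace Ω] {P : Measure Ω} [IsProbabilityMeasure P] {k L : ℕ}

/-! ### Moments of the chain -/

/-- Second moments of the quantity of interest around the deterministic part of the chain. -/
theorem IsMGMCChain.second_moments {y : Vec β} {θ : ℕ → Ω → Vec (p.n L)}
    (h : p.IsMGMCChain k L y P θ) (χ : H) (c : Vec (p.n L)) :
    ∃ a : ℕ → Vec (p.n L), a 0 = c ∧ (c = p.postMean L y → ∀ m, a m = p.postMean L y) ∧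
      (∀ m, MemLp (fun ω => θ m ω - a m) 2 P) ∧
      (c = ∫ ω, θ 0 ω ∂P → ∀ m, ∫ ω, θ m ω - a m ∂P = 0) ∧
      ∀ m s, ∫ ω, ⟪p.F χ L, θ (m + s) ω - a (m + s)⟫_ℝ * ⟪p.F χ L, θ m ω - a m⟫_ℝ ∂P =
        ⟪p.F χ L, mv (p.iterMatrix k L ^ s * ((p.postA L)⁻¹ + p.iterMatrix k L ^ m *
          (cross P (fun ω => θ 0 ω - c) (fun ω => θ 0 ω - c) - (p.postA L)⁻¹) *
          (p.iterMatrix k L ^ m)ᵀ)) (p.F χ L)⟫_ℝ := by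
  obtain ⟨hθ, η, hη, hηη, hne, hη0, hηm, hrec⟩ := h.exists_noise
  have hrec' := hrec (p.postMean L y) (p.postA_postMean L y)
  set μ := p.postMean L y with hμ
  set X := p.iterMatrix k L with hX
  -- The noiseless orbit from `c`. Subtracting it leaves a homogeneous recursion for any `c`: taking
  -- `c` as the initial mean yields covariances, taking `c = μ` yields second moments of the error.
  set a : ℕ → Vec (p.n L) := fun m => mv (X ^ m) (c - μ) + μ with ha
  have ha0 : a 0 = c := by simp [ha, one_mv]
  have he : ∀ m ω, θ (m + 1) ω - a (m + 1) = mv X (θ m ω - a m) + η m ω := fun m ω => by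
    have e : θ m ω - a m = (θ m ω - μ) - mv (X ^ m) (c - μ) := sub_add_eq_sub_sub_swap _ _ _
    rw [e, mv_sub, ← mv_mul, ← pow_succ']
    have := hrec' m ω
    have e2 : θ (m + 1) ω - a (m + 1) = (θ (m + 1) ω - μ) - mv (X ^ (m + 1)) (c - μ) :=
      sub_add_eq_sub_sub_swap _ _ _
    rw [e2, this]
    abel
  have he0 : MemLp (fun ω => θ 0 ω - a 0) 2 P := hθ.sub (memLp_const _)
  have hcross0 : ∀ m, cross P (η m) (fun ω => θ 0 ω - a 0) = 0 := fun m => by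
    simp only [sub_eq_add_neg]
    rw [cross_add_right (hη m) hθ (memLp_const _), hη0, cross_const_eq_zero (hηm m), add_zero]
  have hmem := memLp_recursion (e := fun m ω => θ m ω - a m) he0 hη he
  refine ⟨a, ha0, fun hc m => by simp [ha, hc, mv_zero], hmem, fun hc m => ?_, fun m s => ?_⟩
  · have h0 : ∀ i, ∫ ω, (θ 0 ω - a 0) i ∂P = 0 := fun i => by
      rw [← integral_vec_apply (he0.integrable one_le_two),
        integral_sub (hθ.integrable one_le_two) (integrable_const _), ha0, hc]
      simp
    have hz := cross_recursion_eq_zero (e := fun m ω => θ m ω - a m) he0 hη he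
      (Y := fun _ => EuclideanSpace.single (0 : Fin 1) (1 : ℝ)) (memLp_const _) m
      (cross_const_eq_zero h0 _) fun j _ => cross_const_eq_zero (hηm j) _
    ext i
    rw [integral_vec_apply ((hmem m).integrable one_le_two),
      integral_apply_eq_zero_of_cross hz, PiLp.zero_apply]
  · rw [← inner_cross (hmem (m + s)) (hmem m),
      cross_recursion (e := fun m ω => θ m ω - a m) he0 hη he hηη hne hcross0 m s, ha0]

/-- The covariances of the quantity of interest along the chain. -/
theorem IsMGMCChain.covariance_qoi {y : Vec β} {θ : ℕ → Ω → Vec (p.n L)}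
    (h : p.IsMGMCChain k L y P θ) (χ : H) (m s : ℕ) :
    cov[p.qoi χ L θ (m + s), p.qoi χ L θ m; P] =
      ⟪p.F χ L, mv (p.iterMatrix k L ^ s * ((p.postA L)⁻¹ + p.iterMatrix k L ^ m *
        (covMatrix P (θ 0) - (p.postA L)⁻¹) * (p.iterMatrix k L ^ m)ᵀ)) (p.F χ L)⟫_ℝ := by
  obtain ⟨a, -, -, hmem, hmean, hmom⟩ := h.second_moments χ (∫ ω, θ 0 ω ∂P)
  rw [covMatrix_eq_cross h.exists_noise.1, ← hmom m s]
  have hint : ∀ m, ∫ ω, p.qoi χ L θ m ω ∂P = ⟪p.F χ L, a m⟫_ℝ := fun m => by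
    have h1 : ∀ ω, p.qoi χ L θ m ω = ⟪p.F χ L, θ m ω - a m⟫_ℝ + ⟪p.F χ L, a m⟫_ℝ := fun ω => by
      rw [qoi, ← inner_add_right, sub_add_cancel]
    have h2 := (hmem m).integrable one_le_two
    simp only [h1]
    rw [integral_add (h2.const_inner _) (integrable_const _), integral_inner h2, hmean rfl m]
    simp
  rw [covariance, hint, hint]
  simp only [qoi, inner_sub_right]

end InverseProblem

/-! ### Integrated autocorrelation times -/

/-- The geometric bound for an integrated autocorrelation time. -/
theorem autocorrelation_bound {a σ : ℝ} {g : ℕ → ℝ} (ha : 0 < a) (hσ : 0 ≤ σ) (hσ1 : σ < 1)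
    (hg : ∀ s, |g s| ≤ σ ^ s * a) :
    Summable (fun s => g (s + 1) / a) ∧
      1 + 2 * ∑' s, g (s + 1) / a ≤ (1 + σ) / (1 - σ) := by
  have hb : ∀ s, ‖g (s + 1) / a‖ ≤ σ * σ ^ s := fun s => by
    rw [Real.norm_eq_abs, abs_div, abs_of_pos ha, div_le_iff₀ ha, ← pow_succ']
    exact hg (s + 1)
  have hgeo := (hasSum_geometric_of_lt_one hσ hσ1).mul_left σ
  refine ⟨Summable.of_norm_bounded hgeo.summable hb, ?_⟩
  have h1 := (le_abs_self _).trans ((Real.norm_eq_abs _).symm.le.trans (tsum_of_norm_bounded hgeo hb))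
  have h2 : (1 + σ) / (1 - σ) = 1 + 2 * (σ * (1 - σ)⁻¹) := by
    have : 1 - σ ≠ 0 := by linarith
    field_simp
    ring
  rw [h2]
  linarith

theorem sqrt_mul_inv_mul_sqrt {n : ℕ} {A : Matrix (Fin n) (Fin n) ℝ} (hA : A.PosDef) :
    CFC.sqrt A * A⁻¹ * CFC.sqrt A = 1 := by
  obtain ⟨h1, -, h3, h4, -⟩ := sqrt_spec hA
  have hAi : A⁻¹ = (CFC.sqrt A)⁻¹ * (CFC.sqrt A)⁻¹ := by
    rw [← Matrix.mul_inv_rev, h1]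
  rw [hAi, ← mul_assoc, h4, one_mul, h3]

/-- The stationary case of `second_moment_form`: with `K = A⁻¹` the transient vanishes. -/
theorem inner_pow_mul_inv {n : ℕ} {A X : Matrix (Fin n) (Fin n) ℝ} (hA : A.PosDef)
    (hG : (CFC.sqrt A * X * (CFC.sqrt A)⁻¹)ᵀ = CFC.sqrt A * X * (CFC.sqrt A)⁻¹) (F : Vec n)
    (s : ℕ) :
    ⟪F, mv (X ^ s * A⁻¹) F⟫_ℝ = ⟪mv (CFC.sqrt A)⁻¹ F,
      mv ((CFC.sqrt A * X * (CFC.sqrt A)⁻¹) ^ s) (mv (CFC.sqrt A)⁻¹ F)⟫_ℝ := by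
  have h := second_moment_form hA hG A⁻¹ F s 0
  rwa [sqrt_mul_inv_mul_sqrt hA, sub_self, sub_self, Matrix.mul_zero, Matrix.mul_zero,
    Matrix.zero_mul, Matrix.zero_mul, add_zero, zero_mv, inner_zero_right, add_zero] at h

namespace InverseProblem

variable {H : Type*} [NormedAddCommGroup H] [InnerProductSpace ℝ H] [CompleteSpace H] {β : ℕ}
  (p : InverseProblem H β)

/-- The iteration matrix in energy coordinates. -/
def energyIter (k L : ℕ) : Matrix (Fin (p.n L)) (Fin (p.n L)) ℝ :=
  CFC.sqrt (p.postA L) * p.iterMatrix k L * (CFC.sqrt (p.postA L))⁻¹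

/-- The vector of the functional in energy coordinates. -/
def energyF (χ : H) (L : ℕ) : Vec (p.n L) := mv (CFC.sqrt (p.postA L))⁻¹ (p.F χ L)

theorem rate_eq (k L : ℕ) : p.rate k L = ‖p.energyIter k L‖ := rfl

theorem norm_energyF_sq_pos {χ : H} {L : ℕ} (hF : p.F χ L ≠ 0) : 0 < ‖p.energyF χ L‖ ^ 2 := by
  refine pow_pos (norm_pos_iff.2 fun h => hF ?_) 2
  obtain ⟨-, -, -, h4, -⟩ := sqrt_spec (p.postA_posDef L)
  rw [← one_mv (p.F χ L), ← h4, mv_mul, ← energyF, h, mv_zero]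

/-- The normalised series of autocorrelations of the stationary chain. -/
def tauInt (k L : ℕ) (χ : H) : ℝ :=
  1 + 2 * ∑' s : ℕ, ⟪p.energyF χ L, mv (p.energyIter k L ^ (s + 1)) (p.energyF χ L)⟫_ℝ /
    ‖p.energyF χ L‖ ^ 2

variable {p} {k L : ℕ}

/-- The change to energy coordinates identifies the defining series with one in powers of the
symmetric contraction `energyIter`, dominated term by term by a geometric series; lag zero
identifies the denominators. -/
theorem isTauInt_tauInt (hG : (p.energyIter k L).PosSemidef) (hσ : p.rate k L < 1) {χ : H}
    (hF : p.F χ L ≠ 0) :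
    p.IsTauInt k L χ (p.tauInt k L χ) ∧
      p.tauInt k L χ ≤ (1 + p.rate k L) / (1 - p.rate k L) := by
  have hGt := transpose_eq_of_posSemidef hG
  obtain ⟨h1, h2⟩ := autocorrelation_bound (p.norm_energyF_sq_pos hF) (norm_nonneg _)
    (p.rate_eq k L ▸ hσ) (abs_inner_pow_le (p.energyIter k L) · (p.energyF χ L))
  refine ⟨?_, h2⟩
  have e0 := inner_pow_mul_inv (p.postA_posDef L) hGt (p.F χ L) 0
  rw [pow_zero, one_mul, pow_zero, one_mv, real_inner_self_eq_norm_sq] at e0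
  rw [IsTauInt, tauInt, add_sub_cancel_left, mul_div_cancel_left₀ _ (two_ne_zero' ℝ)]
  simp only [inner_pow_mul_inv (p.postA_posDef L) hGt, e0]
  exact h1.hasSum

section Chain

variable {Ω : Type*} [MeasurableSpace Ω] {P : Measure Ω} [IsProbabilityMeasure P]
  {y : Vec β} {θ : ℕ → Ω → Vec (p.n L)}

/-- The covariances of the quantity of interest in energy coordinates. -/
theorem IsMGMCChain.covariance_qoi_energy (h : p.IsMGMCChain k L y P θ)
    (hG : (p.energyIter k L).PosSemidef) (χ : H) (m s : ℕ) :
    cov[p.qoi χ L θ (m + s), p.qoi χ L θ m; P] =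
      ⟪p.energyF χ L, mv (p.energyIter k L ^ s) (p.energyF χ L)⟫_ℝ +
      ⟪p.energyF χ L, mv (p.energyIter k L ^ (s + m) *
        (CFC.sqrt (p.postA L) * covMatrix P (θ 0) * CFC.sqrt (p.postA L) - 1) *
        p.energyIter k L ^ m) (p.energyF χ L)⟫_ℝ := by
  rw [h.covariance_qoi, second_moment_form (p.postA_posDef L) (transpose_eq_of_posSemidef hG)]
  rfl

theorem IsMGMCChain.variance_qoi_energy (h : p.IsMGMCChain k L y P θ)
    (hG : (p.energyIter k L).PosSemidef) (χ : H) (m : ℕ) :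
    cov[p.qoi χ L θ m, p.qoi χ L θ m; P] = ‖p.energyF χ L‖ ^ 2 +
      ⟪p.energyF χ L, mv (p.energyIter k L ^ (0 + m) *
        (CFC.sqrt (p.postA L) * covMatrix P (θ 0) * CFC.sqrt (p.postA L) - 1) *
        p.energyIter k L ^ m) (p.energyF χ L)⟫_ℝ := by
  have := h.covariance_qoi_energy hG χ m 0
  rwa [add_zero, pow_zero, one_mv, real_inner_self_eq_norm_sq] at this

/-- The stationary chain has the stationary integrated autocorrelation time. -/
theorem IsMGMCChain.hasIACT_of_posterior (h : p.IsMGMCChain k L y P θ)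
    (hG : (p.energyIter k L).PosSemidef) (hσ : p.rate k L < 1) {χ : H} (hF : p.F χ L ≠ 0)
    (h0 : HasLaw (θ 0) (p.posterior L y) P) (m : ℕ) :
    HasIACT P (p.qoi χ L θ) m (p.tauInt k L χ) := by
  have hK : covMatrix P (θ 0) = (p.postA L)⁻¹ :=
    (gaussian_moments (p.postA_posDef L).inv.posSemidef h0).2.2
  have hD : CFC.sqrt (p.postA L) * covMatrix P (θ 0) * CFC.sqrt (p.postA L) - 1 = 0 := by
    rw [hK, sqrt_mul_inv_mul_sqrt (p.postA_posDef L), sub_self]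
  have hvar := h.variance_qoi_energy hG χ m
  rw [hD, Matrix.mul_zero, Matrix.zero_mul, zero_mv, inner_zero_right, add_zero] at hvar
  have hcor : ∀ s, autocorr P (p.qoi χ L θ) m s =
      ⟪p.energyF χ L, mv (p.energyIter k L ^ s) (p.energyF χ L)⟫_ℝ / ‖p.energyF χ L‖ ^ 2 :=
    fun s => by
      rw [autocorr, hvar, h.covariance_qoi_energy hG, hD, Matrix.mul_zero, Matrix.zero_mul,
        zero_mv, inner_zero_right, add_zero]
  obtain ⟨h1, -⟩ := autocorrelation_bound (p.norm_energyF_sq_pos hF) (norm_nonneg _)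
    (p.rate_eq k L ▸ hσ) (abs_inner_pow_le (p.energyIter k L) · (p.energyF χ L))
  refine ⟨hvar ▸ p.norm_energyF_sq_pos hF, ?_, ?_⟩
  · simpa only [hcor] using h1
  · simp only [hcor]
    rfl

/-- Convergence of the integrated autocorrelation time of a chain with bounded initial moments. -/
theorem IsMGMCChain.exists_hasIACT (h : p.IsMGMCChain k L y P θ)
    (hG : (p.energyIter k L).PosSemidef) (hσ : p.rate k L < 1) {χ : H} (hF : p.F χ L ≠ 0)
    {C₀ : ℝ} (h0 : p.InitialBound L P C₀ (θ 0)) {m : ℕ} (hm : 1 ≤ m) :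
    ∃ τm : ℝ, HasIACT P (p.qoi χ L θ) m τm ∧
      |τm - p.tauInt k L χ| ≤ 4 * (|C₀| + 1) * (p.rate k L ^ (2 * m + 1) /
        ((1 - p.rate k L) * (1 - p.rate k L ^ (2 * m)))) := by
  set D := CFC.sqrt (p.postA L) * covMatrix P (θ 0) * CFC.sqrt (p.postA L) - 1 with hD
  have hGt := transpose_eq_of_posSemidef hG
  have hDn : ‖D‖ ≤ |C₀| + 1 := by
    have h1 := (le_max_right _ _).trans h0.le
    calc ‖D‖ ≤ ‖CFC.sqrt (p.postA L) * covMatrix P (θ 0) * CFC.sqrt (p.postA L)‖ +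
          ‖(1 : Matrix (Fin (p.n L)) (Fin (p.n L)) ℝ)‖ := norm_sub_le _ _
      _ ≤ |C₀| + 1 := add_le_add (h1.trans (le_abs_self _)) norm_one_le
  have hDp : (1 + D).PosSemidef := by
    rw [hD, add_sub_cancel, covMatrix_eq_cross h.exists_noise.1]
    have hs := (sqrt_spec (p.postA_posDef L)).2.1
    have hX : MemLp (fun ω => θ 0 ω - ∫ ω, θ 0 ω ∂P) 2 P := h.exists_noise.1.sub (memLp_const _)
    have := posSemidef_transpose_mul_mul (cross_posSemidef hX) (CFC.sqrt (p.postA L))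
    rwa [hs] at this
  set w := p.energyF χ L with hw
  set G := p.energyIter k L with hGdef
  obtain ⟨h1, h2, h3⟩ := autocorrelation_perturbation (c := |C₀| + 1)
    (g := fun s => ⟪w, mv (G ^ s) w⟫_ℝ) (h := fun s => ⟪w, mv (G ^ (s + m) * D * G ^ m) w⟫_ℝ)
    (p.norm_energyF_sq_pos hF) (norm_nonneg G) (p.rate_eq k L ▸ hσ) hm
    (abs_inner_pow_le G · w)
    (fun s => (abs_inner_pow_mul_pow_le hGt s m w).trans (by gcongr))
    (by simpa only [zero_add] using inner_pow_mul_pow_ge hGt hDp m w)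
  have hvar := h.variance_qoi_energy hG χ m
  have hcor : ∀ s, autocorr P (p.qoi χ L θ) m s =
      (⟪w, mv (G ^ s) w⟫_ℝ + ⟪w, mv (G ^ (s + m) * D * G ^ m) w⟫_ℝ) /
        (‖w‖ ^ 2 + ⟪w, mv (G ^ (0 + m) * D * G ^ m) w⟫_ℝ) := fun s => by
    rw [autocorr, hvar, h.covariance_qoi_energy hG]
  refine ⟨_, ⟨hvar ▸ h1, ?_, rfl⟩, ?_⟩
  · simpa only [hcor] using h2
  · simp only [hcor]
    exact h3

/-! ### Mean square error of the estimator -/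

/-- The second moments of the initial error around the posterior mean. -/
theorem norm_initial_second_moment_le (hθ : MemLp (θ 0) 2 P) {C₀ : ℝ}
    (h0 : p.InitialBound L P C₀ (θ 0)) :
    ‖CFC.sqrt (p.postA L) * cross P (fun ω => θ 0 ω - p.postMean L y)
      (fun ω => θ 0 ω - p.postMean L y) * CFC.sqrt (p.postA L)‖ ≤
      |C₀| + (|C₀| + √‖p.Γ⁻¹‖ * ‖y‖) ^ 2 := by
  set Q := CFC.sqrt (p.postA L) with hQ
  have hQt : Qᵀ = Q := (sqrt_spec (p.postA_posDef L)).2.1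
  set E := ∫ ω, θ 0 ω ∂P with hE
  set d := E - p.postMean L y with hd
  have hX : MemLp (fun ω => θ 0 ω - E) 2 P := hθ.sub (memLp_const _)
  have hmean : ∀ i, ∫ ω, (θ 0 ω - E) i ∂P = 0 := fun i => by
    rw [← integral_vec_apply (hX.integrable one_le_two),
      integral_sub (hθ.integrable one_le_two) (integrable_const _), ← hE]
    simp
  -- Bias-variance decomposition: the second moment around the posterior mean is the covariance plus
  -- the rank-one term of the bias `d`, whose energy norm is bounded by the initial mean and the
  -- posterior mean.
  have hsplit : cross P (fun ω => θ 0 ω - p.postMean L y) (fun ω => θ 0 ω - p.postMean L y) =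
      covMatrix P (θ 0) + cross P (fun _ => d) (fun _ => d) := by
    rw [covMatrix_eq_cross hθ, ← cross_add_self hX (memLp_const d) (cross_const_eq_zero hmean d)]
    simp only [hd, sub_add_sub_cancel]
  have hd1 : ‖mv Q d‖ ≤ |C₀| + √‖p.Γ⁻¹‖ * ‖y‖ := by
    have h1 := (le_max_left _ _).trans h0.le
    rw [hd, mv_sub]
    exact (norm_sub_le _ _).trans
      (add_le_add (h1.trans (le_abs_self _)) (p.norm_sqrt_postMean_le L y))
  have hd2 : ‖Q * cross P (fun _ : Ω => d) (fun _ => d) * Q‖ ≤ ‖mv Q d‖ ^ 2 := by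
    refine norm_le_of_norm_mv_le (sq_nonneg _) fun x => ?_
    have h1 : ∀ z, mv (cross P (fun _ : Ω => d) (fun _ => d)) z = ⟪d, z⟫_ℝ • d := fun z => by
      ext i
      simp only [mv_apply, cross, Matrix.of_apply, integral_const, probReal_univ,
        inner_eq_sum, PiLp.smul_apply, smul_eq_mul, Finset.sum_mul]
      exact Finset.sum_congr rfl fun j _ => by ring
    rw [mv_mul, mv_mul, h1, mv_smul, norm_smul, inner_mv_right, hQt, Real.norm_eq_abs]
    calc _ ≤ (‖mv Q d‖ * ‖x‖) * ‖mv Q d‖ := by gcongr; exact abs_real_inner_le_norm _ _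
      _ = _ := by ring
  rw [hsplit, mul_add, add_mul]
  refine (norm_add_le _ _).trans (add_le_add ?_ (hd2.trans (by gcongr)))
  exact ((le_max_right _ _).trans h0.le).trans (le_abs_self _)

/-- The mean square error of the Monte Carlo estimator decays like `1 / M`. -/
theorem IsMGMCChain.estimator_error (h : p.IsMGMCChain k L y P θ)
    (hG : (p.energyIter k L).PosSemidef) {q : ℝ} (hσ : p.rate k L ≤ q) (hq1 : q < 1) (χ : H)
    {C₀ : ℝ} (h0 : p.InitialBound L P C₀ (θ 0)) {M : ℕ} (hM : 1 ≤ M) :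
    Integrable (fun ω => |p.target χ L y - p.estimator χ L θ M ω| ^ 2) P ∧
      ∫ ω, |p.target χ L y - p.estimator χ L θ M ω| ^ 2 ∂P ≤
        2 * ((2 + |C₀| + (|C₀| + √‖p.Γ⁻¹‖ * ‖y‖) ^ 2) * ‖p.sqrtCov χ‖ ^ 2) / (1 - q) / M := by
  have hGt := transpose_eq_of_posSemidef hG
  have hσ0 : 0 ≤ p.rate k L := norm_nonneg _
  have hM0 : (0 : ℝ) < M := by exact_mod_cast hM
  obtain ⟨a, ha0, ham, hmem, -, hmom⟩ := h.second_moments χ (p.postMean L y)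
  have ha := ham rfl
  simp only [ha] at hmem hmom
  set κ := |C₀| + (|C₀| + √‖p.Γ⁻¹‖ * ‖y‖) ^ 2 with hκ
  set Z : ℕ → Ω → ℝ := fun m ω => ⟪p.F χ L, θ m ω - p.postMean L y⟫_ℝ with hZ
  have hZm : ∀ m, MemLp (Z m) 2 P := fun m => (innerSL ℝ (p.F χ L)).comp_memLp' (hmem m)
  have hb : ∀ m s, |∫ ω, Z (m + s) ω * Z m ω ∂P| ≤
      (2 + |C₀| + (|C₀| + √‖p.Γ⁻¹‖ * ‖y‖) ^ 2) * ‖p.sqrtCov χ‖ ^ 2 * q ^ s := fun m s => by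
    rw [hmom m s, second_moment_form (p.postA_posDef L) hGt, ← energyIter, ← energyF]
    set D := CFC.sqrt (p.postA L) * cross P (fun ω => θ 0 ω - p.postMean L y)
      (fun ω => θ 0 ω - p.postMean L y) * CFC.sqrt (p.postA L) - 1
    have hD : ‖D‖ ≤ κ + 1 := (norm_sub_le _ _).trans
      (add_le_add (norm_initial_second_moment_le h.exists_noise.1 h0) norm_one_le)
    have hw := p.norm_sqrt_inv_F_le χ L
    rw [← energyF] at hw
    have h1 := abs_inner_pow_le (p.energyIter k L) s (p.energyF χ L)
    have h2 := abs_inner_pow_mul_pow_le (D := D) hGt s m (p.energyF χ L)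
    have hσs : ‖p.energyIter k L‖ ^ s ≤ q ^ s := pow_le_pow_left₀ hσ0 hσ s
    have hσs' : ‖p.energyIter k L‖ ^ (s + 2 * m) ≤ q ^ s :=
      (pow_le_pow_of_le_one hσ0 (hσ.trans hq1.le) (Nat.le_add_right _ _)).trans hσs
    have hq : 0 ≤ q ^ s := pow_nonneg (hσ0.trans hσ) s
    have hκ0 : 0 ≤ κ := by positivity
    calc _ ≤ _ := abs_add_le _ _
      -- The stationary part contributes one and the transient `‖D‖ ≤ κ + 1`, which gives the
      -- constant `2 + κ`. Replacing the rate by `q` and dropping the decay in `m` makes it uniform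
      -- in level and time.
      _ ≤ q ^ s * ‖p.sqrtCov χ‖ ^ 2 + (κ + 1) * q ^ s * ‖p.sqrtCov χ‖ ^ 2 := by
        refine add_le_add (h1.trans ?_) (h2.trans ?_) <;> gcongr
      _ = _ := by rw [hκ]; ring
  have hsum := integral_sum_sq_le (hσ0.trans hσ) hq1 hZm hb M
  have herr : ∀ ω, |p.target χ L y - p.estimator χ L θ M ω| ^ 2 =
      (1 / (M : ℝ)) ^ 2 * (∑ m ∈ Finset.Icc 1 M, Z m ω) ^ 2 := fun ω => by
    have h1 : ∑ m ∈ Finset.Icc 1 M, p.qoi χ L θ m ω =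
        (∑ m ∈ Finset.Icc 1 M, Z m ω) + M * ⟪p.F χ L, p.postMean L y⟫_ℝ := by
      simp [hZ, qoi, inner_sub_right]
    rw [sq_abs, estimator, target_eq, h1]
    field_simp
    ring
  have hint : Integrable (fun ω => (∑ m ∈ Finset.Icc 1 M, Z m ω) ^ 2) P :=
    (memLp_finsetSum _ fun m _ => hZm m).integrable_sq
  simp only [herr]
  refine ⟨hint.const_mul _, ?_⟩
  rw [integral_const_mul]
  calc _ ≤ (1 / (M : ℝ)) ^ 2 *
        (2 * ((2 + |C₀| + (|C₀| + √‖p.Γ⁻¹‖ * ‖y‖) ^ 2) * ‖p.sqrtCov χ‖ ^ 2) / (1 - q) * M) := by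
        gcongr
    _ = _ := by field_simp

end Chain

end InverseProblem

end MGMC

end

theorem mainTheorem2 {H : Type*} [NormedAddCommGroup H] [InnerProductSpace ℝ H]
    [CompleteSpace H] [TopologicalSpace.SeparableSpace H] {β : ℕ}
    (p : MGMC.InverseProblem H β) (Ψ : ℕ → ℝ)
    (h₁ : p.NormEquivalence) (h₂ : p.RegularityApproximation Ψ) (h₃ : p.InverseInequality Ψ)
    (hsgs : ∃ c : ℝ, ∀ ℓ, 1 ≤ ℓ → ‖p.sgs ℓ‖ ≤ c * ‖p.A ℓ‖)
    (k : ℕ) (hk : 1 ≤ k) :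
    ∃ q : ℝ, 0 ≤ q ∧ q < 1 ∧ (∀ L, p.rate k L ≤ q) ∧
      -- the integrated autocorrelation time
      (∀ C₀ : ℝ, ∃ C : ℝ, 0 < C ∧ ∀ (χ : H) (L : ℕ), p.F χ L ≠ 0 → ∃ τ : ℝ,
        p.IsTauInt k L χ τ ∧
        (∀ (Ω : Type*) [MeasurableSpace Ω] (P : Measure Ω) [IsProbabilityMeasure P]
          (y : MGMC.Vec β) (θ : ℕ → Ω → MGMC.Vec (p.n L)), p.IsMGMCChain k L y P θ →
          HasLaw (θ 0) (p.posterior L y) P →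
          ∀ m : ℕ, MGMC.InverseProblem.HasIACT P (p.qoi χ L θ) m τ) ∧
        τ ≤ (1 + p.rate k L) / (1 - p.rate k L) ∧
        (∀ (Ω : Type*) [MeasurableSpace Ω] (P : Measure Ω) [IsProbabilityMeasure P]
          (y : MGMC.Vec β) (θ : ℕ → Ω → MGMC.Vec (p.n L)), p.IsMGMCChain k L y P θ →
          p.InitialBound L P C₀ (θ 0) →
          ∀ m : ℕ, 1 ≤ m → ∃ τm : ℝ, MGMC.InverseProblem.HasIACT P (p.qoi χ L θ) m τm ∧
            |τm - τ| ≤ C * (p.rate k L ^ (2 * m + 1) /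
              ((1 - p.rate k L) * (1 - p.rate k L ^ (2 * m)))))) ∧
      -- the root-mean-square error
      (∀ (C₀ : ℝ) (χ : H), ∃ C : ℝ → ℝ, (∀ r, 0 < C r) ∧
        ∀ (L : ℕ) (Ω : Type*) [MeasurableSpace Ω] (P : Measure Ω) [IsProbabilityMeasure P]
          (y : MGMC.Vec β) (θ : ℕ → Ω → MGMC.Vec (p.n L)), p.IsMGMCChain k L y P θ →
          p.InitialBound L P C₀ (θ 0) →
          ∀ M : ℕ, 1 ≤ M →
            Integrable (fun ω => |p.target χ L y - p.estimator χ L θ M ω| ^ 2) P ∧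
            √(∫ ω, |p.target χ L y - p.estimator χ L θ M ω| ^ 2 ∂P) ≤ C ‖y‖ / √(M : ℝ)) := by
  obtain ⟨q, hq0, hq1, hq⟩ := p.exists_cycle_contraction h₁ h₂ h₃ hsgs hk
  have hE := fun L => MGMC.energy_conj (p.postA_posDef L) hq0 (hq L).1 (hq L).2
  have hG : ∀ L, (p.energyIter k L).PosSemidef := fun L => (hE L).1
  have hrate : ∀ L, p.rate k L ≤ q := fun L => (hE L).2
  have hlt : ∀ L, p.rate k L < 1 := fun L => (hrate L).trans_lt hq1
  -- The norm of the scaled initial covariance minus the identity is at most `|C₀| + 1`, and the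
  -- perturbed series costs a factor four. The constant involves neither `χ` nor `L`.
  refine ⟨q, hq0, hq1, hrate, fun C₀ => ⟨4 * (|C₀| + 1), by positivity, fun χ L hF => ?_⟩,
    fun C₀ χ => ?_⟩
  · obtain ⟨hτ, hle⟩ := MGMC.InverseProblem.isTauInt_tauInt (hG L) (hlt L) hF
    exact ⟨p.tauInt k L χ, hτ,
      fun Ω _ P _ y θ h h0 m => h.hasIACT_of_posterior (hG L) (hlt L) hF h0 m, hle,
      fun Ω _ P _ y θ h h0 m hm => h.exists_hasIACT (hG L) (hlt L) hF h0 hm⟩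
  -- The summand one only keeps the constant positive when `𝒜^{-1/2} χ = 0`.
  · refine ⟨fun r => √(2 * ((2 + |C₀| + (|C₀| + √‖p.Γ⁻¹‖ * r) ^ 2) * ‖p.sqrtCov χ‖ ^ 2) /
      (1 - q)) + 1, fun r => by positivity, fun L Ω _ P _ y θ h h0 M hM => ?_⟩
    obtain ⟨hint, hle⟩ := h.estimator_error (hG L) (hrate L) hq1 χ h0 hM
    refine ⟨hint, (Real.sqrt_le_sqrt hle).trans ?_⟩
    rw [Real.sqrt_div' _ (Nat.cast_nonneg M)]
    gcongr
    linarith
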